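/- **Notation.** Let $\Gamma_0$ be a counterclockwise circle of radius $\delta>0$ about $0$ and $L_+$ an upward vertical line $\mathrm{Re}\,z=c$ with $c>\delta$. For $r\in\mathbb Z_{\ge 0}$, $\rho\in\mathbb Z$, $\beta\in\mathbb R$ and the Vandermonde determinant $\Delta_n$, put $$\Theta_r(v,z)=\Big[\prod_{\alpha=1}^r\int_{L_+}\frac{dw_\alpha}{2\pi i}\frac{e^{2w_\alpha^2+\beta w_\alpha}}{w_\alpha^\rho}\,\frac{z-w_\alpha}{v-w_\alpha}\Big]\Delta_r^2(w),$$ $$\Theta^{\pm}_{r\mp1}(v,z)=\Big[\prod_{\alpha=1}^{r\mp1}\int_{L_+}\frac{dw_\alpha}{2\pi i}\frac{e^{2w_\alpha^2+\beta w_\alpha}}{w_\alpha^\rho}\big((z-w_\alpha)(v-w_\alpha)\big)^{\pm1}\Big]\Delta_{r\mp1}^2(w),$$ and $\mathbb H^m(z)=\frac{z^{m-1}}{(m-1)!}\mathbf 1_{z\ge0}\mathbf 1_{m\ge1}$. The discrete tacnode kernel, for $\tau_i\in\mathbb Z$ and $\theta_i\in\mathbb R$, is $$\begin{aligned}\mathbb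 L^{\rm dTac}_{r,\rho,\beta}(\tau_1,\theta_1;\tau_2,\theta_2)=&-\mathbb H^{\tau_1-\tau_2}(\theta_2-\theta_1) +\oint_{\Gamma_0}\frac{dv}{(2\pi i)^2}\int_{L_+}\frac{dz}{z-v}\frac{v^{\rho-\tau_1}}{z^{\rho-\tau_2}}\frac{e^{-v^2-\theta_1v}}{e^{-z^2-\theta_2z}}\frac{\Theta_r(v,z)}{\Theta_r(0,0)}\\ &+\oint_{\Gamma_0}\frac{dv}{(2\pi i)^2}\int_{L_+}\frac{dz}{z-v}\frac{v^{\tau_2}}{z^{\tau_1}}\frac{e^{-v^2+(\theta_2-\beta)v}}{e^{-z^2+(\theta_1-\beta)z}}\frac{\Theta_r(v,z)}{\Theta_r(0,0)}\\ &+r\int_{L_+}\frac{dv}{(2\pi i)^2}\int_{L_+}dz\,\frac{v^{-\tau_1}}{z^{\rho-\tau_2}}\frac{e^{v^2-(\theta_1-\beta)v}}{e^{-z^2-\theta_2z}}\frac{\Theta^+_{r-1}(v,z)}{\Theta_r(0,0)}\\ &-\frac1{r+1}\oint_{\Gamma_0}\frac{dv}{(2\pi i)^2}\oint_{\Gamma_0}dz\,\frac{v^{\rho-\tau_1}}{z^{-\tau_2}}\frac{e^{-v^2-\theta_1v}}{e^{z^2-(\theta_2-\beta)z}}\frac{\Theta^-_{r+1}(v,z)}{\Theta_r(0,0)}.\end{aligned}$$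 (For $r=0$ one has $\Theta_0=1$, and the term with the factor $r$ is $0$.) Let $H^{\rm p}_j$ be the probabilists' and $H_j(x)=2^{j/2}H^{\rm p}_j(\sqrt2x)$ the physicists' Hermite polynomials, let $$F^\xi_\tau(v)=\sum_{j=0}^{\tau-1}\frac{H^{\rm p}_j(-\xi)}{j!}v^j\quad(=0\text{ for }\tau\le0),\qquad K_r(x,y)=\sum_{j=0}^{r-1}\frac{H_j(x)H_j(y)}{\sqrt\pi\,2^jj!}e^{-(x^2+y^2)/2}$$ ($K_r$ is the GUE kernel), and for $\tau\in\mathbb Z$, $\xi\in\mathbb R$ define the operators $$\mathcal D^\tau_\xi(u)[g(u)]=g^{(\tau)}(\xi)\ (\tau\ge0),\qquad \mathcal D^\tau_\xi(u)[g(u)]=-\int_\xi^\infty\frac{(\xi-u)^{-\tau-1}}{(-\tau-1)!}g(u)\,du\ (\tau<0),$$ $$\mathcal E^\tau_\xi(v)[g(v)]=\sqrt{2\pi}\oint_{\Gamma_0}\frac{dw\,e^{-w^2/2-\xi w}}{2\pi i\,(-w)^{-\tau}}\int_{L_+}\frac{dv\,e^{v^2/2}}{2\pi i\,(w-v)}g(v),$$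 $$\mathcal F^{(\tau)}_\xi(u)[g(u)]=\mathcal D^\tau_\xi(u)[g(u)]+\mathcal E^\tau_\xi(v)\Big[\int_{\mathbb R}\frac{du}{\sqrt{2\pi}}e^{uv}g(u)\Big].$$ **Theorem.** Let $r\in\mathbb Z_{\ge0}$, $\tau_1,\tau_2\in\mathbb Z$, $\xi_1,\xi_2\in\mathbb R$ and $\rho=\beta=0$. Then $\Theta_r(0,0)\ne0$, and for every choice of signs $\varepsilon_1,\varepsilon_2\in\{1,-1\}$ $$(\sqrt2)^{\tau_2-\tau_1}\,\mathbb L^{\rm dTac}_{r,0,0}(\tau_1,\xi_1\sqrt2;\tau_2,\xi_2\sqrt2)\,\sqrt2=\mathbb L_0+\mathbb L_1+\mathbb L_2,$$ where $$\mathbb L_0=-\mathbb H^{\tau_1-\tau_2}(\xi_2-\xi_1),$$ $$\mathbb L_1=\int_{L_+}\frac{e^{v^2/2}\,dv}{2\pi i\,v^{\tau_1-\tau_2}}\Big(e^{\xi_2v}F^{\xi_1}_{\tau_1}(v)+e^{-\xi_1v}F^{-\xi_2}_{-\tau_2}(v)-e^{v^2/2}F^{\xi_1}_{\tau_1}(v)F^{-\xi_2}_{-\tau_2}(v)\Big),$$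 $$\mathbb L_2=(-1)^{\tau_1-\tau_2}\varepsilon_1^{\tau_1}\varepsilon_2^{\tau_2}\,\mathcal F^{(-\tau_1)}_{\varepsilon_1\xi_1}(u_1)\,\mathcal F^{(\tau_2)}_{-\varepsilon_2\xi_2}(u_2)\,K_r(\varepsilon_1u_1,-\varepsilon_2u_2).$$ Moreover $\mathbb L_1=\mathbb L^+_{11}+\mathbb L^+_{12}+\mathbb L^+_{13}$, the integrals of the three summands in the bracket, and $\mathbb L_2$ does not depend on $\varepsilon_1,\varepsilon_2$. All this holds for every admissible pair of contours $\Gamma_0,L_+$ in the kernel on the left and every admissible pair on the right. -/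

import Mathlib

open scoped Real Nat

namespace Tacnode

noncomputable section

/-- `(2πi)⁻¹ ∮_{Γ₀} g(z) dz`, with `Γ₀` the counterclockwise circle of radius `δ` about `0`. -/
def circInt (δ : ℝ) (g : ℂ → ℂ) : ℂ :=
  (2 * π * Complex.I)⁻¹ * ∮ z in C(0, δ), g z

/-- `(2πi)⁻¹ ∫_{L₊} g(z) dz`, with `L₊` the upward vertical line `Re z = c`, parametrized
by `z = c + i t`, `dz = i dt`. -/
def lineInt (c : ℝ) (g : ℂ → ℂ) : ℂ :=
  (2 * π * Complex.I)⁻¹ * ∫ t : ℝ, g (c + t * Complex.I) * Complex.I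

/-- The `n`-fold integral `∫_{L₊ⁿ} g(w₁,…,wₙ) ∏ dw_α/(2πi)`. -/
def lineIntN (c : ℝ) (n : ℕ) (g : (Fin n → ℂ) → ℂ) : ℂ :=
  ((2 * π * Complex.I)⁻¹) ^ n *
    ∫ t : Fin n → ℝ, g (fun α => c + t α * Complex.I) * Complex.I ^ n

/-- The squared Vandermonde determinant `Δₙ²(w₁,…,wₙ)`. -/
def vandSq {n : ℕ} (w : Fin n → ℂ) : ℂ := (Matrix.vandermonde w).det ^ 2

/-- `Θ_r(v, z)`, with parameters `ρ`, `β`. -/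
def Theta (c : ℝ) (r : ℕ) (ρ : ℤ) (β : ℝ) (v z : ℂ) : ℂ :=
  lineIntN c r fun w =>
    (∏ α, Complex.exp (2 * w α ^ 2 + β * w α) / w α ^ ρ * ((z - w α) / (v - w α))) * vandSq w

/-- `Θ⁺_n(v, z)`: the `n`-fold integral with `((z - w_α)(v - w_α))⁺¹`. -/
def ThetaPlus (c : ℝ) (n : ℕ) (ρ : ℤ) (β : ℝ) (v z : ℂ) : ℂ :=
  lineIntN c n fun w =>
    (∏ α, Complex.exp (2 * w α ^ 2 + β * w α) / w α ^ ρ * ((z - w α) * (v - w α))) * vandSq w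

/-- `Θ⁻_n(v, z)`: the `n`-fold integral with `((z - w_α)(v - w_α))⁻¹`. -/
def ThetaMinus (c : ℝ) (n : ℕ) (ρ : ℤ) (β : ℝ) (v z : ℂ) : ℂ :=
  lineIntN c n fun w =>
    (∏ α, Complex.exp (2 * w α ^ 2 + β * w α) / w α ^ ρ * ((z - w α) * (v - w α))⁻¹) * vandSq w

/-- The Heaviside function `ℍ^m(z) = z^(m-1)/(m-1)! · 1_{z ≥ 0} · 1_{m ≥ 1}`. -/
def heaviside (m : ℤ) (z : ℝ) : ℝ :=
  if 1 ≤ m ∧ 0 ≤ z then z ^ (m - 1).toNat / ((m - 1).toNat)! else 0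

/-- The discrete tacnode kernel `𝕃^{dTac}_{r,ρ,β}(τ₁, θ₁; τ₂, θ₂)`, written with the circle of
radius `δ` for `Γ₀` and the line `Re = c` for `L₊` (where `0 < δ < c`). The number `r - 1` occurs
only in a term with the factor `r`. -/
def dTac (δ c : ℝ) (r : ℕ) (ρ : ℤ) (β : ℝ) (τ₁ : ℤ) (θ₁ : ℝ) (τ₂ : ℤ) (θ₂ : ℝ) : ℂ :=
  -(heaviside (τ₁ - τ₂) (θ₂ - θ₁) : ℂ)
  + circInt δ (fun v => lineInt c fun z =>
      1 / (z - v) * (v ^ (ρ - τ₁) / z ^ (ρ - τ₂))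
        * (Complex.exp (-v ^ 2 - θ₁ * v) / Complex.exp (-z ^ 2 - θ₂ * z))
        * (Theta c r ρ β v z / Theta c r ρ β 0 0))
  + circInt δ (fun v => lineInt c fun z =>
      1 / (z - v) * (v ^ τ₂ / z ^ τ₁)
        * (Complex.exp (-v ^ 2 + (θ₂ - β) * v) / Complex.exp (-z ^ 2 + (θ₁ - β) * z))
        * (Theta c r ρ β v z / Theta c r ρ β 0 0))
  + r * lineInt c (fun v => lineInt c fun z =>
      v ^ (-τ₁) / z ^ (ρ - τ₂)
        * (Complex.exp (v ^ 2 - (θ₁ - β) * v) / Complex.exp (-z ^ 2 - θ₂ * z))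
        * (ThetaPlus c (r - 1) ρ β v z / Theta c r ρ β 0 0))
  - 1 / (r + 1) * circInt δ (fun v => circInt δ fun z =>
      v ^ (ρ - τ₁) / z ^ (-τ₂)
        * (Complex.exp (-v ^ 2 - θ₁ * v) / Complex.exp (z ^ 2 - (θ₂ - β) * z))
        * (ThetaMinus c (r + 1) ρ β v z / Theta c r ρ β 0 0))

/-- The probabilists' Hermite polynomial `Hᵖ_j(x)`. -/
def hermiteP (j : ℕ) (x : ℝ) : ℝ := Polynomial.aeval x (Polynomial.hermite j)

/-- The physicists' Hermite polynomial `H_j(x) = 2^(j/2) Hᵖ_j(√2 x)`. -/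
def hermiteH (j : ℕ) (x : ℝ) : ℝ := √2 ^ j * hermiteP j (√2 * x)

/-- The GUE kernel
`K_r(x, y) = ∑_{j<r} H_j(x) H_j(y) e^{-(x²+y²)/2} / (√π 2^j j!)`. -/
def gue (r : ℕ) (x y : ℝ) : ℝ :=
  ∑ j ∈ Finset.range r,
    hermiteH j x * hermiteH j y / (√π * 2 ^ j * j !) * Real.exp (-(x ^ 2 + y ^ 2) / 2)

/-- `F^ξ_τ(v) = ∑_{j=0}^{τ-1} Hᵖ_j(-ξ) v^j / j!`, which is `0` for `τ ≤ 0`. -/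
def truncF (ξ : ℝ) (τ : ℤ) (v : ℂ) : ℂ :=
  ∑ j ∈ Finset.range τ.toNat, ((hermiteP j (-ξ) / j ! : ℝ) : ℂ) * v ^ j

/-- The `τ`-fold (anti)derivative operator `𝒟_ξ^τ`. -/
def opD (τ : ℤ) (ξ : ℝ) (g : ℝ → ℂ) : ℂ :=
  if 0 ≤ τ then iteratedDeriv τ.toNat g ξ
  else -∫ u in Set.Ioi ξ, (((ξ - u) ^ (-τ - 1).toNat / ((-τ - 1).toNat)! : ℝ) : ℂ) * g u

/-- The integral operator
`ℰ_ξ^τ g = √(2π) ∮_{Γ₀} dw e^{-w²/2-ξw} / (2πi (-w)^{-τ}) ∫_{L₊} dv e^{v²/2} / (2πi (w-v)) g(v)`. -/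
def opE (δ c : ℝ) (τ : ℤ) (ξ : ℝ) (g : ℂ → ℂ) : ℂ :=
  (√(2 * π) : ℂ) * circInt δ fun w =>
    Complex.exp (-w ^ 2 / 2 - ξ * w) / (-w) ^ (-τ)
      * lineInt c fun v => Complex.exp (v ^ 2 / 2) / (w - v) * g v

/-- `ℱ_ξ^{(τ)} g = 𝒟_ξ^τ g + ℰ_ξ^τ(v) [∫_ℝ du/√(2π) e^{uv} g(u)]`. -/
def opF (δ c : ℝ) (τ : ℤ) (ξ : ℝ) (g : ℝ → ℂ) : ℂ :=
  opD τ ξ g + opE δ c τ ξ fun v =>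
    ∫ u : ℝ, (1 / (√(2 * π) : ℂ)) * Complex.exp (u * v) * g u

/-- The Heaviside part. -/
def partL0 (τ₁ : ℤ) (ξ₁ : ℝ) (τ₂ : ℤ) (ξ₂ : ℝ) : ℂ :=
  -(heaviside (τ₁ - τ₂) (ξ₂ - ξ₁) : ℂ)

/-- The single-integral part. -/
def partL1 (c : ℝ) (τ₁ : ℤ) (ξ₁ : ℝ) (τ₂ : ℤ) (ξ₂ : ℝ) : ℂ :=
  lineInt c fun v =>
    Complex.exp (v ^ 2 / 2) / v ^ (τ₁ - τ₂)
      * (Complex.exp (ξ₂ * v) * truncF ξ₁ τ₁ v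
        + Complex.exp (-ξ₁ * v) * truncF (-ξ₂) (-τ₂) v
        - Complex.exp (v ^ 2 / 2) * truncF ξ₁ τ₁ v * truncF (-ξ₂) (-τ₂) v)

/-- The first of the three terms of the single-integral part. -/
def partL11 (c : ℝ) (τ₁ : ℤ) (ξ₁ : ℝ) (τ₂ : ℤ) (ξ₂ : ℝ) : ℂ :=
  lineInt c fun v =>
    Complex.exp (v ^ 2 / 2) / v ^ (τ₁ - τ₂) * (Complex.exp (ξ₂ * v) * truncF ξ₁ τ₁ v)

/-- The second of the three terms of the single-integral part. -/
def partL12 (c : ℝ) (τ₁ : ℤ) (ξ₁ : ℝ) (τ₂ : ℤ) (ξ₂ : ℝ) : ℂ :=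
  lineInt c fun v =>
    Complex.exp (v ^ 2 / 2) / v ^ (τ₁ - τ₂) * (Complex.exp (-ξ₁ * v) * truncF (-ξ₂) (-τ₂) v)

/-- The third of the three terms of the single-integral part. -/
def partL13 (c : ℝ) (τ₁ : ℤ) (ξ₁ : ℝ) (τ₂ : ℤ) (ξ₂ : ℝ) : ℂ :=
  lineInt c fun v =>
    Complex.exp (v ^ 2 / 2) / v ^ (τ₁ - τ₂)
      * (-(Complex.exp (v ^ 2 / 2) * truncF ξ₁ τ₁ v * truncF (-ξ₂) (-τ₂) v))

/-- `(-1)^{τ₁-τ₂} ε₁^{τ₁} ε₂^{τ₂} ℱ^{(-τ₁)}_{ε₁ξ₁}(u₁) ℱ^{(τ₂)}_{-ε₂ξ₂}(u₂) K_r(ε₁u₁, -ε₂u₂)`. -/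
def partL2 (δ c : ℝ) (ε₁ ε₂ : ℝ) (r : ℕ) (τ₁ : ℤ) (ξ₁ : ℝ) (τ₂ : ℤ) (ξ₂ : ℝ) : ℂ :=
  (-1 : ℂ) ^ (τ₁ - τ₂) * (ε₁ : ℂ) ^ τ₁ * (ε₂ : ℂ) ^ τ₂
    * opF δ c (-τ₁) (ε₁ * ξ₁) fun u₁ =>
        opF δ c τ₂ (-ε₂ * ξ₂) fun u₂ => (gue r (ε₁ * u₁) (-ε₂ * u₂) : ℂ)

end

end Tacnode

open scoped Real Nat

namespace Tacnode

open MeasureTheory Filter Topology Complex Polynomial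

/-! At ρ = β = 0 the multiple integrals carry the weight e^{2w²} on a vertical line. Its monic
orthogonal polynomials q_j are Hermite polynomials of imaginary argument (`mpoly (1 / 4)`), with
squared norms h_j ≠ 0 (`mnorm`).

Expanding two bordered Vandermonde determinants in the q_j shows that r Θ⁺_{r-1}(v,z)/Θ_r(0,0) is
the Christoffel-Darboux kernel Σ q_j(v) q_j(z)/h_j (`ThetaPlus_eq_cdKernel`). Lagrange interpolation
peels one variable off the other two integrals. With C_j the Cauchy transform of e^{2x²} q_j, it
gives Θ_r(v,z)/Θ_r(0,0) = 1 - (z-v) Σ q_j(z) C_j(v)/h_j, and a similar formula for Θ⁻_{r+1}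
(`Theta_div`, `ThetaMinus_div`).

After this, every circle variable occurs only in a Cauchy factor 1/(w-v) against v^τ e^{-v²-θv}. By
Fubini and residues at 0 the circle integral becomes w^τ times a Taylor polynomial of the Hermite
generating function, which is the truncation F (`circInt_hermGen_cauchy`). The four double integrals
thus yield three single integrals, together with four finite sums that factor as Σ h_j⁻¹ (X_j -
Y_j)(X'_j - Y'_j) (`dTac_eq`). Rescaling the variables by √2 turns the single integrals into 𝕃₁ and
each difference into a line integral `lineF` (`dTac_scaled`).

For 𝕃₂, the GUE kernel is expanded in functions u ↦ ∫ e^{-uv} e^{v²/2} P(v) dv/(2πi), which are the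
Hermite functions (`gaussT_mpoly`). On these 𝒟^τ multiplies the integrand by (-v)^τ, and ℰ^τ, after
Laplace inversion, supplies the subtracted Taylor polynomial; so ℱ^{(τ)} produces exactly (-1)^τ
`lineF` (`opF_gaussT`).

The signs ε drop out because the integrand of `lineF` extends to an entire function: e^{-ξv} equals
e^{v²/2} times the generating function, and the initial Taylor terms that v^τ would turn into poles
have been removed. The line may therefore cross 0, and v ↦ -v gives a parity rule (`lineF_shift`,
`lineF_neg`). Independence of the contours follows from the same shifts. -/

/-! ### Functions of polynomial growth on strips, and Gaussian bounds -/

/-- The closed vertical strip `a ≤ Re z ≤ b`. -/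
def vstrip (a b : ℝ) : Set ℂ := {z | a ≤ z.re ∧ z.re ≤ b}

/-- The product of `n` vertical lines `Re z = c`. -/
def vlines (c : ℝ) (n : ℕ) : Set (Fin n → ℂ) := {w | ∀ α, w α ∈ vstrip c c}

/-- Continuity together with a polynomial bound on `S`. -/
structure PolyGrowthOn {E : Type*} [NormedAddCommGroup E] (S : Set E) (f : E → ℂ) : Prop where
  cont : ContinuousOn f S
  bound : ∃ C : ℝ, ∃ k : ℕ, 0 ≤ C ∧ ∀ z ∈ S, ‖f z‖ ≤ C * (1 + ‖z‖) ^ k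

namespace PolyGrowthOn

variable {E F : Type*} [NormedAddCommGroup E] [NormedAddCommGroup F] {S T : Set E} {f g : E → ℂ}

theorem const (a : ℂ) : PolyGrowthOn S (fun _ => a) :=
  ⟨continuousOn_const, ‖a‖, 0, norm_nonneg _, fun z _ => by simp⟩

theorem of_bounded (hf : ContinuousOn f S) {C : ℝ} (hC : ∀ z ∈ S, ‖f z‖ ≤ C) :
    PolyGrowthOn S f :=
  ⟨hf, max C 0, 0, le_max_right _ _, fun z hz => by simpa using Or.inl (hC z hz)⟩

theorem mono (hf : PolyGrowthOn T f) (h : S ⊆ T) : PolyGrowthOn S f := by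
  obtain ⟨C, k, hC, hb⟩ := hf.bound
  exact ⟨hf.cont.mono h, C, k, hC, fun z hz => hb z (h hz)⟩

theorem congr (hf : PolyGrowthOn S f) (h : ∀ z ∈ S, g z = f z) : PolyGrowthOn S g := by
  obtain ⟨C, k, hC, hb⟩ := hf.bound
  exact ⟨hf.cont.congr h, C, k, hC, fun z hz => by rw [h z hz]; exact hb z hz⟩

theorem mul (hf : PolyGrowthOn S f) (hg : PolyGrowthOn S g) :
    PolyGrowthOn S (fun z => f z * g z) := by
  obtain ⟨C, k, hC, hb⟩ := hf.bound
  obtain ⟨D, l, hD, hd⟩ := hg.bound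
  refine ⟨hf.cont.mul hg.cont, C * D, k + l, by positivity, fun z hz => ?_⟩
  calc ‖f z * g z‖ = ‖f z‖ * ‖g z‖ := norm_mul _ _
    _ ≤ (C * (1 + ‖z‖) ^ k) * (D * (1 + ‖z‖) ^ l) :=
        mul_le_mul (hb z hz) (hd z hz) (norm_nonneg _) (by positivity)
    _ = _ := by ring

theorem add (hf : PolyGrowthOn S f) (hg : PolyGrowthOn S g) :
    PolyGrowthOn S (fun z => f z + g z) := by
  obtain ⟨C, k, hC, hb⟩ := hf.bound
  obtain ⟨D, l, hD, hd⟩ := hg.bound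
  refine ⟨hf.cont.add hg.cont, C + D, k + l, by positivity, fun z hz => ?_⟩
  have h1 : (1 : ℝ) ≤ 1 + ‖z‖ := by simp
  calc ‖f z + g z‖ ≤ ‖f z‖ + ‖g z‖ := norm_add_le _ _
    _ ≤ C * (1 + ‖z‖) ^ k + D * (1 + ‖z‖) ^ l := add_le_add (hb z hz) (hd z hz)
    _ ≤ C * (1 + ‖z‖) ^ (k + l) + D * (1 + ‖z‖) ^ (k + l) := by
        gcongr <;> first | exact h1 | omega
    _ = _ := by ring

theorem const_mul (a : ℂ) (hf : PolyGrowthOn S f) : PolyGrowthOn S (fun z => a * f z) :=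
  (const a).mul hf

theorem neg (hf : PolyGrowthOn S f) : PolyGrowthOn S (fun z => -f z) :=
  (hf.const_mul (-1)).congr fun z _ => by ring

theorem sub (hf : PolyGrowthOn S f) (hg : PolyGrowthOn S g) :
    PolyGrowthOn S (fun z => f z - g z) :=
  (hf.add hg.neg).congr fun z _ => by ring

theorem pow (hf : PolyGrowthOn S f) (n : ℕ) : PolyGrowthOn S (fun z => f z ^ n) := by
  induction n with
  | zero => simpa using const 1
  | succ n ih => exact (ih.mul hf).congr fun z _ => pow_succ _ _

theorem sum {ι : Type*} (s : Finset ι) {f : ι → E → ℂ} (hf : ∀ i ∈ s, PolyGrowthOn S (f i)) :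
    PolyGrowthOn S (fun z => ∑ i ∈ s, f i z) := by
  classical
  induction s using Finset.induction_on with
  | empty => simpa using const 0
  | insert a s ha ih =>
    refine ((hf a (by simp)).add (ih fun i hi => hf i (by simp [hi]))).congr fun z _ => ?_
    rw [Finset.sum_insert ha]

theorem prod {ι : Type*} (s : Finset ι) {f : ι → E → ℂ} (hf : ∀ i ∈ s, PolyGrowthOn S (f i)) :
    PolyGrowthOn S (fun z => ∏ i ∈ s, f i z) := by
  classical
  induction s using Finset.induction_on with
  | empty => simpa using const 1
  | insert a s ha ih =>
    refine ((hf a (by simp)).mul (ih fun i hi => hf i (by simp [hi]))).congr fun z _ => ?_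
    rw [Finset.prod_insert ha]

theorem inv (hf : ContinuousOn f S) {ε : ℝ} (hε : 0 < ε) (h : ∀ z ∈ S, ε ≤ ‖f z‖) :
    PolyGrowthOn S (fun z => (f z)⁻¹) := by
  refine of_bounded (C := ε⁻¹) (hf.inv₀ fun z hz h0 => ?_) fun z hz => ?_
  · have := h z hz
    rw [h0, norm_zero] at this
    linarith
  · rw [norm_inv]
    exact inv_anti₀ hε (h z hz)

theorem comp {U : Set F} {p : F → E} (hf : PolyGrowthOn S f) (hp : ContinuousOn p U)
    (hm : Set.MapsTo p U S) (hn : ∀ w, ‖p w‖ ≤ ‖w‖) : PolyGrowthOn U (fun w => f (p w)) := by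
  obtain ⟨C, k, hC, hb⟩ := hf.bound
  refine ⟨hf.cont.comp hp hm, C, k, hC, fun w hw => (hb _ (hm hw)).trans ?_⟩
  gcongr
  exact hn w

theorem id {S : Set ℂ} : PolyGrowthOn S (fun z => z) :=
  ⟨continuousOn_id, 1, 1, zero_le_one, fun z _ => by simp⟩

theorem polynomial {S : Set ℂ} (p : Polynomial ℂ) : PolyGrowthOn S (fun z => p.eval z) := by
  refine (sum p.support (f := fun n z => p.coeff n * z ^ n)
    fun n _ => (id.pow n).const_mul _).congr fun z _ => ?_
  rw [Polynomial.eval_eq_sum, Polynomial.sum]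

theorem apply {n : ℕ} {S : Set ℂ} {f : ℂ → ℂ} {U : Set (Fin n → ℂ)} (hf : PolyGrowthOn S f)
    (α : Fin n) (hU : ∀ w ∈ U, w α ∈ S) : PolyGrowthOn U (fun w => f (w α)) :=
  hf.comp (p := fun w => w α) (continuous_apply α).continuousOn (fun w hw => hU w hw)
    fun w => norm_le_pi_norm w α

theorem cexp_mul {a b : ℝ} (x : ℝ) : PolyGrowthOn (vstrip a b) (fun z => cexp (x * z)) := by
  refine of_bounded (C := Real.exp (|x| * (|a| + |b|))) (by fun_prop) fun z hz => ?_
  rw [Complex.norm_exp, Real.exp_le_exp]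
  have h : |z.re| ≤ |a| + |b| := by
    rw [abs_le]
    constructor
    · linarith [hz.1, neg_abs_le a, abs_nonneg b]
    · linarith [hz.2, le_abs_self b, abs_nonneg a]
  calc (x * z).re = x * z.re := by simp
    _ ≤ |x * z.re| := le_abs_self _
    _ = |x| * |z.re| := abs_mul _ _
    _ ≤ _ := by gcongr

theorem norm_cexp_mul_sq (κ : ℝ) (z : ℂ) :
    ‖cexp (κ * z ^ 2)‖ = Real.exp (κ * z.re ^ 2) * Real.exp (-κ * z.im ^ 2) := by
  rw [Complex.norm_exp, ← Real.exp_add]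
  congr 1
  simp [pow_two]
  ring

theorem sq_re_le {a b : ℝ} {z : ℂ} (hz : z ∈ vstrip a b) : z.re ^ 2 ≤ a ^ 2 + b ^ 2 := by
  rcases le_total 0 z.re with h | h
  · nlinarith [hz.2, sq_nonneg a]
  · nlinarith [hz.1, sq_nonneg b]

/-- On a strip |e^{κz²}| = e^{κ(Re z)² - κ(Im z)²} is bounded. A surplus Gaussian factor may thus be
counted with the coefficient, leaving another one for the decay. -/
theorem cexp_sq {a b κ : ℝ} (hκ : 0 ≤ κ) :
    PolyGrowthOn (vstrip a b) (fun z => cexp (κ * z ^ 2)) := by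
  refine of_bounded (C := Real.exp (κ * (a ^ 2 + b ^ 2))) (by fun_prop) fun z hz => ?_
  rw [norm_cexp_mul_sq, ← Real.exp_add, Real.exp_le_exp]
  nlinarith [mul_le_mul_of_nonneg_left (sq_re_le hz) hκ, mul_nonneg hκ (sq_nonneg z.im)]

theorem zpow {a b : ℝ} (ha : 0 < a) (m : ℤ) : PolyGrowthOn (vstrip a b) (fun z => z ^ m) := by
  have hinv : PolyGrowthOn (vstrip a b) (fun z => z⁻¹) :=
    inv continuousOn_id ha fun z hz => (hz.1.trans (le_abs_self _)).trans (abs_re_le_norm z)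
  cases m with
  | ofNat n => simpa using id.pow n
  | negSucc n => simpa [zpow_negSucc] using hinv.pow (n + 1)

theorem inv_sub {a b : ℝ} {v : ℂ} (hv : v.re < a) :
    PolyGrowthOn (vstrip a b) (fun z => (v - z)⁻¹) := by
  refine inv (by fun_prop) (sub_pos.2 hv) fun z hz => ?_
  calc a - v.re ≤ z.re - v.re := by linarith [hz.1]
    _ = -(v - z).re := by simp
    _ ≤ ‖v - z‖ := (neg_le_abs _).trans (abs_re_le_norm _)

end PolyGrowthOn

/-- Half of the Gaussian absorbs the power: (1+|x|)^k ≤ e^{k|x|}, and completing the square gives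
k|x| ≤ k²/(2κ) + κx²/2. -/
theorem one_add_pow_mul_exp_le {κ : ℝ} (hκ : 0 < κ) (k : ℕ) (x : ℝ) :
    (1 + |x|) ^ k * Real.exp (-κ * x ^ 2)
      ≤ Real.exp (k ^ 2 / (2 * κ)) * Real.exp (-(κ / 2) * x ^ 2) := by
  have h1 : (1 + |x|) ^ k ≤ Real.exp (k * |x|) := by
    rw [Real.exp_nat_mul]
    gcongr
    linarith [Real.add_one_le_exp |x|]
  refine (mul_le_mul_of_nonneg_right h1 (Real.exp_pos _).le).trans ?_
  rw [← Real.exp_add, ← Real.exp_add, Real.exp_le_exp]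
  have h2 : (k : ℝ) * |x| ≤ k ^ 2 / (2 * κ) + κ / 2 * |x| ^ 2 := by
    have : k ^ 2 / (2 * κ) + κ / 2 * |x| ^ 2 - k * |x| = (k - κ * |x|) ^ 2 / (2 * κ) := by
      field_simp
      ring
    have h3 : 0 ≤ (k - κ * |x|) ^ 2 / (2 * κ) := by positivity
    linarith
  rw [sq_abs] at h2
  linarith

/-- The bound is uniform in Re z. It serves both for integrability on one line and for the vanishing
of the horizontal sides when a line is moved. -/
theorem PolyGrowthOn.gaussian_bound {a b κ : ℝ} (hκ : 0 < κ) {g : ℂ → ℂ}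
    (hg : PolyGrowthOn (vstrip a b) g) :
    ∃ C, 0 ≤ C ∧ ∀ z ∈ vstrip a b,
      ‖cexp (κ * z ^ 2) * g z‖ ≤ C * Real.exp (-(κ / 2) * z.im ^ 2) := by
  obtain ⟨C, k, hC, hb⟩ := hg.bound
  set M : ℝ := |a| + |b| with hM
  have hM0 : 0 ≤ M := by positivity
  refine ⟨Real.exp (κ * (a ^ 2 + b ^ 2)) * (C * ((1 + M) ^ k * Real.exp (k ^ 2 / (2 * κ)))),
    by positivity, fun z hz => ?_⟩
  have hz1 : 1 + ‖z‖ ≤ (1 + M) * (1 + |z.im|) := by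
    have h : |z.re| ≤ M := by
      rw [abs_le]
      constructor
      · linarith [hz.1, neg_abs_le a, abs_nonneg b]
      · linarith [hz.2, le_abs_self b, abs_nonneg a]
    nlinarith [Complex.norm_le_abs_re_add_abs_im z, mul_nonneg hM0 (abs_nonneg z.im)]
  rw [norm_mul, norm_cexp_mul_sq]
  have h1 : Real.exp (κ * z.re ^ 2) ≤ Real.exp (κ * (a ^ 2 + b ^ 2)) :=
    Real.exp_le_exp.2 (mul_le_mul_of_nonneg_left (sq_re_le hz) hκ.le)
  have h2 : ‖g z‖ ≤ C * ((1 + M) ^ k * (1 + |z.im|) ^ k) := by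
    refine (hb z hz).trans ?_
    rw [← mul_pow]
    gcongr
  calc Real.exp (κ * z.re ^ 2) * Real.exp (-κ * z.im ^ 2) * ‖g z‖
      ≤ Real.exp (κ * (a ^ 2 + b ^ 2)) * Real.exp (-κ * z.im ^ 2)
          * (C * ((1 + M) ^ k * (1 + |z.im|) ^ k)) := by gcongr
    _ = Real.exp (κ * (a ^ 2 + b ^ 2)) * (C * ((1 + M) ^ k *
          ((1 + |z.im|) ^ k * Real.exp (-κ * z.im ^ 2)))) := by ring
    _ ≤ Real.exp (κ * (a ^ 2 + b ^ 2)) * (C * ((1 + M) ^ k *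
          (Real.exp (k ^ 2 / (2 * κ)) * Real.exp (-(κ / 2) * z.im ^ 2)))) := by
        gcongr _ * (_ * (_ * ?_))
        exact one_add_pow_mul_exp_le hκ k z.im
    _ = _ := by ring

/-! ### Integrals over vertical lines -/

theorem line_mem_vstrip (c t : ℝ) : (c + t * I : ℂ) ∈ vstrip c c := by simp [vstrip]

/-- Integrability along the line `Re z = c`. -/
def LineIntegrable (c : ℝ) (f : ℂ → ℂ) : Prop := Integrable fun t : ℝ => f (c + t * I)

theorem PolyGrowthOn.lineIntegrable {c κ : ℝ} (hκ : 0 < κ) {g : ℂ → ℂ}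
    (hg : PolyGrowthOn (vstrip c c) g) : LineIntegrable c fun z => cexp (κ * z ^ 2) * g z := by
  obtain ⟨C, hC, hb⟩ := hg.gaussian_bound hκ
  refine Integrable.mono' ((integrable_exp_neg_mul_sq (half_pos hκ)).const_mul C)
    (Continuous.aestronglyMeasurable ?_) (Eventually.of_forall fun t => ?_)
  · refine Continuous.mul (by fun_prop) ?_
    exact hg.cont.comp_continuous (by fun_prop) (line_mem_vstrip c)
  · simpa using hb _ (line_mem_vstrip c t)

theorem LineIntegrable.add {c : ℝ} {f g : ℂ → ℂ} (hf : LineIntegrable c f)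
    (hg : LineIntegrable c g) : LineIntegrable c fun z => f z + g z := Integrable.add hf hg

theorem LineIntegrable.sub {c : ℝ} {f g : ℂ → ℂ} (hf : LineIntegrable c f)
    (hg : LineIntegrable c g) : LineIntegrable c fun z => f z - g z := Integrable.sub hf hg

theorem LineIntegrable.const_mul {c : ℝ} {f : ℂ → ℂ} (a : ℂ) (hf : LineIntegrable c f) :
    LineIntegrable c fun z => a * f z := Integrable.const_mul hf a

theorem lineInt_congr {c : ℝ} {f g : ℂ → ℂ} (h : ∀ z ∈ vstrip c c, f z = g z) :
    lineInt c f = lineInt c g := by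
  unfold lineInt
  simp only [h _ (line_mem_vstrip c _)]

theorem LineIntegrable.congr {c : ℝ} {f g : ℂ → ℂ} (hf : LineIntegrable c f)
    (h : ∀ z ∈ vstrip c c, f z = g z) : LineIntegrable c g := by
  unfold LineIntegrable at *
  simpa only [h _ (line_mem_vstrip c _)] using hf

theorem lineInt_add {c : ℝ} {f g : ℂ → ℂ} (hf : LineIntegrable c f) (hg : LineIntegrable c g) :
    lineInt c (fun z => f z + g z) = lineInt c f + lineInt c g := by
  unfold lineInt
  rw [← mul_add, ← integral_add (hf.mul_const I) (hg.mul_const I)]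
  simp only [add_mul]

theorem lineInt_sub {c : ℝ} {f g : ℂ → ℂ} (hf : LineIntegrable c f) (hg : LineIntegrable c g) :
    lineInt c (fun z => f z - g z) = lineInt c f - lineInt c g := by
  unfold lineInt
  rw [← mul_sub, ← integral_sub (hf.mul_const I) (hg.mul_const I)]
  simp only [sub_mul]

theorem lineInt_const_mul {c : ℝ} (a : ℂ) (f : ℂ → ℂ) :
    lineInt c (fun z => a * f z) = a * lineInt c f := by
  unfold lineInt
  simp only [mul_assoc, integral_const_mul]
  ring

theorem lineInt_mul_const {c : ℝ} (f : ℂ → ℂ) (a : ℂ) :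
    lineInt c (fun z => f z * a) = lineInt c f * a := by
  simp only [mul_comm _ a, lineInt_const_mul]

theorem lineInt_sum {c : ℝ} {ι : Type*} (s : Finset ι) {f : ι → ℂ → ℂ}
    (hf : ∀ i ∈ s, LineIntegrable c (f i)) :
    lineInt c (fun z => ∑ i ∈ s, f i z) = ∑ i ∈ s, lineInt c (f i) := by
  unfold lineInt
  simp only [Finset.sum_mul]
  rw [integral_finsetSum _ fun i hi => (hf i hi).mul_const I, Finset.mul_sum]

theorem lineInt_scale {c s : ℝ} (hs : 0 < s) (f : ℂ → ℂ) :
    lineInt c f = (s : ℂ)⁻¹ * lineInt (s * c) fun y => f (y / s) := by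
  unfold lineInt
  have hs' : (s : ℂ) ≠ 0 := by exact_mod_cast hs.ne'
  have h := Measure.integral_comp_mul_left (fun t : ℝ => f ((((s * c : ℝ) : ℂ) + t * I) / s) * I) s
  have h2 : ∀ t : ℝ, (((s * c : ℝ) : ℂ) + ((s * t : ℝ) : ℂ) * I) / s = c + t * I := by
    intro t
    push_cast
    field_simp
  simp only [h2] at h
  rw [h, abs_of_pos (inv_pos.2 hs), Complex.real_smul]
  push_cast
  ring

theorem lineInt_comp_neg (c : ℝ) (f : ℂ → ℂ) :
    lineInt c (fun z => f (-z)) = lineInt (-c) f := by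
  unfold lineInt
  rw [← integral_neg_eq_self]
  congr 2
  ext t
  congr 2
  push_cast
  ring_nf

/-- The source of the integrations by parts along lines below, hence of the orthogonality and of the
recurrences for `gaussT`. -/
theorem lineInt_deriv_eq_zero {c : ℝ} {f f' : ℂ → ℂ}
    (hd : ∀ z ∈ vstrip c c, HasDerivAt f (f' z) z) (hf : LineIntegrable c f)
    (hf' : LineIntegrable c f') : lineInt c f' = 0 := by
  unfold lineInt
  have : ∀ t : ℝ, HasDerivAt (fun t : ℝ => f (c + t * I)) (f' (c + t * I) * I) t := by
    intro t
    have h1 : HasDerivAt (fun t : ℝ => (c + t * I : ℂ)) I t := by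
      simpa using (((hasDerivAt_id t).ofReal_comp).mul_const I).const_add (c : ℂ)
    exact (hd _ (line_mem_vstrip c t)).comp t h1
  rw [integral_eq_zero_of_hasDerivAt_of_integrable this (hf'.mul_const I) hf, mul_zero]

/-- Moving a vertical contour. -/
theorem lineInt_shift {a b κ : ℝ} (hab : a ≤ b) (hκ : 0 < κ) {g : ℂ → ℂ}
    (hd : DifferentiableOn ℂ g (vstrip a b)) (hg : PolyGrowthOn (vstrip a b) g) :
    lineInt a (fun z => cexp (κ * z ^ 2) * g z) = lineInt b (fun z => cexp (κ * z ^ 2) * g z) := by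
  set f : ℂ → ℂ := fun z => cexp (κ * z ^ 2) * g z with hf
  have hia : LineIntegrable a f := (hg.mono fun z hz => ⟨hz.1, hz.2.trans hab⟩).lineIntegrable hκ
  have hib : LineIntegrable b f := (hg.mono fun z hz => ⟨hab.trans hz.1, hz.2⟩).lineIntegrable hκ
  obtain ⟨C, hC, hb⟩ := hg.gaussian_bound hκ
  have hdf : DifferentiableOn ℂ f (vstrip a b) := DifferentiableOn.mul (by fun_prop) hd
  -- Cauchy's theorem on the rectangle [a, b] × [-T, T]; the horizontal sides σ = ±1 tend to 0 as T
  -- → ∞ by the Gaussian bound.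
  have hrect : ∀ T : ℝ,
      I * (∫ y in -T..T, f (b + y * I)) - I * (∫ y in -T..T, f (a + y * I))
        = (∫ x in a..b, f (x + T * I)) - ∫ x in a..b, f (x + (-T : ℝ) * I) := by
    intro T
    have := Complex.integral_boundary_rect_eq_zero_of_differentiableOn f (a + (-T : ℝ) * I)
      (b + (T : ℝ) * I) (hdf.mono fun z hz => ?_)
    · simp only [add_re, ofReal_re, mul_re, I_re, mul_zero, ofReal_im, I_im, mul_one, sub_self,
        add_zero, add_im, mul_im, zero_add, smul_eq_mul] at this
      linear_combination this
    · have := hz.1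
      simp only [add_re, ofReal_re, mul_re, I_re, mul_zero, ofReal_im, I_im, mul_one, sub_self,
        add_zero, Set.mem_preimage, Set.uIcc_of_le hab] at this
      exact this
  have htop : ∀ σ : ℝ, σ = 1 ∨ σ = -1 →
      Tendsto (fun T : ℝ => ∫ x in a..b, f (x + (σ * T : ℝ) * I)) atTop (𝓝 0) := by
    intro σ hσ
    have hlim : Tendsto (fun T : ℝ => C * Real.exp (-(κ / 2) * T ^ 2) * |b - a|) atTop (𝓝 0) := by
      have h1 : Tendsto (fun T : ℝ => (κ / 2) * T ^ 2) atTop atTop :=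
        (tendsto_pow_atTop two_ne_zero).const_mul_atTop (half_pos hκ)
      have h2 := ((Real.tendsto_exp_neg_atTop_nhds_zero.comp h1).const_mul C).mul_const |b - a|
      simpa [Function.comp_def, neg_mul] using h2
    refine squeeze_zero_norm (fun T => ?_) hlim
    refine intervalIntegral.norm_integral_le_of_norm_le_const fun x hx => ?_
    rw [Set.uIoc_of_le hab] at hx
    have := hb (x + (σ * T : ℝ) * I) (by simp [vstrip, hx.1.le, hx.2])
    have hs : (σ * T) ^ 2 = T ^ 2 := by rcases hσ with rfl | rfl <;> ring
    simpa [hf, hs, ← mul_pow] using this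
  have hlim : Tendsto (fun T : ℝ => I * (∫ y in -T..T, f (b + y * I))
      - I * (∫ y in -T..T, f (a + y * I))) atTop (𝓝 0) := by
    simp only [hrect]
    simpa using (htop 1 (Or.inl rfl)).sub (htop (-1) (Or.inr rfl))
  have hlim2 := ((intervalIntegral_tendsto_integral hib tendsto_neg_atTop_atBot tendsto_id).const_mul
    I).sub ((intervalIntegral_tendsto_integral hia tendsto_neg_atTop_atBot tendsto_id).const_mul I)
  have := tendsto_nhds_unique hlim2 hlim
  unfold lineInt
  rw [integral_mul_const, integral_mul_const]
  linear_combination -(2 * π * I : ℂ)⁻¹ * this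

/-- For the sup norm, 1 + ‖w‖ ≤ ∏ (1 + |w_α|). The integrand is therefore dominated by a product of
integrable functions of one variable. -/
theorem PolyGrowthOn.integrable_vlines {c : ℝ} {n : ℕ} {κ : ℝ} (hκ : 0 < κ)
    {g : (Fin n → ℂ) → ℂ} (hg : PolyGrowthOn (vlines c n) g) :
    Integrable fun t : Fin n → ℝ =>
      (∏ α, cexp (κ * (c + t α * I : ℂ) ^ 2)) * g fun α => c + t α * I := by
  obtain ⟨C, k, hC, hb⟩ := hg.bound
  have hmem : ∀ t : Fin n → ℝ, (fun α => (c + t α * I : ℂ)) ∈ vlines c n :=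
    fun t α => line_mem_vstrip c (t α)
  have hdom : PolyGrowthOn (vstrip c c) fun z => ((1 + ‖z‖ : ℝ) : ℂ) ^ k := by
    refine PolyGrowthOn.pow ⟨by fun_prop, 1, 1, zero_le_one, fun z _ => ?_⟩ k
    rw [norm_real, Real.norm_of_nonneg (by positivity)]
    simp
  have h2 := Integrable.fintype_prod (ι := Fin n) (μ := fun _ => (volume : Measure ℝ))
    (f := fun _ (t : ℝ) => cexp (κ * (c + t * I : ℂ) ^ 2) * ((1 + ‖(c + t * I : ℂ)‖ : ℝ) : ℂ) ^ k)
    fun _ => hdom.lineIntegrable hκ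
  refine Integrable.mono (h2.const_mul (C : ℂ)) (Continuous.aestronglyMeasurable ?_)
    (Eventually.of_forall fun t => ?_)
  · exact Continuous.mul (by fun_prop) (hg.cont.comp_continuous (by fun_prop) hmem)
  · rw [norm_mul, norm_mul, Finset.prod_mul_distrib, norm_mul, norm_prod, Finset.prod_pow,
      mul_left_comm]
    refine mul_le_mul_of_nonneg_left ((hb _ (hmem t)).trans ?_) (by positivity)
    rw [norm_pow, norm_prod, norm_real, Real.norm_of_nonneg hC]
    gcongr
    have hnn : ∀ α : Fin n, ‖((1 + ‖(c + t α * I : ℂ)‖ : ℝ) : ℂ)‖ = 1 + ‖(c + t α * I : ℂ)‖ :=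
      fun α => by rw [norm_real, Real.norm_of_nonneg (by positivity)]
    simp only [hnn]
    have hge : ∀ s : Finset (Fin n), (1 : ℝ) ≤ ∏ α ∈ s, (1 + ‖(c + t α * I : ℂ)‖) := fun s =>
      Finset.prod_induction _ (fun x => (1 : ℝ) ≤ x) (fun _ _ => one_le_mul_of_one_le_of_one_le)
        le_rfl fun α _ => by simp
    have : ‖fun α => (c + t α * I : ℂ)‖ ≤ ∏ α, (1 + ‖(c + t α * I : ℂ)‖) - 1 := by
      rw [pi_norm_le_iff_of_nonneg (by linarith [hge Finset.univ])]
      intro α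
      rw [← Finset.mul_prod_erase _ _ (Finset.mem_univ α)]
      nlinarith [hge (Finset.univ.erase α), norm_nonneg (c + t α * I : ℂ)]
    linarith

/-! ### The orthogonal polynomials of the weight e^{2w²} -/

/-- The monic polynomials orthogonal on vertical lines with respect to `e^{w²/(2a)}`. -/
noncomputable def mpoly (a : ℂ) : ℕ → ℂ[X]
  | 0 => 1
  | n + 1 => X * mpoly a n + C a * derivative (mpoly a n)

/-- The Appell property. It turns the defining differential recursion into a three-term recurrence,
from which scaling and the comparison with Hermite polynomials follow by two-step induction. -/
theorem derivative_mpoly (a : ℂ) (n : ℕ) :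
    derivative (mpoly a (n + 1)) = (n + 1 : ℂ[X]) * mpoly a n := by
  induction n with
  | zero => simp [mpoly]
  | succ n ih =>
    rw [mpoly, derivative_add, derivative_mul, derivative_X, derivative_C_mul, ih]
    rw [derivative_mul, show derivative ((n : ℂ[X]) + 1) = 0 by simp]
    conv_rhs => rw [mpoly]
    rw [mpoly]
    push_cast
    ring

theorem mpoly_succ_succ (a : ℂ) (n : ℕ) :
    mpoly a (n + 2) = X * mpoly a (n + 1) + C (a * (n + 1)) * mpoly a n := by
  rw [mpoly, derivative_mpoly]
  simp only [map_mul, map_add, map_natCast, map_one]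
  ring

theorem eval_mpoly_succ_succ (a : ℂ) (n : ℕ) (x : ℂ) :
    (mpoly a (n + 2)).eval x
      = x * (mpoly a (n + 1)).eval x + a * (n + 1) * (mpoly a n).eval x := by
  rw [mpoly_succ_succ]
  simp

/-- The three-term recurrence is homogeneous when x has weight 1 and the parameter has weight 2.
With s = -1 this is parity; with s involving √2 it relates the different normalizations. -/
theorem eval_mpoly_scale {a b s : ℂ} (h : a = s ^ 2 * b) (n : ℕ) (x : ℂ) :
    (mpoly a n).eval (s * x) = s ^ n * (mpoly b n).eval x := by
  induction n using Nat.twoStepInduction with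
  | zero => simp [mpoly]
  | one => simp [mpoly]
  | more n h0 h1 =>
    rw [eval_mpoly_succ_succ, eval_mpoly_succ_succ, h0, h1, h]
    ring

theorem mpoly_monic_natDegree (a : ℂ) (n : ℕ) :
    (mpoly a n).Monic ∧ (mpoly a n).natDegree = n := by
  induction n with
  | zero => simp [mpoly]
  | succ n ih =>
    obtain ⟨hm, hd⟩ := ih
    have hX : (X * mpoly a n).Monic := monic_X.mul hm
    have hXd : (X * mpoly a n).natDegree = n + 1 := by
      rw [monic_X.natDegree_mul hm, hd, natDegree_X, add_comm]
    have hlt : (C a * derivative (mpoly a n)).degree < (X * mpoly a n).degree := by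
      rw [degree_eq_natDegree hX.ne_zero, hXd]
      refine lt_of_le_of_lt degree_le_natDegree ?_
      refine Nat.cast_lt.2 (Nat.lt_succ_of_le ?_)
      refine (natDegree_C_mul_le _ _).trans ((natDegree_derivative_le _).trans ?_)
      omega
    rw [mpoly]
    exact ⟨hX.add_of_left hlt, by rw [natDegree_add_eq_left_of_degree_lt hlt, hXd]⟩

/-- Gaussian moments of polynomials along a vertical line are integrable. -/
theorem lineIntegrable_gaussian_polynomial (c : ℝ) {κ : ℝ} (hκ : 0 < κ) (p : ℂ[X]) :
    LineIntegrable c fun z => cexp (κ * z ^ 2) * p.eval z :=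
  (PolyGrowthOn.polynomial p).lineIntegrable hκ

/-- Integration by parts for the weight `e^{2w²}`. -/
theorem lineInt_mpoly_succ_mul (c : ℝ) (n : ℕ) (p : ℂ[X]) :
    lineInt c (fun z => cexp ((2 : ℝ) * z ^ 2) * (mpoly (1 / 4) (n + 1) * p).eval z)
      = -(1 / 4) * lineInt c
          (fun z => cexp ((2 : ℝ) * z ^ 2) * (mpoly (1 / 4) n * derivative p).eval z) := by
  have hi := fun p => lineIntegrable_gaussian_polynomial c two_pos p
  set q := mpoly (1 / 4) n with hq
  -- Since 4 q_{n+1} e^{2z²} = (q_n e^{2z²})', the integrand is the total derivative of e^{2z²} q_n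
  -- p.
  have h0 : lineInt c (fun z => cexp ((2 : ℝ) * z ^ 2)
      * (4 * X * (q * p) + derivative (q * p)).eval z) = 0 := by
    refine lineInt_deriv_eq_zero (f := fun z => cexp ((2 : ℝ) * z ^ 2) * (q * p).eval z)
      (fun z _ => ?_) (hi _) (hi _)
    have h1 : HasDerivAt (fun z : ℂ => cexp ((2 : ℝ) * z ^ 2))
        (cexp ((2 : ℝ) * z ^ 2) * ((2 : ℝ) * (2 * z))) z := by
      simpa using ((hasDerivAt_pow 2 z).const_mul ((2 : ℝ) : ℂ)).cexp
    refine (h1.mul ((q * p).hasDerivAt z)).congr_deriv ?_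
    simp only [eval_add, eval_mul, eval_X, eval_ofNat]
    push_cast
    ring
  have hpt : ∀ z : ℂ, (mpoly (1 / 4) (n + 1) * p).eval z
      = (1 / 4) * (4 * X * (q * p) + derivative (q * p)).eval z
        + -(1 / 4) * (q * derivative p).eval z := by
    intro z
    simp only [mpoly, ← hq, derivative_mul, eval_add, eval_mul, eval_X, eval_C, eval_ofNat]
    ring
  calc _ = lineInt c (fun z => (1 / 4) * (cexp ((2 : ℝ) * z ^ 2)
        * (4 * X * (q * p) + derivative (q * p)).eval z)
        + -(1 / 4) * (cexp ((2 : ℝ) * z ^ 2) * (q * derivative p).eval z)) := by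
        congr 1
        ext z
        rw [hpt]
        ring
    _ = _ := by
        rw [lineInt_add ((hi _).const_mul _) ((hi _).const_mul _), lineInt_const_mul, h0,
          mul_zero, zero_add, lineInt_const_mul]

/-- The Rodrigues formula integrated by parts n times. It vanishes for deg p < n, and for monic p of
degree n it leaves n! times the total mass of the weight. -/
theorem lineInt_mpoly_mul (c : ℝ) (n : ℕ) (p : ℂ[X]) :
    lineInt c (fun z => cexp ((2 : ℝ) * z ^ 2) * (mpoly (1 / 4) n * p).eval z)
      = (-(1 / 4)) ^ n * lineInt c
          (fun z => cexp ((2 : ℝ) * z ^ 2) * (derivative^[n] p).eval z) := by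
  induction n generalizing p with
  | zero => simp [mpoly]
  | succ n ih =>
    rw [lineInt_mpoly_succ_mul, ih, Function.iterate_succ_apply]
    ring

theorem lineInt_gaussian (c : ℝ) {κ : ℝ} (hκ : 0 < κ) (s : ℂ) :
    lineInt c (fun z => cexp (κ * z ^ 2 - s * z))
      = (2 * π : ℂ)⁻¹ * (π / κ : ℂ) ^ (1 / 2 : ℂ) * cexp (-s ^ 2 / (4 * κ)) := by
  unfold lineInt
  rw [integral_mul_const]
  have hpt : ∀ t : ℝ, cexp (κ * (c + t * I) ^ 2 - s * (c + t * I))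
      = cexp (-(κ : ℂ) * t ^ 2 + (2 * κ * c - s) * I * t + (κ * c ^ 2 - s * c)) := by
    intro t
    congr 1
    linear_combination (κ * t ^ 2 : ℂ) * I_sq
  simp only [hpt]
  rw [integral_cexp_quadratic (by simpa using hκ)]
  have hκ' : (κ : ℂ) ≠ 0 := by exact_mod_cast hκ.ne'
  have he : (κ * c ^ 2 - s * c : ℂ) - ((2 * κ * c - s) * I) ^ 2 / (4 * -κ) = -s ^ 2 / (4 * κ) := by
    field_simp
    linear_combination ((2 * κ * c - s) ^ 2 : ℂ) * I_sq
  rw [he, neg_neg]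
  field_simp

/-- The squared norms of the polynomials `mpoly (1 / 4) n`. -/
noncomputable def mnorm (n : ℕ) : ℂ := (-(1 / 4)) ^ n * n ! * (2 * ((√(2 * π) : ℝ) : ℂ))⁻¹

theorem mnorm_ne_zero (n : ℕ) : mnorm n ≠ 0 := by
  have : ((√(2 * π) : ℝ) : ℂ) ≠ 0 := by
    exact_mod_cast (Real.sqrt_pos.2 (by positivity)).ne'
  have h2 : (n ! : ℂ) ≠ 0 := by exact_mod_cast n.factorial_ne_zero
  exact mul_ne_zero (mul_ne_zero (pow_ne_zero _ (by norm_num)) h2)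
    (inv_ne_zero (mul_ne_zero two_ne_zero this))

theorem lineInt_weight (c : ℝ) :
    lineInt c (fun z => cexp ((2 : ℝ) * z ^ 2)) = (2 * ((√(2 * π) : ℝ) : ℂ))⁻¹ := by
  have := lineInt_gaussian c two_pos 0
  simp only [zero_mul, sub_zero] at this
  rw [this]
  have h1 : (π / (2 : ℝ) : ℂ) ^ (1 / 2 : ℂ) = (√(π / 2) : ℝ) := by
    rw [Real.sqrt_eq_rpow, ofReal_cpow (by positivity)]
    push_cast
    rfl
  rw [h1]
  have h2 : √(π / 2) = √(2 * π) / 2 := by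
    rw [show π / 2 = (2 * π) / 2 ^ 2 by ring, Real.sqrt_div (by positivity),
      Real.sqrt_sq (by norm_num)]
  have h3 : (√(2 * π)) ^ 2 = 2 * π := Real.sq_sqrt (by positivity)
  have h4 : (((√(2 * π) : ℝ) : ℂ)) ^ 2 = 2 * π := by exact_mod_cast h3
  have h5 : ((√(2 * π) : ℝ) : ℂ) ≠ 0 := by
    exact_mod_cast (Real.sqrt_pos.2 (by positivity)).ne'
  rw [h2, ← h4]
  push_cast
  simp
  field_simp

theorem lineInt_mpoly_orthogonal (c : ℝ) (m n : ℕ) :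
    lineInt c (fun z => cexp ((2 : ℝ) * z ^ 2)
        * ((mpoly (1 / 4) m).eval z * (mpoly (1 / 4) n).eval z))
      = if m = n then mnorm n else 0 := by
  have key : ∀ m n : ℕ, n ≤ m → lineInt c (fun z => cexp ((2 : ℝ) * z ^ 2)
        * ((mpoly (1 / 4) m).eval z * (mpoly (1 / 4) n).eval z))
      = if m = n then mnorm n else 0 := by
    intro m n hmn
    simp only [← eval_mul]
    rw [lineInt_mpoly_mul]
    obtain ⟨hm, hd⟩ := mpoly_monic_natDegree (1 / 4) n
    split_ifs with h
    · subst h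
      have h1 : derivative^[m] (mpoly (1 / 4) m) = C (m ! : ℂ) := by
        have h2 : (derivative^[m] (mpoly (1 / 4) m)).natDegree = 0 := by
          have := natDegree_iterate_derivative (mpoly (1 / 4) m) m
          omega
        rw [eq_C_of_natDegree_eq_zero h2, coeff_iterate_derivative]
        have h3 : (mpoly (1 / 4) m).coeff m = 1 := by
          have := hm.coeff_natDegree
          rwa [hd] at this
        rw [zero_add, h3, Nat.descFactorial_self, nsmul_one]
      simp only [h1, eval_C]
      rw [lineInt_mul_const, lineInt_weight, mnorm]
      ring
    · rw [iterate_derivative_eq_zero (by omega)]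
      simp [lineInt]
  rcases le_total n m with h | h
  · exact key m n h
  · simp only [mul_comm ((mpoly (1 / 4) m).eval _)]
    rw [key n m h]
    by_cases hmn : m = n
    · simp [hmn]
    · simp [hmn, Ne.symm hmn]

/-! ### Vandermonde and Lagrange identities -/

/-- The inserted variable is brought to the front by a cyclic permutation, whose sign disappears in
the square. -/
theorem vandSq_insertNth {n : ℕ} (α : Fin (n + 1)) (x : ℂ) (y : Fin n → ℂ) :
    vandSq (α.insertNth x y : Fin (n + 1) → ℂ) = (∏ β, (x - y β) ^ 2) * vandSq y := by
  have h1 : (Matrix.vandermonde (α.insertNth x y : Fin (n + 1) → ℂ))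
      = (Matrix.vandermonde (Fin.cons x y : Fin (n + 1) → ℂ)).submatrix α.cycleRange id := by
    ext i j
    simp [Matrix.vandermonde]
  unfold vandSq
  rw [h1, Matrix.det_permute, mul_pow, ← Int.cast_pow, ← Units.val_pow_eq_pow_val, Int.units_sq,
    Matrix.det_vandermonde, Matrix.det_vandermonde, Fin.prod_univ_succ]
  simp only [Fin.prod_Ioi_zero, Fin.prod_Ioi_succ, Fin.cons_succ, Fin.cons_zero, mul_pow,
    Finset.prod_pow]
  simp only [Units.val_one, Int.cast_one, one_mul, ← Finset.prod_pow]
  congr 1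
  exact Finset.prod_congr rfl fun β _ => by ring

theorem vandSq_eq {n : ℕ} (α : Fin (n + 1)) (w : Fin (n + 1) → ℂ) :
    vandSq w = (∏ β, (w α - w (α.succAbove β)) ^ 2) * vandSq (fun β => w (α.succAbove β)) := by
  conv_lhs => rw [← Fin.insertNth_self_removeNth α w]
  rw [vandSq_insertNth]
  rfl

theorem vandSq_eq_zero {n : ℕ} {w : Fin n → ℂ} (hw : ¬ Function.Injective w) :
    vandSq w = 0 := by
  rw [vandSq, pow_eq_zero_iff two_ne_zero]
  by_contra h
  exact hw (Matrix.det_vandermonde_ne_zero_iff.1 h)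

/-- Covers coinciding nodes, where Lagrange interpolation is unavailable: the expansions below keep
only one of the two factors ∏ (w_α - w_β) of Δ², and this already vanishes. -/
theorem prod_sub_mul_vandSq_eq_zero {n : ℕ} {w : Fin (n + 1) → ℂ} (hw : ¬ Function.Injective w)
    (α : Fin (n + 1)) :
    (∏ β, (w α - w (α.succAbove β))) * vandSq (fun β => w (α.succAbove β)) = 0 := by
  have := vandSq_eq_zero hw
  rw [vandSq_eq α, Finset.prod_pow, mul_eq_zero, pow_eq_zero_iff two_ne_zero] at this
  exact mul_eq_zero.2 this

theorem sum_lagrange {n : ℕ} {x : Fin (n + 1) → ℂ} (hx : Function.Injective x) (z : ℂ) :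
    ∑ α, ∏ β, (z - x (α.succAbove β)) / (x α - x (α.succAbove β)) = 1 := by
  have := congrArg (Polynomial.eval z)
    (Lagrange.sum_basis (s := Finset.univ) (v := x) hx.injOn Finset.univ_nonempty)
  rw [eval_one, eval_finsetSum] at this
  rw [← this]
  refine Finset.sum_congr rfl fun α _ => ?_
  rw [Lagrange.basis, eval_prod, ← Finset.compl_singleton, ← Fin.image_succAbove_univ,
    Finset.prod_image fun _ _ _ _ h => Fin.succAbove_right_injective h]
  refine Finset.prod_congr rfl fun β _ => ?_
  simp [Lagrange.basisDivisor, div_eq_inv_mul]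

/-- Lagrange interpolation of the constant 1 at the nodes v, w₁, …, evaluated at z. The basis
polynomial of v is the product on the left; every other one contains (z-v)/(w_α-v), and Δ² clears
its remaining denominators. -/
theorem prod_div_mul_vandSq {n : ℕ} (w : Fin (n + 1) → ℂ) {v : ℂ} (hv : ∀ α, v ≠ w α) (z : ℂ) :
    (∏ α, (z - w α) / (v - w α)) * vandSq w
      = vandSq w + (z - v) * ∑ α, (v - w α)⁻¹ *
        ((∏ β, (z - w (α.succAbove β)) * (w α - w (α.succAbove β)))
          * vandSq (fun β => w (α.succAbove β))) := by
  by_cases hw : Function.Injective w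
  · have h := sum_lagrange (x := (Fin.cons v w : Fin (n + 2) → ℂ))
      (Fin.cons_injective_iff.2 ⟨fun ⟨α, h⟩ => hv α h.symm, hw⟩) z
    rw [Fin.sum_univ_succ] at h
    simp only [Fin.succAbove_zero, Fin.cons_succ, Fin.cons_zero, Fin.prod_univ_succ,
      Fin.succ_succAbove_zero, Fin.succ_succAbove_succ] at h
    rw [← Fin.prod_univ_succ (fun α => (z - w α) / (v - w α))] at h
    rw [eq_sub_of_add_eq h, sub_mul, one_mul, sub_eq_add_neg, Finset.mul_sum, Finset.sum_mul,
      ← Finset.sum_neg_distrib]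
    congr 1
    refine Finset.sum_congr rfl fun α _ => ?_
    have hne : ∀ β, w α - w (α.succAbove β) ≠ 0 := fun β =>
      sub_ne_zero.2 fun h => Fin.succAbove_ne α β (hw h).symm
    rw [vandSq_eq α w, Finset.prod_div_distrib, Finset.prod_mul_distrib, Finset.prod_pow]
    have h1 : ∏ β, (w α - w (α.succAbove β)) ≠ 0 := Finset.prod_ne_zero_iff.2 fun β _ => hne β
    have h2 : v - w α ≠ 0 := sub_ne_zero.2 (hv α)
    have h3 : w α - v ≠ 0 := sub_ne_zero.2 (hv α).symm
    field_simp
    ring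
  · rw [vandSq_eq_zero hw, mul_zero, zero_add, Finset.sum_eq_zero, mul_zero]
    intro α _
    rw [Finset.prod_mul_distrib, mul_assoc, prod_sub_mul_vandSq_eq_zero hw, mul_zero, mul_zero]

/-- Interpolation of 1 at the nodes w_α alone, evaluated at v: the basis polynomial of w_α cancels
all factors v - w_β with β ≠ α, so v survives in a single simple pole. -/
theorem prod_inv_mul_vandSq {n : ℕ} (w : Fin (n + 1) → ℂ) {v z : ℂ} (hv : ∀ α, v ≠ w α)
    (hz : ∀ α, z ≠ w α) :
    (∏ α, ((z - w α) * (v - w α))⁻¹) * vandSq w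
      = ∑ α, ((v - w α)⁻¹ * (z - w α)⁻¹) *
        ((∏ β, (w α - w (α.succAbove β)) / (z - w (α.succAbove β)))
          * vandSq (fun β => w (α.succAbove β))) := by
  by_cases hw : Function.Injective w
  · rw [← one_mul ((∏ α, ((z - w α) * (v - w α))⁻¹) * vandSq w), ← sum_lagrange hw v,
      Finset.sum_mul]
    refine Finset.sum_congr rfl fun α _ => ?_
    have hne : ∀ β, w α - w (α.succAbove β) ≠ 0 := fun β =>
      sub_ne_zero.2 fun h => Fin.succAbove_ne α β (hw h).symm
    have h1 : ∏ β, (w α - w (α.succAbove β)) ≠ 0 := Finset.prod_ne_zero_iff.2 fun β _ => hne β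
    have h2 : ∏ β, (v - w (α.succAbove β)) ≠ 0 :=
      Finset.prod_ne_zero_iff.2 fun β _ => sub_ne_zero.2 (hv _)
    have h3 : ∏ β, (z - w (α.succAbove β)) ≠ 0 :=
      Finset.prod_ne_zero_iff.2 fun β _ => sub_ne_zero.2 (hz _)
    have h4 : v - w α ≠ 0 := sub_ne_zero.2 (hv α)
    have h5 : z - w α ≠ 0 := sub_ne_zero.2 (hz α)
    rw [vandSq_eq α w, Fin.prod_univ_succAbove _ α, Finset.prod_inv_distrib,
      Finset.prod_div_distrib, Finset.prod_div_distrib, Finset.prod_mul_distrib, Finset.prod_pow]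
    field_simp
  · rw [vandSq_eq_zero hw, mul_zero, Finset.sum_eq_zero]
    intro α _
    rw [Finset.prod_div_distrib, div_mul_eq_mul_div, prod_sub_mul_vandSq_eq_zero hw, zero_div,
      mul_zero]

/-- One factor Δ is bordered by v and the other by z. The two signs, one for each w_α, cancel in the
product. -/
theorem prod_mul_vandSq {n : ℕ} (w : Fin n → ℂ) (v z : ℂ) :
    (∏ α, (z - w α) * (v - w α)) * vandSq w
      = (Matrix.vandermonde (Fin.cons v w : Fin (n + 1) → ℂ)).det
        * (Matrix.vandermonde (Fin.cons z w : Fin (n + 1) → ℂ)).det := by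
  rw [vandSq, Matrix.det_vandermonde, Matrix.det_vandermonde, Matrix.det_vandermonde,
    Fin.prod_univ_succ, Fin.prod_univ_succ]
  simp only [Fin.prod_Ioi_zero, Fin.prod_Ioi_succ, Fin.cons_succ, Fin.cons_zero]
  have h : ∏ α, (z - w α) * (v - w α) = (∏ α, (w α - v)) * ∏ α, (w α - z) := by
    rw [← Finset.prod_mul_distrib]
    exact Finset.prod_congr rfl fun β _ => by ring
  rw [h]
  ring

/-- Column operations replace the monomials by any monic polynomials of the same degrees, in
particular by orthogonal ones. -/
theorem det_vandermonde_cons {n : ℕ} (w : Fin n → ℂ) (v a : ℂ) :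
    (Matrix.vandermonde (Fin.cons v w : Fin (n + 1) → ℂ)).det
      = ∑ σ : Equiv.Perm (Fin (n + 1)), (Equiv.Perm.sign σ : ℂ) * ((mpoly a (σ 0)).eval v
          * ∏ i : Fin n, (mpoly a (σ i.succ)).eval (w i)) := by
  rw [Matrix.det_eval_matrixOfPolynomials_eq_det_vandermonde _ (fun i => mpoly a i)
    (fun i => (mpoly_monic_natDegree a i).2) (fun i => (mpoly_monic_natDegree a i).1),
    ← Matrix.det_transpose, Matrix.det_apply']
  refine Finset.sum_congr rfl fun σ _ => ?_
  rw [Fin.prod_univ_succ]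
  simp

/-! ### Multiple Gaussian integrals and the reduction of the Θ-functions -/

/-- The `n`-fold integral along `Re = c` against the weight `∏ e^{2w²}`. -/
noncomputable def gaussN (c : ℝ) (n : ℕ) (F : (Fin n → ℂ) → ℂ) : ℂ :=
  lineIntN c n fun w => (∏ α, cexp ((2 : ℝ) * w α ^ 2)) * F w

section gaussN

variable {c : ℝ} {n : ℕ}

theorem line_mem_vlines (t : Fin n → ℝ) : (fun α => (c + t α * I : ℂ)) ∈ vlines c n :=
  fun α => line_mem_vstrip c (t α)

theorem gaussN_congr {F G : (Fin n → ℂ) → ℂ} (h : ∀ w ∈ vlines c n, F w = G w) :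
    gaussN c n F = gaussN c n G := by
  unfold gaussN lineIntN
  simp only [h _ (line_mem_vlines _)]

theorem gaussN_const_mul (a : ℂ) (F : (Fin n → ℂ) → ℂ) :
    gaussN c n (fun w => a * F w) = a * gaussN c n F := by
  unfold gaussN lineIntN
  simp only [mul_assoc, mul_left_comm _ a, integral_const_mul]

theorem gaussN_add {F G : (Fin n → ℂ) → ℂ} (hF : PolyGrowthOn (vlines c n) F)
    (hG : PolyGrowthOn (vlines c n) G) :
    gaussN c n (fun w => F w + G w) = gaussN c n F + gaussN c n G := by
  unfold gaussN lineIntN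
  rw [← mul_add, ← integral_add ((hF.integrable_vlines two_pos).mul_const _)
    ((hG.integrable_vlines two_pos).mul_const _)]
  simp only [mul_add, add_mul]

theorem gaussN_sum {ι : Type*} (s : Finset ι) {F : ι → (Fin n → ℂ) → ℂ}
    (hF : ∀ i ∈ s, PolyGrowthOn (vlines c n) (F i)) :
    gaussN c n (fun w => ∑ i ∈ s, F i w) = ∑ i ∈ s, gaussN c n (F i) := by
  unfold gaussN lineIntN
  simp only [Finset.mul_sum, Finset.sum_mul]
  rw [integral_finsetSum _ fun i hi => ((hF i hi).integrable_vlines two_pos).mul_const _,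
    Finset.mul_sum]

theorem gaussN_prod (f : Fin n → ℂ → ℂ) :
    gaussN c n (fun w => ∏ α, f α (w α))
      = ∏ α, lineInt c (fun z => cexp ((2 : ℝ) * z ^ 2) * f α z) := by
  unfold gaussN lineIntN lineInt
  simp only [← Finset.prod_mul_distrib, integral_mul_const]
  rw [integral_fintype_prod_volume_eq_prod
    (fun α (t : ℝ) => cexp ((2 : ℝ) * (c + t * I : ℂ) ^ 2) * f α (c + t * I))]
  simp only [Finset.prod_mul_distrib, Finset.prod_const, Finset.card_univ, Fintype.card_fin]

theorem gaussN_succ {F : (Fin (n + 1) → ℂ) → ℂ} (hF : PolyGrowthOn (vlines c (n + 1)) F)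
    (α : Fin (n + 1)) :
    gaussN c (n + 1) F
      = lineInt c fun x => cexp ((2 : ℝ) * x ^ 2) * gaussN c n fun y => F (α.insertNth x y) := by
  unfold gaussN lineIntN lineInt
  set G : (Fin (n + 1) → ℝ) → ℂ := fun t =>
    (∏ β, cexp ((2 : ℝ) * (c + t β * I : ℂ) ^ 2)) * F fun β => c + t β * I with hG
  have hmp := (volume_preserving_piFinSuccAbove (fun _ : Fin (n + 1) => ℝ) α).symm
  have hGi : Integrable G := hF.integrable_vlines two_pos
  have h1 : ∫ t, G t = ∫ x : ℝ, ∫ y : Fin n → ℝ, G (α.insertNth x y) := by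
    rw [← hmp.integral_comp', Measure.volume_eq_prod, integral_prod]
    · rfl
    · exact (hmp.integrable_comp_emb (MeasurableEquiv.measurableEmbedding _)).2 hGi
  have h2 : ∀ (x : ℝ) (y : Fin n → ℝ), G (α.insertNth x y)
      = cexp ((2 : ℝ) * (c + x * I : ℂ) ^ 2) * ((∏ β, cexp ((2 : ℝ) * (c + y β * I : ℂ) ^ 2))
        * F (α.insertNth (c + x * I : ℂ) fun β => (c + y β * I : ℂ))) := by
    intro x y
    rw [hG]
    simp only
    rw [Fin.prod_univ_succAbove _ α]
    simp only [Fin.insertNth_apply_same, Fin.insertNth_apply_succAbove, mul_assoc]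
    congr 4
    ext β
    refine Fin.succAboveCases α ?_ (fun β => ?_) β <;> simp
  rw [integral_mul_const, h1]
  simp only [h2, integral_const_mul, integral_mul_const]
  have h3 : ∀ a J : ℂ, a * ((2 * π * I : ℂ)⁻¹ ^ n * (J * I ^ n))
      = ((2 * π * I : ℂ)⁻¹ ^ n * I ^ n) * (a * J) := by
    intro a J
    ring
  simp only [h3, integral_const_mul]
  ring


theorem PolyGrowthOn.coord {f : ℂ → ℂ} (hf : PolyGrowthOn (vstrip c c) f) (α : Fin n) :
    PolyGrowthOn (vlines c n) fun w => f (w α) :=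
  hf.apply α fun _ hw => hw α

theorem PolyGrowthOn.proj (α : Fin n) : PolyGrowthOn (vlines c n) fun w => w α :=
  PolyGrowthOn.id.coord α

theorem PolyGrowthOn.vandSq : PolyGrowthOn (vlines c n) Tacnode.vandSq := by
  have h : PolyGrowthOn (vlines c n)
      fun w => ∏ i : Fin n, ∏ j ∈ Finset.Ioi i, (w j - w i) :=
    .prod _ fun i _ => .prod _ fun j _ =>
      (PolyGrowthOn.proj j).sub (PolyGrowthOn.proj i)
  refine (h.pow 2).congr fun w _ => ?_
  rw [Tacnode.vandSq, Matrix.det_vandermonde]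

theorem PolyGrowthOn.vandSq_succAbove (α : Fin (n + 1)) :
    PolyGrowthOn (vlines c (n + 1)) fun w => Tacnode.vandSq fun β => w (α.succAbove β) :=
  (PolyGrowthOn.vandSq (c := c) (n := n)).comp
    (p := fun (w : Fin (n + 1) → ℂ) (β : Fin n) => w (α.succAbove β)) (by fun_prop)
    (fun w hw β => hw _) fun w => (pi_norm_le_iff_of_nonneg (norm_nonneg _)).2
      fun β => norm_le_pi_norm w _

theorem ne_of_mem_vlines {v : ℂ} (hv : v.re < c) {w : Fin n → ℂ} (hw : w ∈ vlines c n)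
    (α : Fin n) : v ≠ w α := by
  rintro rfl
  exact absurd (hw α).1 (not_le.2 hv)

theorem Theta_eq_gaussN (v z : ℂ) :
    Theta c n 0 0 v z = gaussN c n fun w => (∏ α, (z - w α) / (v - w α)) * vandSq w := by
  unfold Theta gaussN
  simp [Finset.prod_mul_distrib, mul_assoc]

theorem ThetaPlus_eq_gaussN (v z : ℂ) :
    ThetaPlus c n 0 0 v z = gaussN c n fun w => (∏ α, (z - w α) * (v - w α)) * vandSq w := by
  unfold ThetaPlus gaussN
  simp [Finset.prod_mul_distrib, mul_assoc]

theorem ThetaMinus_eq_gaussN (v z : ℂ) :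
    ThetaMinus c n 0 0 v z
      = gaussN c n fun w => (∏ α, ((z - w α) * (v - w α))⁻¹) * vandSq w := by
  unfold ThetaMinus gaussN
  simp [Finset.prod_mul_distrib, mul_assoc]

theorem Theta_zero_zero (hc : 0 < c) : Theta c n 0 0 0 0 = gaussN c n vandSq := by
  rw [Theta_eq_gaussN]
  refine gaussN_congr fun w hw => ?_
  have h : ∀ α, (0 - w α) / (0 - w α) = 1 := fun α =>
    div_self (sub_ne_zero.2 (ne_of_mem_vlines (by simpa using hc) hw α))
  simp only [h, Finset.prod_const_one, one_mul]

/-- The n+1 terms of the Lagrange expansion have equal integrals. When w_α = x is held fixed,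
integrating out the other variables leaves Θ⁺_n(x,z). -/
theorem Theta_succ (hc : 0 < c) {v : ℂ} (hv : v.re < c) (z : ℂ) :
    Theta c (n + 1) 0 0 v z = Theta c (n + 1) 0 0 0 0 + (z - v) * ((n + 1) *
      lineInt c fun x => cexp ((2 : ℝ) * x ^ 2) * ((v - x)⁻¹ * ThetaPlus c n 0 0 x z)) := by
  have hco : ∀ (a : ℂ) (α : Fin (n + 1)), PolyGrowthOn (vlines c (n + 1)) fun w => a - w α :=
    fun a α => (PolyGrowthOn.const a).sub (PolyGrowthOn.proj α)
  have hH : ∀ α : Fin (n + 1), PolyGrowthOn (vlines c (n + 1)) fun w => (v - w α)⁻¹ *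
        ((∏ β, (z - w (α.succAbove β)) * (w α - w (α.succAbove β)))
          * vandSq fun β => w (α.succAbove β)) := fun α =>
    ((PolyGrowthOn.inv_sub hv).coord α).mul
      ((PolyGrowthOn.prod _ fun β _ => (hco z _).mul
        ((PolyGrowthOn.proj α).sub
          (PolyGrowthOn.proj _))).mul (PolyGrowthOn.vandSq_succAbove α))
  rw [Theta_zero_zero hc, Theta_eq_gaussN,
    gaussN_congr fun w hw => prod_div_mul_vandSq w (ne_of_mem_vlines hv hw) z,
    gaussN_add PolyGrowthOn.vandSq ((PolyGrowthOn.sum _ fun α _ => hH α).const_mul _),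
    gaussN_const_mul, gaussN_sum _ fun α _ => hH α]
  have h1 : ∀ α : Fin (n + 1), (gaussN c (n + 1) fun w => (v - w α)⁻¹ *
        ((∏ β, (z - w (α.succAbove β)) * (w α - w (α.succAbove β)))
          * vandSq fun β => w (α.succAbove β)))
      = lineInt c fun x => cexp ((2 : ℝ) * x ^ 2) * ((v - x)⁻¹ * ThetaPlus c n 0 0 x z) := by
    intro α
    rw [gaussN_succ (hH α) α]
    simp only [Fin.insertNth_apply_same, Fin.insertNth_apply_succAbove, gaussN_const_mul,
      ThetaPlus_eq_gaussN]
  simp [h1]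

/-- Again n+1 equal terms. The variables other than w_α = x carry (x-w)/(z-w), and this is Θ_n(z,x),
with the arguments in that order. -/
theorem ThetaMinus_succ {v z : ℂ} (hv : v.re < c) (hz : z.re < c) :
    ThetaMinus c (n + 1) 0 0 v z = (n + 1) *
      lineInt c fun x => cexp ((2 : ℝ) * x ^ 2) *
        ((v - x)⁻¹ * (z - x)⁻¹ * Theta c n 0 0 z x) := by
  have hH : ∀ α : Fin (n + 1), PolyGrowthOn (vlines c (n + 1)) fun w =>
      ((v - w α)⁻¹ * (z - w α)⁻¹) * ((∏ β, (w α - w (α.succAbove β)) / (z - w (α.succAbove β)))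
          * vandSq (fun β => w (α.succAbove β))) := fun α =>
    (((PolyGrowthOn.inv_sub hv).coord α).mul
      ((PolyGrowthOn.inv_sub hz).coord α)).mul
      ((PolyGrowthOn.prod _ fun β _ => (((PolyGrowthOn.proj α).sub
          (PolyGrowthOn.proj _))).mul
          ((PolyGrowthOn.inv_sub hz).coord _)).mul
          (PolyGrowthOn.vandSq_succAbove α))
  rw [ThetaMinus_eq_gaussN, gaussN_congr fun w hw =>
    prod_inv_mul_vandSq w (ne_of_mem_vlines hv hw) (ne_of_mem_vlines hz hw),
    gaussN_sum _ fun α _ => hH α]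
  have h1 : ∀ α : Fin (n + 1), (gaussN c (n + 1) fun w => ((v - w α)⁻¹ * (z - w α)⁻¹) *
        ((∏ β, (w α - w (α.succAbove β)) / (z - w (α.succAbove β)))
          * vandSq (fun β => w (α.succAbove β))))
      = lineInt c fun x => cexp ((2 : ℝ) * x ^ 2) *
        ((v - x)⁻¹ * (z - x)⁻¹ * Theta c n 0 0 z x) := by
    intro α
    rw [gaussN_succ (hH α) α]
    simp only [Fin.insertNth_apply_same, Fin.insertNth_apply_succAbove, gaussN_const_mul,
      Theta_eq_gaussN]
  simp only [h1, Finset.sum_const, Finset.card_univ, Fintype.card_fin, nsmul_eq_mul]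
  push_cast
  rfl

/-- The Christoffel-Darboux kernel of the polynomials `mpoly (1 / 4)`. -/
noncomputable def cdKernel (r : ℕ) (v z : ℂ) : ℂ :=
  ∑ j ∈ Finset.range r, (mpoly (1 / 4) j).eval v * (mpoly (1 / 4) j).eval z / mnorm j

theorem Equiv.Perm.ext_of_succ {σ τ : Equiv.Perm (Fin (n + 1))}
    (h : ∀ i : Fin n, σ i.succ = τ i.succ) : σ = τ := by
  ext i
  congr 1
  refine Fin.cases ?_ h i
  by_contra h0
  obtain ⟨j, hj⟩ := τ.surjective (σ 0)
  induction j using Fin.cases with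
  | zero => exact h0 hj.symm
  | succ j => exact Fin.succ_ne_zero j (σ.injective ((h j).trans hj))

/-- Andréief's argument: both determinants are expanded over permutations, and orthogonality forces
σ and τ to agree off 0, hence everywhere. What is left depends on σ only through j = σ(0). -/
theorem ThetaPlus_eq_cdKernel (v z : ℂ) :
    ThetaPlus c n 0 0 v z
      = n ! * (∏ j : Fin (n + 1), mnorm j) * cdKernel (n + 1) v z := by
  set q : ℕ → ℂ[X] := mpoly (1 / 4) with hq
  have hpg : ∀ σ τ : Equiv.Perm (Fin (n + 1)), PolyGrowthOn (vlines c n) fun w =>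
      ∏ i : Fin n, ((q (σ i.succ)).eval (w i) * (q (τ i.succ)).eval (w i)) := fun σ τ =>
    .prod _ fun i _ => ((PolyGrowthOn.polynomial _).coord i).mul
      ((PolyGrowthOn.polynomial _).coord i)
  have hint : ∀ σ τ : Equiv.Perm (Fin (n + 1)), (gaussN c n fun w =>
      ∏ i : Fin n, ((q (σ i.succ)).eval (w i) * (q (τ i.succ)).eval (w i)))
      = if σ = τ then ∏ i : Fin n, mnorm (σ i.succ) else 0 := by
    intro σ τ
    rw [gaussN_prod (fun i z => (q (σ i.succ)).eval z * (q (τ i.succ)).eval z)]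
    simp only [hq, lineInt_mpoly_orthogonal]
    split_ifs with h
    · simp [h]
    · have : ¬ ∀ i : Fin n, σ i.succ = τ i.succ := fun h' => h (Equiv.Perm.ext_of_succ h')
      push Not at this
      obtain ⟨i, hi⟩ := this
      exact Finset.prod_eq_zero (Finset.mem_univ i) (if_neg fun h' => hi (Fin.ext h'))
  have hexp : ThetaPlus c n 0 0 v z = gaussN c n fun w =>
      ∑ σ : Equiv.Perm (Fin (n + 1)), ∑ τ : Equiv.Perm (Fin (n + 1)),
        ((Equiv.Perm.sign σ : ℂ) * (Equiv.Perm.sign τ : ℂ)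
          * ((q (σ 0)).eval v * (q (τ 0)).eval z)) *
        ∏ i : Fin n, ((q (σ i.succ)).eval (w i) * (q (τ i.succ)).eval (w i)) := by
    rw [ThetaPlus_eq_gaussN]
    refine gaussN_congr fun w _ => ?_
    rw [prod_mul_vandSq, det_vandermonde_cons w v (1 / 4), det_vandermonde_cons w z (1 / 4),
      Finset.sum_mul_sum]
    refine Finset.sum_congr rfl fun σ _ => Finset.sum_congr rfl fun τ _ => ?_
    rw [Finset.prod_mul_distrib]
    ring
  rw [hexp, gaussN_sum _ fun σ _ => .sum _ fun τ _ => (hpg σ τ).const_mul _]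
  have hsq : ∀ σ : Equiv.Perm (Fin (n + 1)), (Equiv.Perm.sign σ : ℂ) * (Equiv.Perm.sign σ : ℂ)
      = 1 := by
    intro σ
    rw [← Int.cast_mul, ← Units.val_mul, Int.units_mul_self]
    simp
  have hσ : ∀ σ : Equiv.Perm (Fin (n + 1)), (gaussN c n fun w =>
      ∑ τ : Equiv.Perm (Fin (n + 1)),
        ((Equiv.Perm.sign σ : ℂ) * (Equiv.Perm.sign τ : ℂ)
          * ((q (σ 0)).eval v * (q (τ 0)).eval z)) *
        ∏ i : Fin n, ((q (σ i.succ)).eval (w i) * (q (τ i.succ)).eval (w i)))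
      = (∏ j : Fin (n + 1), mnorm j)
        * ((q (σ 0)).eval v * (q (σ 0)).eval z / mnorm (σ 0)) := by
    intro σ
    rw [gaussN_sum _ fun τ _ => (hpg σ τ).const_mul _]
    simp only [gaussN_const_mul, hint, mul_ite, mul_zero, Finset.sum_ite_eq, Finset.mem_univ,
      if_true, hsq, one_mul]
    rw [← Equiv.prod_comp σ, Fin.prod_univ_succ]
    field_simp [mnorm_ne_zero]
  simp only [hσ]
  -- Grouping the permutations by the value at 0: each value is taken n! times.
  rw [← Finset.mul_sum, ← Equiv.sum_comp Equiv.Perm.decomposeFin.symm, Fintype.sum_prod_type]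
  simp only [Equiv.Perm.decomposeFin_symm_apply_zero, Finset.sum_const, Finset.card_univ,
    Fintype.card_perm, Fintype.card_fin, nsmul_eq_mul, ← Finset.mul_sum]
  rw [Fin.sum_univ_eq_sum_range (fun j => (q j).eval v * (q j).eval z / mnorm j), ← cdKernel]
  ring

end gaussN

/-! ### The normalized Θ-functions in terms of orthogonal polynomials -/

theorem gaussN_zero (c : ℝ) (F : (Fin 0 → ℂ) → ℂ) : gaussN c 0 F = F Fin.elim0 := by
  have h := gaussN_prod (c := c) (n := 0) (fun _ _ => 1)
  simp only [Finset.univ_eq_empty, Finset.prod_empty] at h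
  calc gaussN c 0 F = gaussN c 0 (fun _ => F Fin.elim0 * 1) := by
        congr 1
        ext w
        rw [mul_one, Subsingleton.elim w Fin.elim0]
    _ = _ := by rw [gaussN_const_mul, h, mul_one]

/-- With one variable x singled out, the rest integrates to Θ⁺(x,x), the diagonal of the
Christoffel-Darboux kernel; each of its r terms has total mass 1. -/
theorem Theta_zero_zero_eq {c : ℝ} (hc : 0 < c) (r : ℕ) :
    Theta c r 0 0 0 0 = r ! * ∏ j : Fin r, mnorm j := by
  rw [Theta_zero_zero hc]
  cases r with
  | zero => simp [gaussN_zero, vandSq]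
  | succ n =>
    rw [gaussN_succ PolyGrowthOn.vandSq 0]
    have h1 : ∀ x, (gaussN c n fun y => vandSq ((0 : Fin (n + 1)).insertNth x y))
        = n ! * (∏ j : Fin (n + 1), mnorm j) * cdKernel (n + 1) x x := by
      intro x
      rw [← ThetaPlus_eq_cdKernel (c := c), ThetaPlus_eq_gaussN]
      simp only [vandSq_insertNth, pow_two]
    simp only [h1, cdKernel]
    have h2 : ∀ x : ℂ, cexp ((2 : ℝ) * x ^ 2) * (n ! * (∏ j : Fin (n + 1), mnorm j) *
        ∑ j ∈ Finset.range (n + 1),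
          (mpoly (1 / 4) j).eval x * (mpoly (1 / 4) j).eval x / mnorm j)
        = ∑ j ∈ Finset.range (n + 1), (n ! * (∏ j : Fin (n + 1), mnorm j) / mnorm j)
          * (cexp ((2 : ℝ) * x ^ 2)
            * ((mpoly (1 / 4) j).eval x * (mpoly (1 / 4) j).eval x)) := by
      intro x
      rw [Finset.mul_sum, Finset.mul_sum]
      exact Finset.sum_congr rfl fun j _ => by ring
    simp only [h2]
    rw [lineInt_sum _ fun j _ => LineIntegrable.const_mul _ ?_]
    · simp only [lineInt_const_mul, lineInt_mpoly_orthogonal, if_true,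
        div_mul_cancel₀ _ (mnorm_ne_zero _), Finset.sum_const, Finset.card_range, nsmul_eq_mul]
      rw [Nat.factorial_succ]
      push_cast
      ring
    · exact ((PolyGrowthOn.polynomial _).mul (PolyGrowthOn.polynomial _)).lineIntegrable two_pos

theorem Theta_zero_zero_ne_zero {c : ℝ} (hc : 0 < c) (r : ℕ) : Theta c r 0 0 0 0 ≠ 0 := by
  rw [Theta_zero_zero_eq hc]
  exact mul_ne_zero (by exact_mod_cast r.factorial_ne_zero)
    (Finset.prod_ne_zero_iff.2 fun j _ => mnorm_ne_zero j)

theorem mul_ThetaPlus_div {c : ℝ} (hc : 0 < c) (r : ℕ) (v z : ℂ) :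
    r * (ThetaPlus c (r - 1) 0 0 v z / Theta c r 0 0 0 0) = cdKernel r v z := by
  cases r with
  | zero => simp [cdKernel]
  | succ n =>
    have h0 := Theta_zero_zero_ne_zero hc (n + 1)
    rw [mul_div_assoc', div_eq_iff h0, Nat.add_sub_cancel, ThetaPlus_eq_cdKernel,
      Theta_zero_zero_eq hc, Nat.factorial_succ]
    push_cast
    ring

/-- The Cauchy transform of `e^{2x²} q_j(x)` along `Re x = c`. -/
noncomputable def cauchyT (c : ℝ) (j : ℕ) (v : ℂ) : ℂ :=
  lineInt c fun x => cexp ((2 : ℝ) * x ^ 2) * ((mpoly (1 / 4) j).eval x * (x - v)⁻¹)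

theorem lineInt_eq_cauchyT (c : ℝ) (j : ℕ) (v : ℂ) :
    (lineInt c fun x => cexp ((2 : ℝ) * x ^ 2) * ((mpoly (1 / 4) j).eval x * (x - v)⁻¹))
      = cauchyT c j v := rfl

theorem PolyGrowthOn.inv_sub' {a b : ℝ} {v : ℂ} (hv : v.re < a) :
    PolyGrowthOn (vstrip a b) (fun z => (z - v)⁻¹) :=
  (PolyGrowthOn.inv_sub hv).neg.congr fun z _ => by rw [← inv_neg, neg_sub]

/-- The correction carries the factor z - v. It cancels the 1/(z-v) of the tacnode kernel, and v and
z then separate in every term of the sum. -/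
theorem Theta_div {c : ℝ} (hc : 0 < c) (r : ℕ) {v : ℂ} (hv : v.re < c) (z : ℂ) :
    Theta c r 0 0 v z / Theta c r 0 0 0 0
      = 1 - (z - v) * ∑ j ∈ Finset.range r,
          (mpoly (1 / 4) j).eval z / mnorm j * cauchyT c j v := by
  have h0 := Theta_zero_zero_ne_zero hc r
  cases r with
  | zero =>
    have h1 : Theta c 0 0 0 v z = Theta c 0 0 0 0 0 := by
      rw [Theta_zero_zero hc, Theta_eq_gaussN]
      simp
    simp [h1, div_self h0]
  | succ n =>
    suffices h : (n + 1) * (lineInt c fun x =>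
        cexp ((2 : ℝ) * x ^ 2) * ((v - x)⁻¹ * ThetaPlus c n 0 0 x z))
        = -((∑ j ∈ Finset.range (n + 1), (mpoly (1 / 4) j).eval z / mnorm j * cauchyT c j v)
          * Theta c (n + 1) 0 0 0 0) by
      rw [div_eq_iff h0, Theta_succ hc hv z, h]
      ring
    have h1 : ∀ x : ℂ, cexp ((2 : ℝ) * x ^ 2) * ((v - x)⁻¹ * ThetaPlus c n 0 0 x z)
        = ∑ j ∈ Finset.range (n + 1), -(n ! * (∏ j : Fin (n + 1), mnorm j)
            * ((mpoly (1 / 4) j).eval z / mnorm j))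
          * (cexp ((2 : ℝ) * x ^ 2) * ((mpoly (1 / 4) j).eval x * (x - v)⁻¹)) := by
      intro x
      rw [ThetaPlus_eq_cdKernel, cdKernel, Finset.mul_sum, Finset.mul_sum, Finset.mul_sum]
      refine Finset.sum_congr rfl fun j _ => ?_
      rw [← neg_sub x v, inv_neg]
      ring
    simp only [h1]
    rw [lineInt_sum _ fun j _ => LineIntegrable.const_mul _ ?_]
    · simp only [lineInt_const_mul, lineInt_eq_cauchyT]
      rw [Theta_zero_zero_eq hc, Nat.factorial_succ, Finset.sum_mul, Finset.mul_sum,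
        ← Finset.sum_neg_distrib]
      refine Finset.sum_congr rfl fun j _ => ?_
      push_cast
      ring
    · exact ((PolyGrowthOn.polynomial _).mul (PolyGrowthOn.inv_sub' hv)).lineIntegrable two_pos

/-- The formula for Θ_r(z,x)/Θ_r(0,0) is inserted under the x-integral; its factor x - z cancels one
pole, and a sum of products of Cauchy transforms remains. -/
theorem ThetaMinus_div {c : ℝ} (hc : 0 < c) (r : ℕ) {v z : ℂ} (hv : v.re < c) (hz : z.re < c) :
    1 / (r + 1 : ℂ) * (ThetaMinus c (r + 1) 0 0 v z / Theta c r 0 0 0 0)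
      = lineInt c (fun x => cexp ((2 : ℝ) * x ^ 2) * ((x - v)⁻¹ * (x - z)⁻¹))
        - ∑ j ∈ Finset.range r, cauchyT c j v * cauchyT c j z / mnorm j := by
  have h0 := Theta_zero_zero_ne_zero hc r
  have hr : (r + 1 : ℂ) ≠ 0 := by exact_mod_cast r.succ_ne_zero
  have hne : ∀ u : ℂ, u.re < c → ∀ x ∈ vstrip c c, x - u ≠ 0 := by
    intro u hu x hx h
    rw [sub_eq_zero.1 h] at hx
    exact absurd hx.1 (not_le.2 hu)
  have h1 : ∀ x ∈ vstrip c c,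
      cexp ((2 : ℝ) * x ^ 2) * ((v - x)⁻¹ * (z - x)⁻¹ * Theta c r 0 0 z x)
      = Theta c r 0 0 0 0 * (cexp ((2 : ℝ) * x ^ 2) * ((x - v)⁻¹ * (x - z)⁻¹)
        - ∑ j ∈ Finset.range r, (cauchyT c j z / mnorm j) *
          (cexp ((2 : ℝ) * x ^ 2) * ((mpoly (1 / 4) j).eval x * (x - v)⁻¹))) := by
    intro x hx
    rw [← div_mul_cancel₀ (Theta c r 0 0 z x) h0, Theta_div hc r hz x, ← neg_sub x v,
      ← neg_sub x z, inv_neg, inv_neg]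
    have h2 := hne z hz x hx
    have h3 : (x - z)⁻¹ * ((x - z) * ∑ j ∈ Finset.range r,
          (mpoly (1 / 4) j).eval x / mnorm j * cauchyT c j z)
        = ∑ j ∈ Finset.range r, (mpoly (1 / 4) j).eval x / mnorm j * cauchyT c j z := by
      rw [← mul_assoc, inv_mul_cancel₀ h2, one_mul]
    have h4 : ∑ j ∈ Finset.range r, (cauchyT c j z / mnorm j) *
          (cexp ((2 : ℝ) * x ^ 2) * ((mpoly (1 / 4) j).eval x * (x - v)⁻¹))
        = cexp ((2 : ℝ) * x ^ 2) * (x - v)⁻¹ * ∑ j ∈ Finset.range r,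
          (mpoly (1 / 4) j).eval x / mnorm j * cauchyT c j z := by
      rw [Finset.mul_sum]
      exact Finset.sum_congr rfl fun j _ => by ring
    rw [h4]
    linear_combination -(cexp ((2 : ℝ) * x ^ 2) * (x - v)⁻¹ * Theta c r 0 0 0 0) * h3
  have hi : ∀ j, LineIntegrable c fun x =>
      cexp ((2 : ℝ) * x ^ 2) * ((mpoly (1 / 4) j).eval x * (x - v)⁻¹) := fun j =>
    ((PolyGrowthOn.polynomial _).mul (PolyGrowthOn.inv_sub' hv)).lineIntegrable two_pos
  have hiS : LineIntegrable c fun x => ∑ j ∈ Finset.range r, (cauchyT c j z / mnorm j) *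
      (cexp ((2 : ℝ) * x ^ 2) * ((mpoly (1 / 4) j).eval x * (x - v)⁻¹)) := by
    unfold LineIntegrable
    exact integrable_finsetSum _ fun j _ => (hi j).const_mul _
  rw [ThetaMinus_succ hv hz, lineInt_congr h1, lineInt_const_mul, lineInt_sub
    (((PolyGrowthOn.inv_sub' hv).mul (PolyGrowthOn.inv_sub' hz)).lineIntegrable two_pos) hiS,
    lineInt_sum _ fun j _ => (hi j).const_mul _]
  simp only [lineInt_const_mul, lineInt_eq_cauchyT]
  have h5 : ∑ j ∈ Finset.range r, cauchyT c j v * cauchyT c j z / mnorm j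
      = ∑ j ∈ Finset.range r, cauchyT c j z / mnorm j * cauchyT c j v :=
    Finset.sum_congr rfl fun j _ => by ring
  rw [h5]
  generalize (lineInt c fun x => cexp ((2 : ℝ) * x ^ 2) * ((x - v)⁻¹ * (x - z)⁻¹))
    - ∑ j ∈ Finset.range r, cauchyT c j z / mnorm j * cauchyT c j v = A
  field_simp

/-! ### Circle integrals and their exchange with line integrals -/

section circle

variable {δ c κ : ℝ}

theorem re_lt_of_mem_sphere (hc : δ < c) {v : ℂ} (hv : v ∈ Metric.sphere (0 : ℂ) δ) :
    v.re < c := by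
  have : ‖v‖ = δ := by simpa using hv
  exact ((le_abs_self _).trans (abs_re_le_norm v)).trans_lt (this ▸ hc)

theorem circInt_congr (hδ : 0 < δ) {f g : ℂ → ℂ}
    (h : ∀ v ∈ Metric.sphere (0 : ℂ) δ, f v = g v) : circInt δ f = circInt δ g := by
  unfold circInt
  rw [circleIntegral.integral_congr hδ.le h]

theorem circInt_const_mul (a : ℂ) (f : ℂ → ℂ) :
    circInt δ (fun v => a * f v) = a * circInt δ f := by
  unfold circInt
  rw [circleIntegral.integral_const_mul]
  ring

theorem circInt_add {f g : ℂ → ℂ} (hf : CircleIntegrable f 0 δ) (hg : CircleIntegrable g 0 δ) :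
    circInt δ (fun v => f v + g v) = circInt δ f + circInt δ g := by
  unfold circInt
  rw [circleIntegral.integral_add hf hg, mul_add]

theorem circInt_sub {f g : ℂ → ℂ} (hf : CircleIntegrable f 0 δ) (hg : CircleIntegrable g 0 δ) :
    circInt δ (fun v => f v - g v) = circInt δ f - circInt δ g := by
  unfold circInt
  rw [circleIntegral.integral_sub hf hg, mul_sub]

theorem circInt_sum {ι : Type*} (s : Finset ι) {f : ι → ℂ → ℂ}
    (hf : ∀ i ∈ s, CircleIntegrable (f i) 0 δ) :
    circInt δ (fun v => ∑ i ∈ s, f i v) = ∑ i ∈ s, circInt δ (f i) := by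
  unfold circInt
  rw [circleIntegral.integral_fun_sum hf, Finset.mul_sum]

theorem _root_.CircleIntegrable.finset_sum {ι : Type*} (s : Finset ι) {f : ι → ℂ → ℂ}
    (hf : ∀ i ∈ s, CircleIntegrable (f i) 0 δ) :
    CircleIntegrable (fun v => ∑ i ∈ s, f i v) 0 δ := by
  have := CircleIntegrable.sum s hf
  simpa [Finset.sum_fn] using this

theorem _root_.CircleIntegrable.const_mul {f : ℂ → ℂ} (a : ℂ) (hf : CircleIntegrable f 0 δ) :
    CircleIntegrable (fun v => a * f v) 0 δ := hf.const_smul (a := a)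

/-- The circle and the line are at distance c - δ > 0, so the Cauchy factor is bounded and the
Gaussian on the line gives integrability of the product. -/
theorem integrable_circle_line (hδ : 0 < δ) (hc : δ < c) (hκ : 0 < κ) {B : ℝ → ℂ}
    (hB : Continuous B) {M : ℝ} (hM : ∀ θ, ‖B θ‖ ≤ M) {g : ℂ → ℂ}
    (hg : PolyGrowthOn (vstrip c c) g) :
    Integrable (Function.uncurry fun θ t : ℝ => B θ * (cexp (κ * (c + t * I : ℂ) ^ 2)
      * (g (c + t * I) * (c + t * I - circleMap 0 δ θ)⁻¹)))
      ((volume.restrict (Set.uIoc 0 (2 * π))).prod volume) := by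
  have hgap : ∀ θ t : ℝ, c - δ ≤ ‖(c + t * I - circleMap 0 δ θ : ℂ)‖ := by
    intro θ t
    have h1 : (circleMap 0 δ θ).re ≤ δ := by
      refine ((le_abs_self _).trans (abs_re_le_norm _)).trans ?_
      rw [norm_circleMap_zero, abs_of_pos hδ]
    have h2 : (c + t * I - circleMap 0 δ θ : ℂ).re = c - (circleMap 0 δ θ).re := by simp
    refine le_trans ?_ ((le_abs_self _).trans (abs_re_le_norm _))
    rw [h2]
    linarith
  have hfin : IsFiniteMeasure (volume.restrict (Set.uIoc 0 (2 * π))) := by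
    rw [Set.uIoc_of_le Real.two_pi_pos.le]
    infer_instance
  have h0 : Integrable (fun p : ℝ × ℝ => (1 : ℂ) * (cexp (κ * (c + p.2 * I : ℂ) ^ 2)
      * g (c + p.2 * I))) ((volume.restrict (Set.uIoc 0 (2 * π))).prod volume) := by
    exact Integrable.mul_prod (f := fun _ : ℝ => (1 : ℂ))
      (g := fun t : ℝ => cexp (κ * (c + t * I : ℂ) ^ 2) * g (c + t * I)) (integrable_const 1)
      (hg.lineIntegrable hκ)
  have hcont : Continuous fun p : ℝ × ℝ =>
      B p.1 * (c + p.2 * I - circleMap 0 δ p.1 : ℂ)⁻¹ := by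
    refine (hB.comp continuous_fst).mul (Continuous.inv₀ ?_ fun p => ?_)
    · exact Continuous.sub (by fun_prop) ((continuous_circleMap 0 δ).comp continuous_fst)
    · exact norm_pos_iff.1 ((sub_pos.2 hc).trans_le (hgap p.1 p.2))
  refine (h0.bdd_mul (c := M * (c - δ)⁻¹) hcont.aestronglyMeasurable
    (Eventually.of_forall fun p => ?_)).congr (Eventually.of_forall fun p => ?_)
  · rw [norm_mul, norm_inv]
    exact mul_le_mul (hM _) (inv_anti₀ (sub_pos.2 hc) (hgap _ _)) (by positivity)
      ((norm_nonneg _).trans (hM 0))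
  · simp only [Function.uncurry]
    ring

theorem continuous_comp_circleMap (hδ : 0 < δ) {A : ℂ → ℂ}
    (hA : ContinuousOn A (Metric.sphere 0 δ)) : Continuous fun θ => A (circleMap 0 δ θ) :=
  hA.comp_continuous (continuous_circleMap 0 δ) fun θ => circleMap_mem_sphere 0 hδ.le θ

theorem exists_bound_comp_circleMap (hδ : 0 < δ) {A : ℂ → ℂ}
    (hA : ContinuousOn A (Metric.sphere 0 δ)) : ∃ M, ∀ θ, ‖A (circleMap 0 δ θ)‖ ≤ M := by
  obtain ⟨M, hM⟩ := (isCompact_sphere (0 : ℂ) δ).exists_bound_of_continuousOn hA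
  exact ⟨M, fun θ => hM _ (circleMap_mem_sphere 0 hδ.le θ)⟩

theorem circleIntegrable_mul_lineInt (hδ : 0 < δ) (hc : δ < c) (hκ : 0 < κ) {A g : ℂ → ℂ}
    (hA : ContinuousOn A (Metric.sphere 0 δ)) (hg : PolyGrowthOn (vstrip c c) g) :
    CircleIntegrable (fun v => A v * lineInt c fun w =>
      cexp (κ * w ^ 2) * (g w * (w - v)⁻¹)) 0 δ := by
  obtain ⟨M, hM⟩ := exists_bound_comp_circleMap hδ hA
  have h := (integrable_circle_line hδ hc hκ (continuous_comp_circleMap hδ hA) hM hg)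
  have h1 := h.integral_prod_left
  simp only [Function.uncurry, integral_const_mul] at h1
  rw [CircleIntegrable, intervalIntegrable_iff]
  refine (h1.mul_const ((2 * π * I)⁻¹ * I)).congr (Eventually.of_forall fun θ => ?_)
  simp only [lineInt, integral_mul_const]
  ring

/-- Interchange of a circle integral and a line integral. -/
theorem circInt_lineInt_swap (hδ : 0 < δ) (hc : δ < c) (hκ : 0 < κ) {A g : ℂ → ℂ}
    (hA : ContinuousOn A (Metric.sphere 0 δ)) (hg : PolyGrowthOn (vstrip c c) g) :
    circInt δ (fun v => A v * lineInt c fun w => cexp (κ * w ^ 2) * (g w * (w - v)⁻¹))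
      = lineInt c fun w => cexp (κ * w ^ 2) * (g w * circInt δ fun v => A v * (w - v)⁻¹) := by
  have hA' : ContinuousOn (fun v => v * I * A v) (Metric.sphere 0 δ) := by fun_prop
  obtain ⟨M, hM⟩ := exists_bound_comp_circleMap hδ hA'
  have h := intervalIntegral_integral_swap
    (integrable_circle_line hδ hc hκ (continuous_comp_circleMap hδ hA') hM hg)
  unfold circInt lineInt circleIntegral
  simp only [deriv_circleMap, smul_eq_mul]
  have e1 : ∀ θ : ℝ, circleMap 0 δ θ * I * (A (circleMap 0 δ θ) * ((2 * π * I)⁻¹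
        * ∫ t : ℝ, cexp (κ * (c + t * I : ℂ) ^ 2)
          * (g (c + t * I) * (c + t * I - circleMap 0 δ θ)⁻¹) * I))
      = (2 * π * I)⁻¹ * I * ∫ t : ℝ, circleMap 0 δ θ * I * A (circleMap 0 δ θ)
        * (cexp (κ * (c + t * I : ℂ) ^ 2)
          * (g (c + t * I) * (c + t * I - circleMap 0 δ θ)⁻¹)) := by
    intro θ
    simp only [integral_const_mul, integral_mul_const]
    ring
  have e2 : ∀ t : ℝ, cexp (κ * (c + t * I : ℂ) ^ 2) * (g (c + t * I) * ((2 * π * I)⁻¹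
        * ∫ θ in (0 : ℝ)..2 * π, circleMap 0 δ θ * I
          * (A (circleMap 0 δ θ) * (c + t * I - circleMap 0 δ θ)⁻¹))) * I
      = (2 * π * I)⁻¹ * I * ∫ θ in (0 : ℝ)..2 * π, circleMap 0 δ θ * I * A (circleMap 0 δ θ)
        * (cexp (κ * (c + t * I : ℂ) ^ 2)
          * (g (c + t * I) * (c + t * I - circleMap 0 δ θ)⁻¹)) := by
    intro t
    have : ∀ θ : ℝ, circleMap 0 δ θ * I * A (circleMap 0 δ θ)
        * (cexp (κ * (c + t * I : ℂ) ^ 2) * (g (c + t * I) * (c + t * I - circleMap 0 δ θ)⁻¹))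
        = (cexp (κ * (c + t * I : ℂ) ^ 2) * g (c + t * I)) * (circleMap 0 δ θ * I
          * (A (circleMap 0 δ θ) * (c + t * I - circleMap 0 δ θ)⁻¹)) := by
      intro θ
      ring
    simp only [this, intervalIntegral.integral_const_mul]
    ring
  simp only [e1, intervalIntegral.integral_const_mul]
  rw [h]
  simp only [e2]
  rw [integral_const_mul]

end circle

/-! ### Reduction of the kernel to single integrals -/

section core

variable {δ c : ℝ} {A A' b b' Φ Φ' : ℂ → ℂ}

theorem LineIntegrable.finset_sum {ι : Type*} (s : Finset ι) {f : ι → ℂ → ℂ}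
    (hf : ∀ i ∈ s, LineIntegrable c (f i)) : LineIntegrable c fun z => ∑ i ∈ s, f i z :=
  integrable_finsetSum _ hf

/-- After Fubini the circle integral meets a Cauchy factor both in the leading term and inside
`cauchyT`, so Φ appears in both: with weight e^{z²} in the first and e^{2z²} in the second. -/
theorem circInt_lineInt_kernel (hδ : 0 < δ) (hc : δ < c)
    (hA : ContinuousOn A (Metric.sphere 0 δ)) (hb : PolyGrowthOn (vstrip c c) b)
    (hΦ : ∀ w ∈ vstrip c c, circInt δ (fun v => A v * (w - v)⁻¹) = Φ w) (r : ℕ) :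
    circInt δ (fun v => lineInt c fun z => A v * (cexp ((1 : ℝ) * z ^ 2) * (b z * ((z - v)⁻¹
        - ∑ j ∈ Finset.range r, (mpoly (1 / 4) j).eval z / mnorm j * cauchyT c j v))))
      = lineInt c (fun z => cexp ((1 : ℝ) * z ^ 2) * (b z * Φ z))
        - ∑ j ∈ Finset.range r,
          lineInt c (fun z => cexp ((1 : ℝ) * z ^ 2) * (b z * (mpoly (1 / 4) j).eval z)) / mnorm j
            * lineInt c (fun z => cexp ((2 : ℝ) * z ^ 2) * ((mpoly (1 / 4) j).eval z * Φ z)) := by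
  have hi1 : ∀ j, LineIntegrable c fun z =>
      cexp ((1 : ℝ) * z ^ 2) * (b z * (mpoly (1 / 4) j).eval z) := fun j =>
    (hb.mul (PolyGrowthOn.polynomial _)).lineIntegrable one_pos
  have hinner : ∀ v ∈ Metric.sphere (0 : ℂ) δ,
      (lineInt c fun z => A v * (cexp ((1 : ℝ) * z ^ 2) * (b z * ((z - v)⁻¹
        - ∑ j ∈ Finset.range r, (mpoly (1 / 4) j).eval z / mnorm j * cauchyT c j v))))
      = A v * lineInt c (fun z => cexp ((1 : ℝ) * z ^ 2) * (b z * (z - v)⁻¹))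
        - ∑ j ∈ Finset.range r,
          lineInt c (fun z => cexp ((1 : ℝ) * z ^ 2) * (b z * (mpoly (1 / 4) j).eval z)) / mnorm j
            * (A v * cauchyT c j v) := by
    intro v hv
    have h1 : ∀ z : ℂ, cexp ((1 : ℝ) * z ^ 2) * (b z * ((z - v)⁻¹
        - ∑ j ∈ Finset.range r, (mpoly (1 / 4) j).eval z / mnorm j * cauchyT c j v))
        = cexp ((1 : ℝ) * z ^ 2) * (b z * (z - v)⁻¹)
          - ∑ j ∈ Finset.range r, (cauchyT c j v / mnorm j)
            * (cexp ((1 : ℝ) * z ^ 2) * (b z * (mpoly (1 / 4) j).eval z)) := by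
      intro z
      rw [mul_sub, mul_sub, Finset.mul_sum, Finset.mul_sum]
      congr 1
      exact Finset.sum_congr rfl fun j _ => by ring
    simp only [h1]
    rw [lineInt_const_mul, lineInt_sub
      ((hb.mul (PolyGrowthOn.inv_sub' (re_lt_of_mem_sphere hc hv))).lineIntegrable one_pos)
      (LineIntegrable.finset_sum _ fun j _ => (hi1 j).const_mul _),
      lineInt_sum _ fun j _ => (hi1 j).const_mul _, mul_sub, Finset.mul_sum]
    congr 1
    refine Finset.sum_congr rfl fun j _ => ?_
    rw [lineInt_const_mul]
    ring
  have hci : ∀ j, CircleIntegrable (fun v => A v * cauchyT c j v) 0 δ := fun j =>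
    circleIntegrable_mul_lineInt hδ hc two_pos hA (PolyGrowthOn.polynomial _)
  rw [circInt_congr hδ hinner, circInt_sub (circleIntegrable_mul_lineInt hδ hc one_pos hA hb)
    (CircleIntegrable.finset_sum _ fun j _ => (hci j).const_mul _),
    circInt_sum _ fun j _ => (hci j).const_mul _, circInt_lineInt_swap hδ hc one_pos hA hb]
  congr 1
  · exact lineInt_congr fun w hw => by rw [hΦ w hw]
  · refine Finset.sum_congr rfl fun j _ => ?_
    rw [circInt_const_mul]
    congr 1
    have := circInt_lineInt_swap hδ hc two_pos hA
      (PolyGrowthOn.polynomial (S := vstrip c c) (mpoly (1 / 4) j))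
    rw [show (fun v => A v * cauchyT c j v) = fun v => A v * lineInt c fun w =>
      cexp ((2 : ℝ) * w ^ 2) * ((mpoly (1 / 4) j).eval w * (w - v)⁻¹) from rfl, this]
    exact lineInt_congr fun w hw => by rw [hΦ w hw]

/-- Both circle variables are removed by the Cauchy factors, first z and then v, so only integrals
over x with weight e^{2x²} survive. -/
theorem circInt_circInt_kernel (hδ : 0 < δ) (hc : δ < c)
    (hA : ContinuousOn A (Metric.sphere 0 δ)) (hA' : ContinuousOn A' (Metric.sphere 0 δ))
    (hΦ : ∀ w ∈ vstrip c c, circInt δ (fun v => A v * (w - v)⁻¹) = Φ w)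
    (hΦ' : ∀ w ∈ vstrip c c, circInt δ (fun v => A' v * (w - v)⁻¹) = Φ' w)
    (hΦ'g : PolyGrowthOn (vstrip c c) Φ') (r : ℕ) :
    circInt δ (fun v => circInt δ fun z => A v * A' z *
        (lineInt c (fun x => cexp ((2 : ℝ) * x ^ 2) * ((x - v)⁻¹ * (x - z)⁻¹))
        - ∑ j ∈ Finset.range r, cauchyT c j v * cauchyT c j z / mnorm j))
      = lineInt c (fun z => cexp ((2 : ℝ) * z ^ 2) * (Φ z * Φ' z))
        - ∑ j ∈ Finset.range r,
          lineInt c (fun z => cexp ((2 : ℝ) * z ^ 2) * ((mpoly (1 / 4) j).eval z * Φ z)) / mnorm j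
            * lineInt c (fun z => cexp ((2 : ℝ) * z ^ 2) * ((mpoly (1 / 4) j).eval z * Φ' z)) := by
  have hci : ∀ {A : ℂ → ℂ}, ContinuousOn A (Metric.sphere 0 δ) →
      ∀ j, CircleIntegrable (fun v => A v * cauchyT c j v) 0 δ := fun hA j =>
    circleIntegrable_mul_lineInt hδ hc two_pos hA (PolyGrowthOn.polynomial _)
  have hct : ∀ {A Φ : ℂ → ℂ}, ContinuousOn A (Metric.sphere 0 δ) →
      (∀ w ∈ vstrip c c, circInt δ (fun v => A v * (w - v)⁻¹) = Φ w) → ∀ j,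
      circInt δ (fun v => A v * cauchyT c j v)
        = lineInt c (fun z => cexp ((2 : ℝ) * z ^ 2) * ((mpoly (1 / 4) j).eval z * Φ z)) := by
    intro A Φ hA hΦ j
    have := circInt_lineInt_swap hδ hc two_pos hA
      (PolyGrowthOn.polynomial (S := vstrip c c) (mpoly (1 / 4) j))
    rw [show (fun v => A v * cauchyT c j v) = fun v => A v * lineInt c fun w =>
      cexp ((2 : ℝ) * w ^ 2) * ((mpoly (1 / 4) j).eval w * (w - v)⁻¹) from rfl, this]
    exact lineInt_congr fun w hw => by rw [hΦ w hw]
  have hinner : ∀ v ∈ Metric.sphere (0 : ℂ) δ,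
      (circInt δ fun z => A v * A' z *
        (lineInt c (fun x => cexp ((2 : ℝ) * x ^ 2) * ((x - v)⁻¹ * (x - z)⁻¹))
        - ∑ j ∈ Finset.range r, cauchyT c j v * cauchyT c j z / mnorm j))
      = A v * lineInt c (fun x => cexp ((2 : ℝ) * x ^ 2) * (Φ' x * (x - v)⁻¹))
        - ∑ j ∈ Finset.range r,
          lineInt c (fun z => cexp ((2 : ℝ) * z ^ 2) * ((mpoly (1 / 4) j).eval z * Φ' z)) / mnorm j
            * (A v * cauchyT c j v) := by
    intro v hv
    have hpg := PolyGrowthOn.inv_sub' (a := c) (b := c) (re_lt_of_mem_sphere hc hv)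
    have h1 : ∀ z : ℂ, A v * A' z *
        (lineInt c (fun x => cexp ((2 : ℝ) * x ^ 2) * ((x - v)⁻¹ * (x - z)⁻¹))
        - ∑ j ∈ Finset.range r, cauchyT c j v * cauchyT c j z / mnorm j)
        = A v * (A' z * lineInt c (fun x => cexp ((2 : ℝ) * x ^ 2) * ((x - v)⁻¹ * (x - z)⁻¹)))
          - ∑ j ∈ Finset.range r, (A v * cauchyT c j v / mnorm j) * (A' z * cauchyT c j z) := by
      intro z
      rw [mul_sub, Finset.mul_sum, mul_assoc]
      congr 1
      exact Finset.sum_congr rfl fun j _ => by ring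
    simp only [h1]
    rw [circInt_sub ((circleIntegrable_mul_lineInt hδ hc two_pos hA' hpg).const_mul _)
      (CircleIntegrable.finset_sum _ fun j _ => (hci hA' j).const_mul _),
      circInt_sum _ fun j _ => (hci hA' j).const_mul _, circInt_const_mul,
      circInt_lineInt_swap hδ hc two_pos hA' hpg]
    congr 1
    · congr 1
      exact lineInt_congr fun w hw => by rw [hΦ' w hw, mul_comm (Φ' w)]
    · refine Finset.sum_congr rfl fun j _ => ?_
      rw [circInt_const_mul, hct hA' hΦ']
      ring
  rw [circInt_congr hδ hinner, circInt_sub (circleIntegrable_mul_lineInt hδ hc two_pos hA hΦ'g)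
    (CircleIntegrable.finset_sum _ fun j _ => (hci hA j).const_mul _),
    circInt_sum _ fun j _ => (hci hA j).const_mul _, circInt_lineInt_swap hδ hc two_pos hA hΦ'g]
  congr 1
  · exact lineInt_congr fun w hw => by rw [hΦ w hw, mul_comm (Φ' w)]
  · refine Finset.sum_congr rfl fun j _ => ?_
    rw [circInt_const_mul, hct hA hΦ]
    ring

theorem lineInt_lineInt_cdKernel (hb : PolyGrowthOn (vstrip c c) b)
    (hb' : PolyGrowthOn (vstrip c c) b') (r : ℕ) :
    lineInt c (fun v => lineInt c fun z => (cexp ((1 : ℝ) * v ^ 2) * b v)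
        * (cexp ((1 : ℝ) * z ^ 2) * b' z) * cdKernel r v z)
      = ∑ j ∈ Finset.range r,
        lineInt c (fun z => cexp ((1 : ℝ) * z ^ 2) * (b z * (mpoly (1 / 4) j).eval z)) / mnorm j
          * lineInt c (fun z => cexp ((1 : ℝ) * z ^ 2) * (b' z * (mpoly (1 / 4) j).eval z)) := by
  have hi : ∀ {b : ℂ → ℂ}, PolyGrowthOn (vstrip c c) b → ∀ j, LineIntegrable c fun z =>
      cexp ((1 : ℝ) * z ^ 2) * (b z * (mpoly (1 / 4) j).eval z) := fun hb j =>
    (hb.mul (PolyGrowthOn.polynomial _)).lineIntegrable one_pos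
  have h1 : ∀ v z : ℂ, (cexp ((1 : ℝ) * v ^ 2) * b v)
        * (cexp ((1 : ℝ) * z ^ 2) * b' z) * cdKernel r v z
      = ∑ j ∈ Finset.range r, (cexp ((1 : ℝ) * v ^ 2) * (b v * (mpoly (1 / 4) j).eval v) / mnorm j)
          * (cexp ((1 : ℝ) * z ^ 2) * (b' z * (mpoly (1 / 4) j).eval z)) := by
    intro v z
    rw [cdKernel, Finset.mul_sum]
    exact Finset.sum_congr rfl fun j _ => by ring
  have h2 : ∀ v : ℂ, (lineInt c fun z => (cexp ((1 : ℝ) * v ^ 2) * b v)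
        * (cexp ((1 : ℝ) * z ^ 2) * b' z) * cdKernel r v z)
      = ∑ j ∈ Finset.range r,
        (lineInt c (fun z => cexp ((1 : ℝ) * z ^ 2) * (b' z * (mpoly (1 / 4) j).eval z)) / mnorm j)
          * (cexp ((1 : ℝ) * v ^ 2) * (b v * (mpoly (1 / 4) j).eval v)) := by
    intro v
    simp only [h1]
    rw [lineInt_sum _ fun j _ => (hi hb' j).const_mul _]
    refine Finset.sum_congr rfl fun j _ => ?_
    rw [lineInt_const_mul]
    ring
  simp only [h2]
  rw [lineInt_sum _ fun j _ => (hi hb j).const_mul _]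
  refine Finset.sum_congr rfl fun j _ => ?_
  rw [lineInt_const_mul]
  ring

end core

/-- The kernel at `ρ = β = 0` as a sum of single integrals and products of single integrals. -/
theorem dTac_eq {δ c : ℝ} (hδ : 0 < δ) (hc : δ < c) (r : ℕ) (τ₁ τ₂ : ℤ) (θ₁ θ₂ : ℝ)
    {Φ₁ Φ₂ : ℂ → ℂ}
    (hΦ₁ : ∀ w ∈ vstrip c c,
      circInt δ (fun v => v ^ (-τ₁) * cexp (-v ^ 2 - θ₁ * v) * (w - v)⁻¹) = Φ₁ w)
    (hΦ₂ : ∀ w ∈ vstrip c c,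
      circInt δ (fun v => v ^ τ₂ * cexp (-v ^ 2 + θ₂ * v) * (w - v)⁻¹) = Φ₂ w)
    (hg₁ : PolyGrowthOn (vstrip c c) Φ₁) (hg₂ : PolyGrowthOn (vstrip c c) Φ₂) :
    dTac δ c r 0 0 τ₁ θ₁ τ₂ θ₂ = -(heaviside (τ₁ - τ₂) (θ₂ - θ₁) : ℂ)
      + lineInt c (fun z => cexp ((1 : ℝ) * z ^ 2) * (z ^ τ₂ * cexp (θ₂ * z) * Φ₁ z))
      + lineInt c (fun z => cexp ((1 : ℝ) * z ^ 2) * (z ^ (-τ₁) * cexp ((-θ₁ : ℝ) * z) * Φ₂ z))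
      - lineInt c (fun z => cexp ((2 : ℝ) * z ^ 2) * (Φ₁ z * Φ₂ z))
      + ∑ j ∈ Finset.range r, (mnorm j)⁻¹
        * lineInt c (fun z => (cexp ((1 : ℝ) * z ^ 2) * (z ^ (-τ₁) * cexp ((-θ₁ : ℝ) * z))
            - cexp ((2 : ℝ) * z ^ 2) * Φ₁ z) * (mpoly (1 / 4) j).eval z)
        * lineInt c (fun z => (cexp ((1 : ℝ) * z ^ 2) * (z ^ τ₂ * cexp (θ₂ * z))
            - cexp ((2 : ℝ) * z ^ 2) * Φ₂ z) * (mpoly (1 / 4) j).eval z) := by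
  have hc0 : 0 < c := hδ.trans hc
  set A₁ : ℂ → ℂ := fun v => v ^ (-τ₁) * cexp (-v ^ 2 - θ₁ * v) with hA₁
  set A₂ : ℂ → ℂ := fun v => v ^ τ₂ * cexp (-v ^ 2 + θ₂ * v) with hA₂
  set b₁ : ℂ → ℂ := fun z => z ^ (-τ₁) * cexp ((-θ₁ : ℝ) * z) with hb₁
  set b₂ : ℂ → ℂ := fun z => z ^ τ₂ * cexp (θ₂ * z) with hb₂
  have hne : ∀ v ∈ Metric.sphere (0 : ℂ) δ, v ≠ 0 := fun v hv h => by
    simp [h] at hv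
    exact hδ.ne hv
  have hA₁c : ContinuousOn A₁ (Metric.sphere 0 δ) :=
    ContinuousOn.mul (fun v hv => (continuousAt_zpow₀ v _ (Or.inl (hne v hv))).continuousWithinAt)
      (by fun_prop)
  have hA₂c : ContinuousOn A₂ (Metric.sphere 0 δ) :=
    ContinuousOn.mul (fun v hv => (continuousAt_zpow₀ v _ (Or.inl (hne v hv))).continuousWithinAt)
      (by fun_prop)
  have hb₁g : PolyGrowthOn (vstrip c c) b₁ := (PolyGrowthOn.zpow hc0 _).mul (.cexp_mul _)
  have hb₂g : PolyGrowthOn (vstrip c c) b₂ := (PolyGrowthOn.zpow hc0 _).mul (.cexp_mul _)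
  have hker : ∀ v z : ℂ, v.re < c → z ∈ vstrip c c →
      1 / (z - v) * (Theta c r 0 0 v z / Theta c r 0 0 0 0)
        = (z - v)⁻¹ - ∑ j ∈ Finset.range r, (mpoly (1 / 4) j).eval z / mnorm j * cauchyT c j v := by
    intro v z hv hz
    have h : z - v ≠ 0 := by
      intro h
      rw [sub_eq_zero.1 h] at hz
      exact absurd hz.1 (not_le.2 hv)
    rw [Theta_div hc0 r hv z, one_div, mul_sub, mul_one, ← mul_assoc, inv_mul_cancel₀ h, one_mul]
  have T1 := circInt_lineInt_kernel hδ hc hA₁c hb₂g hΦ₁ r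
  have T2 := circInt_lineInt_kernel hδ hc hA₂c hb₁g hΦ₂ r
  have T3 := lineInt_lineInt_cdKernel hb₁g hb₂g r
  have T4 := circInt_circInt_kernel hδ hc hA₁c hA₂c hΦ₁ hΦ₂ hg₂ r
  have hd1 : (circInt δ fun v => lineInt c fun z =>
      1 / (z - v) * (v ^ ((0 : ℤ) - τ₁) / z ^ ((0 : ℤ) - τ₂))
        * (Complex.exp (-v ^ 2 - θ₁ * v) / Complex.exp (-z ^ 2 - θ₂ * z))
        * (Theta c r 0 0 v z / Theta c r 0 0 0 0))
      = circInt δ (fun v => lineInt c fun z => A₁ v * (cexp ((1 : ℝ) * z ^ 2) * (b₂ z * ((z - v)⁻¹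
        - ∑ j ∈ Finset.range r, (mpoly (1 / 4) j).eval z / mnorm j * cauchyT c j v)))) := by
    refine circInt_congr hδ fun v hv => lineInt_congr fun z hz => ?_
    rw [← hker v z (re_lt_of_mem_sphere hc hv) hz, hA₁, hb₂]
    simp only [zero_sub, zpow_neg, div_inv_eq_mul, div_eq_mul_inv (cexp _) (cexp _), ← Complex.exp_neg]
    rw [show -(-z ^ 2 - θ₂ * z) = (1 : ℝ) * z ^ 2 + θ₂ * z by push_cast; ring, Complex.exp_add]
    ring
  have hd2 : (circInt δ fun v => lineInt c fun z =>
      1 / (z - v) * (v ^ τ₂ / z ^ τ₁)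
        * (Complex.exp (-v ^ 2 + (θ₂ - (0 : ℝ)) * v) / Complex.exp (-z ^ 2 + (θ₁ - (0 : ℝ)) * z))
        * (Theta c r 0 0 v z / Theta c r 0 0 0 0))
      = circInt δ (fun v => lineInt c fun z => A₂ v * (cexp ((1 : ℝ) * z ^ 2) * (b₁ z * ((z - v)⁻¹
        - ∑ j ∈ Finset.range r, (mpoly (1 / 4) j).eval z / mnorm j * cauchyT c j v)))) := by
    refine circInt_congr hδ fun v hv => lineInt_congr fun z hz => ?_
    rw [← hker v z (re_lt_of_mem_sphere hc hv) hz, hA₂, hb₁]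
    simp only [ofReal_zero, sub_zero, zpow_neg, div_eq_mul_inv (cexp _) (cexp _), ← Complex.exp_neg]
    rw [show -(-z ^ 2 + θ₁ * z) = (1 : ℝ) * z ^ 2 + (-θ₁ : ℝ) * z by push_cast; ring,
      Complex.exp_add (((1 : ℝ) : ℂ) * z ^ 2)]
    ring
  have hd3 : r * (lineInt c fun v => lineInt c fun z =>
      v ^ (-τ₁) / z ^ ((0 : ℤ) - τ₂)
        * (Complex.exp (v ^ 2 - (θ₁ - (0 : ℝ)) * v) / Complex.exp (-z ^ 2 - θ₂ * z))
        * (ThetaPlus c (r - 1) 0 0 v z / Theta c r 0 0 0 0))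
      = lineInt c (fun v => lineInt c fun z => (cexp ((1 : ℝ) * v ^ 2) * b₁ v)
        * (cexp ((1 : ℝ) * z ^ 2) * b₂ z) * cdKernel r v z) := by
    rw [← lineInt_const_mul]
    refine lineInt_congr fun v hv => ?_
    rw [← lineInt_const_mul]
    refine lineInt_congr fun z hz => ?_
    rw [← mul_ThetaPlus_div hc0, hb₁, hb₂]
    simp only [ofReal_zero, sub_zero, zero_sub, zpow_neg, div_inv_eq_mul,
      div_eq_mul_inv (cexp _) (cexp _), ← Complex.exp_neg]
    rw [show -(-z ^ 2 - θ₂ * z) = (1 : ℝ) * z ^ 2 + θ₂ * z by push_cast; ring,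
      show v ^ 2 - θ₁ * v = (1 : ℝ) * v ^ 2 + (-θ₁ : ℝ) * v by push_cast; ring,
      Complex.exp_add, Complex.exp_add]
    ring
  have hd4 : 1 / ((r : ℂ) + 1) * (circInt δ fun v => circInt δ fun z =>
      v ^ ((0 : ℤ) - τ₁) / z ^ (-τ₂)
        * (Complex.exp (-v ^ 2 - θ₁ * v) / Complex.exp (z ^ 2 - (θ₂ - (0 : ℝ)) * z))
        * (ThetaMinus c (r + 1) 0 0 v z / Theta c r 0 0 0 0))
      = circInt δ (fun v => circInt δ fun z => A₁ v * A₂ z *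
        (lineInt c (fun x => cexp ((2 : ℝ) * x ^ 2) * ((x - v)⁻¹ * (x - z)⁻¹))
        - ∑ j ∈ Finset.range r, cauchyT c j v * cauchyT c j z / mnorm j)) := by
    rw [← circInt_const_mul]
    refine circInt_congr hδ fun v hv => ?_
    rw [← circInt_const_mul]
    refine circInt_congr hδ fun z hz => ?_
    rw [← ThetaMinus_div hc0 r (re_lt_of_mem_sphere hc hv) (re_lt_of_mem_sphere hc hz), hA₁, hA₂]
    simp only [ofReal_zero, sub_zero, zero_sub, zpow_neg, div_inv_eq_mul,
      div_eq_mul_inv (cexp _) (cexp _), ← Complex.exp_neg]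
    rw [show -(z ^ 2 - θ₂ * z) = -z ^ 2 + θ₂ * z by ring]
    ring
  have hi : ∀ {κ : ℝ} (_ : 0 < κ) {g : ℂ → ℂ}, PolyGrowthOn (vstrip c c) g → ∀ j,
      LineIntegrable c fun z => cexp (κ * z ^ 2) * (g z * (mpoly (1 / 4) j).eval z) :=
    fun hκ _ hg j => (hg.mul (PolyGrowthOn.polynomial _)).lineIntegrable hκ
  have hsplit : ∀ {b Φ : ℂ → ℂ}, PolyGrowthOn (vstrip c c) b → PolyGrowthOn (vstrip c c) Φ → ∀ j,
      lineInt c (fun z => (cexp ((1 : ℝ) * z ^ 2) * b z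
            - cexp ((2 : ℝ) * z ^ 2) * Φ z) * (mpoly (1 / 4) j).eval z)
      = lineInt c (fun z => cexp ((1 : ℝ) * z ^ 2) * (b z * (mpoly (1 / 4) j).eval z))
        - lineInt c (fun z => cexp ((2 : ℝ) * z ^ 2) * ((mpoly (1 / 4) j).eval z * Φ z)) := by
    intro b Φ hb hΦ j
    simp only [mul_comm ((mpoly (1 / 4) j).eval _) (Φ _)]
    rw [← lineInt_sub (hi one_pos hb j) (hi two_pos hΦ j)]
    congr 1
    ext z
    ring
  have e1 := hsplit hb₁g hg₁
  have e2 := hsplit hb₂g hg₂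
  unfold dTac
  rw [hd1, hd2, hd3, hd4, T1, T2, T3, T4]
  simp only [hb₁, hb₂] at e1 e2 ⊢
  simp only [e1, e2]
  -- The four sums coming from the four double integrals are the expansion of a single product (X₁ -
  -- Y₁)(X₂ - Y₂); X collects the line factors and Y the residues at 0.
  have hfin : ∀ j ∈ Finset.range r, ∀ X₁ X₂ Y₁ Y₂ : ℂ,
      (mnorm j)⁻¹ * (X₁ - Y₁) * (X₂ - Y₂)
        = -(X₂ / mnorm j * Y₁) - X₁ / mnorm j * Y₂ + X₁ / mnorm j * X₂ + Y₁ / mnorm j * Y₂ := by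
    intros
    ring
  rw [Finset.sum_congr rfl fun j hj => hfin j hj _ _ _ _]
  simp only [Finset.sum_add_distrib, Finset.sum_sub_distrib, Finset.sum_neg_distrib]
  ring

/-! ### Hermite polynomials as residues at 0 -/

theorem hermiteP_eq (j : ℕ) (x : ℝ) : (hermiteP j x : ℂ) = (mpoly (-1) j).eval (x : ℂ) := by
  have h : ∀ j, (hermite j).map (algebraMap ℤ ℂ) = mpoly (-1) j := by
    intro j
    induction j with
    | zero => simp [mpoly, hermite_zero]
    | succ n ih =>
      rw [hermite_succ, Polynomial.map_sub, Polynomial.map_mul, map_X, ← derivative_map, ih, mpoly]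
      simp [sub_eq_add_neg]
  rw [← h, eval_map_algebraMap, hermiteP]
  have := (Polynomial.aeval_algebraMap_apply ℂ x (hermite j)).symm
  simpa using this

theorem hermiteP_succ_succ (j : ℕ) (x : ℝ) :
    hermiteP (j + 2) x = x * hermiteP (j + 1) x - (j + 1) * hermiteP j x := by
  have : (hermiteP (j + 2) x : ℂ) = ((x * hermiteP (j + 1) x - (j + 1) * hermiteP j x : ℝ) : ℂ) := by
    push_cast
    rw [hermiteP_eq, hermiteP_eq, hermiteP_eq, eval_mpoly_succ_succ]
    ring
  exact_mod_cast this

section coefficients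

variable {δ : ℝ}

theorem circInt_eq_zero (hδ : 0 < δ) {f : ℂ → ℂ}
    (hf : DifferentiableOn ℂ f (Metric.closedBall 0 δ)) : circInt δ f = 0 := by
  unfold circInt
  rw [Complex.circleIntegral_eq_zero_of_differentiable_on_off_countable hδ.le
    Set.countable_empty hf.continuousOn, mul_zero]
  intro z hz
  exact (hf z (Metric.ball_subset_closedBall hz.1)).differentiableAt
    (Metric.closedBall_mem_nhds_of_mem hz.1)

/-- The entire function `e^{-w²/2-ξw}`, whose Taylor coefficients are Hermite polynomials. -/
noncomputable def hermGen (ξ : ℝ) (w : ℂ) : ℂ := cexp (-w ^ 2 / 2 - ξ * w)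

theorem differentiable_hermGen (ξ : ℝ) : Differentiable ℂ (hermGen ξ) := by
  unfold hermGen
  fun_prop

theorem ne_zero_of_mem_sphere (hδ : 0 < δ) {w : ℂ} (hw : w ∈ Metric.sphere (0 : ℂ) δ) : w ≠ 0 := by
  rintro rfl
  rw [mem_sphere_zero_iff_norm, norm_zero] at hw
  exact hδ.ne hw

theorem continuousOn_zpow_sphere (hδ : 0 < δ) (m : ℤ) :
    ContinuousOn (fun w : ℂ => w ^ m) (Metric.sphere 0 δ) := fun w hw =>
  (continuousAt_zpow₀ w m (Or.inl (ne_zero_of_mem_sphere hδ hw))).continuousWithinAt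

theorem circleIntegrable_zpow_hermGen (hδ : 0 < δ) (ξ : ℝ) (m : ℤ) :
    CircleIntegrable (fun w => w ^ m * hermGen ξ w) 0 δ :=
  ((continuousOn_zpow_sphere hδ m).mul
    (differentiable_hermGen ξ).continuous.continuousOn).circleIntegrable hδ.le

/-- The derivative of w^{-m} e^{-w²/2-ξw} has zero integral around the circle. -/
theorem circInt_hermGen_recurrence (hδ : 0 < δ) (ξ : ℝ) (m : ℤ) :
    m * circInt δ (fun w => w ^ (-m - 1) * hermGen ξ w)
      = -circInt δ (fun w => w ^ (-m + 1) * hermGen ξ w)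
        - ξ * circInt δ (fun w => w ^ (-m) * hermGen ξ w) := by
  have hi := circleIntegrable_zpow_hermGen hδ ξ
  have h0 : circInt δ (fun w => (-m) * (w ^ (-m - 1) * hermGen ξ w)
      - (w ^ (-m + 1) * hermGen ξ w + ξ * (w ^ (-m) * hermGen ξ w))) = 0 := by
    unfold circInt
    rw [circleIntegral.integral_eq_zero_of_hasDerivWithinAt (f := fun w => w ^ (-m) * hermGen ξ w)
      hδ.le, mul_zero]
    intro w hw
    have hw0 := ne_zero_of_mem_sphere hδ hw
    refine HasDerivAt.hasDerivWithinAt ?_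
    have h1 : HasDerivAt (hermGen ξ) (hermGen ξ w * (-w - ξ)) w := by
      unfold hermGen
      have h2 : HasDerivAt (fun w : ℂ => -w ^ 2 / 2 - ξ * w) (-w - ξ) w := by
        refine ((((hasDerivAt_pow 2 w).neg).div_const 2).sub
          ((hasDerivAt_id w).const_mul (ξ : ℂ))).congr_deriv ?_
        simp
        ring
      exact h2.cexp
    refine ((hasDerivAt_zpow (-m) w (Or.inl hw0)).mul h1).congr_deriv ?_
    rw [zpow_add_one₀ hw0]
    push_cast
    ring
  have hi' : CircleIntegrable
      (fun w => w ^ (-m + 1) * hermGen ξ w + ξ * (w ^ (-m) * hermGen ξ w)) 0 δ :=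
    (hi _).add ((hi _).const_mul _)
  rw [circInt_sub ((hi _).const_mul _) hi', circInt_add (hi _) ((hi _).const_mul _), circInt_const_mul, circInt_const_mul] at h0
  linear_combination -h0

/-- The preceding identity is the three-term recurrence of Hᵖ_m(-ξ)/m!; Cauchy's formula and
holomorphy at 0 supply its initial values. -/
theorem circInt_hermGen_coeff (hδ : 0 < δ) (ξ : ℝ) (m : ℕ) :
    circInt δ (fun w => w ^ (-(m : ℤ) - 1) * hermGen ξ w) = ((hermiteP m (-ξ) / m ! : ℝ) : ℂ) := by
  have h0 : circInt δ (fun w => w ^ (-1 : ℤ) * hermGen ξ w) = 1 := by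
    have := Complex.circleIntegral_sub_center_inv_smul_of_differentiable_on_off_countable (c := 0)
      hδ Set.countable_empty (differentiable_hermGen ξ).continuous.continuousOn
      (fun z _ => (differentiable_hermGen ξ) z)
    simp only [sub_zero, smul_eq_mul, hermGen] at this
    unfold circInt
    simp only [zpow_neg_one, hermGen]
    rw [this, show -(0 : ℂ) ^ 2 / 2 - ξ * 0 = 0 by ring, Complex.exp_zero, mul_one,
      inv_mul_cancel₀ two_pi_I_ne_zero]
  induction m using Nat.twoStepInduction with
  | zero => simpa [hermiteP, hermite_zero] using h0
  | one =>
    have h1 := circInt_hermGen_recurrence hδ ξ 1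
    have h2 : circInt δ (fun w => w ^ (-1 + 1 : ℤ) * hermGen ξ w) = 0 := by
      refine circInt_eq_zero hδ ?_
      simpa using (differentiable_hermGen ξ).differentiableOn
    rw [h2, h0] at h1
    simpa [hermiteP] using h1
  | more m ih0 ih1 =>
    have h1 := circInt_hermGen_recurrence hδ ξ (m + 2 : ℕ)
    have e1 : (-((m + 2 : ℕ) : ℤ) + 1) = -(m : ℤ) - 1 := by push_cast; ring
    have e2 : (-((m + 2 : ℕ) : ℤ)) = -((m + 1 : ℕ) : ℤ) - 1 := by push_cast; ring
    rw [e1, ih0] at h1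
    conv_rhs at h1 => rw [e2, ih1]
    have hm : ((m : ℂ) + 2) ≠ 0 := by exact_mod_cast (m + 1).succ_ne_zero
    have hm1 : ((m : ℂ) + 1) ≠ 0 := by exact_mod_cast m.succ_ne_zero
    have hf : (m ! : ℂ) ≠ 0 := by exact_mod_cast m.factorial_ne_zero
    apply mul_left_cancel₀ hm
    rw [hermiteP_succ_succ, Nat.factorial_succ (m + 1), Nat.factorial_succ m]
    rw [Nat.factorial_succ m] at h1
    push_cast at h1 ⊢
    rw [h1]
    have hm' : (m : ℂ) + 1 + 1 ≠ 0 := by exact_mod_cast (m + 1).succ_ne_zero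
    field_simp
    ring

/-- The Cauchy transform over `Γ₀` of `w^τ e^{-w²/2-ξw}`, outside the circle. -/
theorem circInt_hermGen_cauchy (hδ : 0 < δ) (ξ : ℝ) (τ : ℤ) {z : ℂ} (hz : δ < ‖z‖) :
    circInt δ (fun w => w ^ τ * hermGen ξ w * (z - w)⁻¹) = z ^ τ * truncF ξ (-τ) z := by
  have hne : ∀ w ∈ Metric.closedBall (0 : ℂ) δ, z - w ≠ 0 := by
    intro w hw h
    rw [← sub_eq_zero.1 h, mem_closedBall_zero_iff] at hw
    exact absurd hw (not_le.2 hz)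
  have hz0 : z ≠ 0 := norm_pos_iff.1 (hδ.trans hz)
  have hnn : ∀ n : ℕ, circInt δ (fun w => w ^ n * hermGen ξ w * (z - w)⁻¹) = 0 := by
    intro n
    refine circInt_eq_zero hδ ?_
    refine DifferentiableOn.mul ?_ (DifferentiableOn.inv (by fun_prop) hne)
    exact ((differentiable_pow n).mul (differentiable_hermGen ξ)).differentiableOn
  -- Since w⁻¹(z-w)⁻¹ = z⁻¹(w⁻¹ + (z-w)⁻¹), lowering the power of w by one adds exactly one Taylor
  -- coefficient. For nonnegative powers the integrand is holomorphic in the disc.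
  have hneg : ∀ m : ℕ, circInt δ (fun w => w ^ (-(m : ℤ)) * hermGen ξ w * (z - w)⁻¹)
      = z ^ (-(m : ℤ)) * ∑ j ∈ Finset.range m, ((hermiteP j (-ξ) / j ! : ℝ) : ℂ) * z ^ j := by
    intro m
    induction m with
    | zero => simpa using hnn 0
    | succ m ih =>
      have h1 : ∀ w ∈ Metric.sphere (0 : ℂ) δ,
          w ^ (-((m + 1 : ℕ) : ℤ)) * hermGen ξ w * (z - w)⁻¹
          = z⁻¹ * (w ^ (-(m : ℤ) - 1) * hermGen ξ w
            + w ^ (-(m : ℤ)) * hermGen ξ w * (z - w)⁻¹) := by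
        intro w hw
        have hw0 := ne_zero_of_mem_sphere hδ hw
        have hzw := hne w (Metric.sphere_subset_closedBall hw)
        have e1 : (-((m + 1 : ℕ) : ℤ)) = -(m : ℤ) - 1 := by push_cast; ring
        rw [e1, zpow_sub_one₀ hw0]
        field_simp
        ring
      have hi2 : CircleIntegrable (fun w => w ^ (-(m : ℤ)) * hermGen ξ w * (z - w)⁻¹) 0 δ :=
        (((continuousOn_zpow_sphere hδ _).mul
          (differentiable_hermGen ξ).continuous.continuousOn).mul
          (ContinuousOn.inv₀ (by fun_prop) fun w hw =>
            hne w (Metric.sphere_subset_closedBall hw))).circleIntegrable hδ.le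
      rw [circInt_congr hδ h1, circInt_const_mul,
        circInt_add (circleIntegrable_zpow_hermGen hδ ξ _) hi2, ih, circInt_hermGen_coeff hδ,
        Finset.sum_range_succ]
      have e1 : (-((m + 1 : ℕ) : ℤ)) = -(m : ℤ) - 1 := by push_cast; ring
      rw [e1, zpow_sub_one₀ hz0, zpow_neg, zpow_natCast]
      field_simp
      ring
  rcases le_or_gt 0 τ with h | h
  · lift τ to ℕ using h
    have : (-(τ : ℤ)).toNat = 0 := by simp
    simpa [truncF, this] using hnn τ
  · obtain ⟨m, hm⟩ := Int.eq_ofNat_of_zero_le (show 0 ≤ -τ by omega)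
    obtain rfl : τ = -(m : ℤ) := by omega
    rw [hneg, truncF, neg_neg, Int.toNat_natCast]

theorem circInt_scale {s : ℝ} (hs : 0 < s) (f : ℂ → ℂ) :
    circInt δ f = (s : ℂ)⁻¹ * circInt (s * δ) fun y => f (y / s) := by
  have hs' : (s : ℂ) ≠ 0 := by exact_mod_cast hs.ne'
  have h : ∀ θ : ℝ, circleMap 0 (s * δ) θ = s * circleMap 0 δ θ := by
    intro θ
    simp [circleMap]
    ring
  unfold circInt circleIntegral
  simp only [deriv_circleMap, smul_eq_mul, h, mul_div_cancel_left₀ _ hs', mul_assoc,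
    intervalIntegral.integral_const_mul]
  field_simp

theorem circInt_gaussian_cauchy (hδ : 0 < δ) (ξ : ℝ) (τ : ℤ) {z : ℂ} (hz : δ < ‖z‖) :
    circInt δ (fun v => v ^ τ * cexp (-v ^ 2 - (ξ * √2 : ℝ) * v) * (z - v)⁻¹)
      = z ^ τ * truncF ξ (-τ) ((√2 : ℝ) * z) := by
  have h2 : (0 : ℝ) < √2 := by positivity
  have h2' : ((√2 : ℝ) : ℂ) ≠ 0 := by exact_mod_cast h2.ne'
  have hsq : ((√2 : ℝ) : ℂ) ^ 2 = 2 := by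
    exact_mod_cast Real.sq_sqrt (show (0 : ℝ) ≤ 2 by norm_num)
  rw [circInt_scale h2]
  have hpt : ∀ y : ℂ, (y / (√2 : ℝ)) ^ τ * cexp (-(y / (√2 : ℝ)) ^ 2 - (ξ * √2 : ℝ) * (y / (√2 : ℝ)))
      * (z - y / (√2 : ℝ))⁻¹
      = ((√2 : ℝ) : ℂ) * ((√2 : ℝ) : ℂ) ^ (-τ)
        * (y ^ τ * hermGen ξ y * ((√2 : ℝ) * z - y)⁻¹) := by
    intro y
    have e1 : -(y / (√2 : ℝ)) ^ 2 - (ξ * √2 : ℝ) * (y / (√2 : ℝ)) = -y ^ 2 / 2 - ξ * y := by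
      rw [div_pow, hsq]
      push_cast
      field_simp
    have e2 : z - y / (√2 : ℝ) = ((√2 : ℝ) * z - y) / (√2 : ℝ) := by
      field_simp
    rw [e1, e2, inv_div, div_zpow, zpow_neg, hermGen]
    ring
  simp only [hpt]
  rw [circInt_const_mul, circInt_hermGen_cauchy (by positivity) ξ τ, mul_zpow, zpow_neg]
  · have : ((√2 : ℝ) : ℂ) ^ τ ≠ 0 := zpow_ne_zero _ h2'
    field_simp
  · rw [norm_mul, norm_real, Real.norm_of_nonneg h2.le]
    gcongr

end coefficients

/-! ### Rescaling by √2 -/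

theorem PolyGrowthOn.truncF {S : Set ℂ} (ξ : ℝ) (τ : ℤ) : PolyGrowthOn S (Tacnode.truncF ξ τ) :=
  .sum _ fun j _ => (PolyGrowthOn.id.pow j).const_mul _

theorem PolyGrowthOn.truncF_mul {S : Set ℂ} (ξ : ℝ) (τ : ℤ) (a : ℂ) :
    PolyGrowthOn S fun z => Tacnode.truncF ξ τ (a * z) :=
  .sum _ fun j _ => ((PolyGrowthOn.id.const_mul a).pow j).const_mul _

/-- The line integrals whose products make up `𝕃₂`. -/
noncomputable def lineF (c : ℝ) (τ : ℤ) (ξ : ℝ) (P : ℂ[X]) : ℂ :=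
  lineInt c fun v => v ^ τ * (cexp (-ξ * v) - cexp (v ^ 2 / 2) * truncF ξ (-τ) v)
    * (cexp (v ^ 2 / 2) * P.eval v)

theorem sqrt_two_pos : (0 : ℝ) < √2 := by positivity

theorem sqrt_two_ne_zero : ((√2 : ℝ) : ℂ) ≠ 0 := by exact_mod_cast sqrt_two_pos.ne'

theorem sqrt_two_sq : ((√2 : ℝ) : ℂ) ^ 2 = 2 := by
  exact_mod_cast Real.sq_sqrt (show (0 : ℝ) ≤ 2 by norm_num)

theorem heaviside_scale (m : ℤ) (z : ℝ) :
    heaviside m (z * √2) = √2 ^ (m - 1) * heaviside m z := by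
  have h2 := sqrt_two_pos
  unfold heaviside
  by_cases h : 1 ≤ m ∧ 0 ≤ z
  · have h' : 1 ≤ m ∧ 0 ≤ z * √2 := ⟨h.1, mul_nonneg h.2 h2.le⟩
    rw [if_pos h, if_pos h', mul_pow]
    obtain ⟨n, hn⟩ := Int.eq_ofNat_of_zero_le (show 0 ≤ m - 1 by omega)
    rw [hn, Int.toNat_natCast, zpow_natCast]
    ring
  · have h' : ¬ (1 ≤ m ∧ 0 ≤ z * √2) := fun h' => h ⟨h'.1, nonneg_of_mul_nonneg_left h'.2 h2⟩
    rw [if_neg h, if_neg h', mul_zero]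

theorem lineInt_sqrt_two {c : ℝ} {f g : ℂ → ℂ} {a : ℂ}
    (h : ∀ y ∈ vstrip (√2 * c) (√2 * c), f (y / (√2 : ℝ)) = a * g y) :
    lineInt c f = ((√2 : ℝ) : ℂ)⁻¹ * a * lineInt (√2 * c) g := by
  rw [lineInt_scale sqrt_two_pos, lineInt_congr h, lineInt_const_mul, mul_assoc]

theorem cexp_sq_div_sqrt_two (κ : ℝ) (y : ℂ) :
    cexp (κ * (y / (√2 : ℝ)) ^ 2) = cexp (κ * y ^ 2 / 2) := by
  rw [div_pow, sqrt_two_sq, mul_div_assoc]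

theorem cexp_mul_div_sqrt_two (ξ : ℝ) (y : ℂ) :
    cexp ((ξ * √2 : ℝ) * (y / (√2 : ℝ))) = cexp (ξ * y) := by
  congr 1
  have := sqrt_two_ne_zero
  push_cast
  field_simp

theorem eval_mpoly_div_sqrt_two (j : ℕ) (y : ℂ) :
    (mpoly (1 / 4) j).eval (y / (√2 : ℝ))
      = (((√2 : ℝ) : ℂ) ^ j)⁻¹ * (mpoly (1 / 2) j).eval y := by
  rw [div_eq_inv_mul, eval_mpoly_scale (b := 1 / 2), inv_pow]
  rw [inv_pow, sqrt_two_sq]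
  norm_num

theorem ne_zero_of_mem_vstrip {c : ℝ} (hc : 0 < c) {z : ℂ} (hz : z ∈ vstrip c c) : z ≠ 0 := by
  rintro rfl
  exact absurd hz.1 (not_le.2 (by simpa using hc))

/-- Substituting z = y/√2 turns the weights e^{z²}, e^{2z²} into e^{y²/2}, e^{y²} and the parameter
1/4 of the polynomials into 1/2. The line moves to Re y = √2 c, and the prefactor absorbs the powers
of √2 that depend on τ₁, τ₂. -/
theorem dTac_scaled {δ c : ℝ} (hδ : 0 < δ) (hc : δ < c) (r : ℕ) (τ₁ τ₂ : ℤ) (ξ₁ ξ₂ : ℝ) :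
    ((√2 : ℝ) : ℂ) ^ (τ₂ - τ₁) * dTac δ c r 0 0 τ₁ (ξ₁ * √2) τ₂ (ξ₂ * √2) * ((√2 : ℝ) : ℂ)
      = partL0 τ₁ ξ₁ τ₂ ξ₂ + (partL11 (√2 * c) τ₁ ξ₁ τ₂ ξ₂ + partL12 (√2 * c) τ₁ ξ₁ τ₂ ξ₂
        + partL13 (√2 * c) τ₁ ξ₁ τ₂ ξ₂)
        + ∑ j ∈ Finset.range r, (-2) ^ j * (2 * (√π : ℝ)) / j !
          * lineF (√2 * c) (-τ₁) ξ₁ (mpoly (1 / 2) j)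
          * lineF (√2 * c) τ₂ (-ξ₂) (mpoly (1 / 2) j) := by
  have hc0 : 0 < c := hδ.trans hc
  have hc2 : 0 < √2 * c := mul_pos sqrt_two_pos hc0
  set s : ℂ := ((√2 : ℝ) : ℂ) with hs
  have hs0 : s ≠ 0 := sqrt_two_ne_zero
  have hs2 : s ^ 2 = 2 := sqrt_two_sq
  have hlt : ∀ w ∈ vstrip c c, δ < ‖w‖ := fun w hw =>
    hc.trans_le ((hw.1.trans (le_abs_self _)).trans (abs_re_le_norm w))
  have hΦ₁ : ∀ w ∈ vstrip c c,
      circInt δ (fun v => v ^ (-τ₁) * cexp (-v ^ 2 - (ξ₁ * √2 : ℝ) * v) * (w - v)⁻¹)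
        = w ^ (-τ₁) * truncF ξ₁ τ₁ (s * w) := fun w hw => by
    rw [circInt_gaussian_cauchy hδ ξ₁ (-τ₁) (hlt w hw), neg_neg]
  have hΦ₂ : ∀ w ∈ vstrip c c,
      circInt δ (fun v => v ^ τ₂ * cexp (-v ^ 2 + (ξ₂ * √2 : ℝ) * v) * (w - v)⁻¹)
        = w ^ τ₂ * truncF (-ξ₂) (-τ₂) (s * w) := fun w hw => by
    rw [← circInt_gaussian_cauchy hδ (-ξ₂) τ₂ (hlt w hw)]
    simp only [neg_mul, ofReal_neg, sub_neg_eq_add]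
  rw [dTac_eq hδ hc r τ₁ τ₂ _ _ hΦ₁ hΦ₂ ((PolyGrowthOn.zpow hc0 _).mul (.truncF_mul _ _ _))
    ((PolyGrowthOn.zpow hc0 _).mul (.truncF_mul _ _ _))]
  have hH : s ^ (τ₂ - τ₁) * (heaviside (τ₁ - τ₂) (ξ₂ * √2 - ξ₁ * √2) : ℂ) * s
      = (heaviside (τ₁ - τ₂) (ξ₂ - ξ₁) : ℂ) := by
    rw [← sub_mul, heaviside_scale]
    push_cast
    rw [← hs, zpow_sub_one₀ hs0, show τ₂ - τ₁ = -(τ₁ - τ₂) by ring, zpow_neg]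
    have := zpow_ne_zero (τ₁ - τ₂) hs0
    field_simp
  have hz : ∀ (y : ℂ) (m : ℤ), (y / s) ^ m = s ^ (-m) * y ^ m := fun y m => by
    rw [div_zpow, zpow_neg, div_eq_inv_mul]
  have hcan : ∀ y : ℂ, s * (y / s) = y := fun y => mul_div_cancel₀ _ hs0
  have hE1 : ∀ y : ℂ, cexp ((1 : ℝ) * (y / s) ^ 2) = cexp (y ^ 2 / 2) := fun y => by
    rw [hs, cexp_sq_div_sqrt_two]
    simp
  have hE2 : ∀ y : ℂ, cexp ((2 : ℝ) * (y / s) ^ 2) = cexp (y ^ 2 / 2) * cexp (y ^ 2 / 2) :=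
    fun y => by
      rw [hs, cexp_sq_div_sqrt_two, ← Complex.exp_add]
      congr 1
      push_cast
      ring
  have hEx : ∀ (ξ : ℝ) (y : ℂ), cexp ((ξ * √2 : ℝ) * (y / s)) = cexp (ξ * y) :=
    cexp_mul_div_sqrt_two
  have hEn : ∀ (ξ : ℝ) (y : ℂ), cexp ((-(ξ * √2) : ℝ) * (y / s)) = cexp (-ξ * y) := fun ξ y => by
    rw [← neg_mul, hEx, ofReal_neg]
  have h11 := lineInt_sqrt_two (c := c) (a := s ^ (τ₁ - τ₂))
    (f := fun z => cexp ((1 : ℝ) * z ^ 2) * (z ^ τ₂ * cexp ((ξ₂ * √2 : ℝ) * z)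
      * (z ^ (-τ₁) * truncF ξ₁ τ₁ (s * z))))
    (g := fun v => cexp (v ^ 2 / 2) / v ^ (τ₁ - τ₂) * (cexp (ξ₂ * v) * truncF ξ₁ τ₁ v))
    (fun y hy => by
      have hy0 := ne_zero_of_mem_vstrip hc2 hy
      simp only [← hs, hE1, hEx, hz, hcan]
      rw [zpow_sub₀ hs0, zpow_sub₀ hy0, neg_neg, zpow_neg, zpow_neg]
      have := zpow_ne_zero τ₁ hy0
      have := zpow_ne_zero τ₂ hy0
      have := zpow_ne_zero τ₂ hs0
      field_simp)
  have h12 := lineInt_sqrt_two (c := c) (a := s ^ (τ₁ - τ₂))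
    (f := fun z => cexp ((1 : ℝ) * z ^ 2) * (z ^ (-τ₁) * cexp ((-(ξ₁ * √2) : ℝ) * z)
      * (z ^ τ₂ * truncF (-ξ₂) (-τ₂) (s * z))))
    (g := fun v => cexp (v ^ 2 / 2) / v ^ (τ₁ - τ₂) * (cexp (-ξ₁ * v) * truncF (-ξ₂) (-τ₂) v))
    (fun y hy => by
      have hy0 := ne_zero_of_mem_vstrip hc2 hy
      simp only [← hs, hE1, hEn, hz, hcan]
      rw [zpow_sub₀ hs0, zpow_sub₀ hy0, neg_neg, zpow_neg, zpow_neg]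
      have := zpow_ne_zero τ₁ hy0
      have := zpow_ne_zero τ₂ hy0
      have := zpow_ne_zero τ₂ hs0
      field_simp)
  have h13 := lineInt_sqrt_two (c := c) (a := -s ^ (τ₁ - τ₂))
    (f := fun z => cexp ((2 : ℝ) * z ^ 2) * (z ^ (-τ₁) * truncF ξ₁ τ₁ (s * z)
      * (z ^ τ₂ * truncF (-ξ₂) (-τ₂) (s * z))))
    (g := fun v => cexp (v ^ 2 / 2) / v ^ (τ₁ - τ₂)
      * (-(cexp (v ^ 2 / 2) * truncF ξ₁ τ₁ v * truncF (-ξ₂) (-τ₂) v)))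
    (fun y hy => by
      have hy0 := ne_zero_of_mem_vstrip hc2 hy
      simp only [← hs, hE2, hz, hcan]
      rw [zpow_sub₀ hs0, zpow_sub₀ hy0, neg_neg, zpow_neg, zpow_neg]
      have := zpow_ne_zero τ₁ hy0
      have := zpow_ne_zero τ₂ hy0
      have := zpow_ne_zero τ₂ hs0
      field_simp)
  have hF1 : ∀ j, lineInt c (fun z => (cexp ((1 : ℝ) * z ^ 2)
        * (z ^ (-τ₁) * cexp ((-(ξ₁ * √2) : ℝ) * z))
        - cexp ((2 : ℝ) * z ^ 2) * (z ^ (-τ₁) * truncF ξ₁ τ₁ (s * z))) * (mpoly (1 / 4) j).eval z)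
      = s⁻¹ * (s ^ τ₁ * (s ^ j)⁻¹) * lineF (√2 * c) (-τ₁) ξ₁ (mpoly (1 / 2) j) := by
    intro j
    refine lineInt_sqrt_two fun y hy => ?_
    simp only [← hs, hE1, hE2, hEn, hz, hcan, neg_neg]
    rw [hs, eval_mpoly_div_sqrt_two]
    ring
  have hF2 : ∀ j, lineInt c (fun z => (cexp ((1 : ℝ) * z ^ 2)
        * (z ^ τ₂ * cexp ((ξ₂ * √2 : ℝ) * z))
        - cexp ((2 : ℝ) * z ^ 2) * (z ^ τ₂ * truncF (-ξ₂) (-τ₂) (s * z)))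
          * (mpoly (1 / 4) j).eval z)
      = s⁻¹ * (s ^ (-τ₂) * (s ^ j)⁻¹) * lineF (√2 * c) τ₂ (-ξ₂) (mpoly (1 / 2) j) := by
    intro j
    refine lineInt_sqrt_two fun y hy => ?_
    simp only [← hs, hE1, hE2, hEx, hz, hcan, ofReal_neg, neg_neg]
    rw [hs, eval_mpoly_div_sqrt_two]
    ring
  have hpow : s ^ (τ₂ - τ₁) * s ^ (τ₁ - τ₂) = 1 := by
    rw [← zpow_add₀ hs0]
    simp
  -- Here 1/h_j = (-4)^j 2√(2π)/j!; the two rescaled polynomials contribute 2^{-j}, and one factor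
  -- √2 is left to cancel.
  have hcoef : ∀ j, s ^ (τ₂ - τ₁) * ((mnorm j)⁻¹ * (s⁻¹ * (s ^ τ₁ * (s ^ j)⁻¹))
      * (s⁻¹ * (s ^ (-τ₂) * (s ^ j)⁻¹))) * s = (-2) ^ j * (2 * (√π : ℝ)) / j ! := by
    intro j
    have h1 : s ^ (τ₂ - τ₁) * s ^ τ₁ * s ^ (-τ₂) = 1 := by
      rw [← zpow_add₀ hs0, ← zpow_add₀ hs0]
      simp
    have h2 : s ^ j * s ^ j = 2 ^ j := by rw [← mul_pow, ← pow_two, hs2]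
    have h3 : ((√(2 * π) : ℝ) : ℂ) = s * (√π : ℝ) := by
      rw [hs, Real.sqrt_mul (by norm_num)]
      push_cast
      rfl
    have hsj : s ^ j ≠ 0 := pow_ne_zero _ hs0
    have h4 : (mnorm j)⁻¹ = (-4) ^ j * (2 * (s * (√π : ℝ))) / j ! := by
      have h5 : (-(1 / 4) : ℂ) = (-4)⁻¹ := by norm_num
      rw [mnorm, h3, h5, mul_inv, mul_inv, inv_inv, inv_pow, inv_inv]
      ring
    calc _ = (mnorm j)⁻¹ * s⁻¹ * (s ^ j * s ^ j)⁻¹ * (s ^ (τ₂ - τ₁) * s ^ τ₁ * s ^ (-τ₂)) := by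
          field_simp
      _ = _ := by
          rw [h1, h2, h4, show (-4 : ℂ) = -2 * 2 by norm_num, mul_pow]
          field_simp
  rw [h11, h12, h13]
  simp only [hF1, hF2, ← hs]
  have hsum : s ^ (τ₂ - τ₁) * (∑ j ∈ Finset.range r, (mnorm j)⁻¹
      * (s⁻¹ * (s ^ τ₁ * (s ^ j)⁻¹) * lineF (√2 * c) (-τ₁) ξ₁ (mpoly (1 / 2) j))
      * (s⁻¹ * (s ^ (-τ₂) * (s ^ j)⁻¹) * lineF (√2 * c) τ₂ (-ξ₂) (mpoly (1 / 2) j))) * s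
      = ∑ j ∈ Finset.range r, (-2) ^ j * (2 * (√π : ℝ)) / j !
          * lineF (√2 * c) (-τ₁) ξ₁ (mpoly (1 / 2) j)
          * lineF (√2 * c) τ₂ (-ξ₂) (mpoly (1 / 2) j) := by
    rw [Finset.mul_sum, Finset.sum_mul]
    refine Finset.sum_congr rfl fun j _ => ?_
    rw [← hcoef j]
    ring
  rw [← hsum, partL0, partL11, partL12, partL13]
  rw [← hH]
  generalize lineInt (√2 * c) (fun v => cexp (v ^ 2 / 2) / v ^ (τ₁ - τ₂)
    * (cexp (ξ₂ * v) * truncF ξ₁ τ₁ v)) = X₁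
  generalize lineInt (√2 * c) (fun v => cexp (v ^ 2 / 2) / v ^ (τ₁ - τ₂)
    * (cexp (-ξ₁ * v) * truncF (-ξ₂) (-τ₂) v)) = X₂
  generalize lineInt (√2 * c) (fun v => cexp (v ^ 2 / 2) / v ^ (τ₁ - τ₂)
      * (-(cexp (v ^ 2 / 2) * truncF ξ₁ τ₁ v * truncF (-ξ₂) (-τ₂) v))) = X₃
  have h1 : s⁻¹ * s = 1 := inv_mul_cancel₀ hs0
  linear_combination (X₁ + X₂ + X₃) * (s⁻¹ * s * hpow + h1)

/-! ### Polynomials times Gaussians and their Laplace transforms -/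

theorem cexp_half_sq (v : ℂ) : cexp (v ^ 2 / 2) = cexp ((1 / 2 : ℝ) * v ^ 2) := by
  congr 1
  push_cast
  ring

theorem PolyGrowthOn.lineIntegrable_half {c : ℝ} {g : ℂ → ℂ} (hg : PolyGrowthOn (vstrip c c) g) :
    LineIntegrable c fun v => cexp (v ^ 2 / 2) * g v := by
  simp only [cexp_half_sq]
  exact hg.lineIntegrable (by norm_num)

/-- The inverse Laplace transform of `e^{v²/2} P(v)`, a polynomial times a Gaussian. -/
noncomputable def gaussT (c : ℝ) (P : ℂ[X]) (u : ℝ) : ℂ :=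
  lineInt c fun v => cexp (-u * v) * (cexp (v ^ 2 / 2) * P.eval v)

section gaussT

variable {c : ℝ}

theorem lineIntegrable_gaussT (P : ℂ[X]) (u : ℝ) :
    LineIntegrable c fun v => cexp (-u * v) * (cexp (v ^ 2 / 2) * P.eval v) := by
  have h : PolyGrowthOn (vstrip c c) fun v => cexp ((-u : ℝ) * v) * P.eval v :=
    (PolyGrowthOn.cexp_mul _).mul (.polynomial _)
  refine h.lineIntegrable_half.congr fun v _ => ?_
  push_cast
  ring

theorem gaussT_add (P Q : ℂ[X]) (u : ℝ) :
    gaussT c (P + Q) u = gaussT c P u + gaussT c Q u := by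
  unfold gaussT
  rw [← lineInt_add (lineIntegrable_gaussT P u) (lineIntegrable_gaussT Q u)]
  simp only [eval_add, mul_add]

theorem gaussT_C_mul (a : ℂ) (P : ℂ[X]) (u : ℝ) :
    gaussT c (C a * P) u = a * gaussT c P u := by
  unfold gaussT
  rw [← lineInt_const_mul]
  congr 1
  ext v
  rw [eval_mul, eval_C]
  ring

theorem gaussT_sum {ι : Type*} (s : Finset ι) (a : ι → ℂ) (P : ι → ℂ[X]) (u : ℝ) :
    gaussT c (∑ i ∈ s, C (a i) * P i) u = ∑ i ∈ s, a i * gaussT c (P i) u := by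
  classical
  induction s using Finset.induction_on with
  | empty => simp [gaussT, lineInt]
  | insert i s hi ih =>
    rw [Finset.sum_insert hi, Finset.sum_insert hi, gaussT_add, gaussT_C_mul, ih]

/-- Integration by parts in v. Together with the case P = 1 it determines the transform of every
polynomial. -/
theorem gaussT_X_mul (P : ℂ[X]) (u : ℝ) :
    gaussT c (X * P) u = u * gaussT c P u - gaussT c (derivative P) u := by
  have h0 : gaussT c (X * P + (C (-(u : ℂ)) * P + derivative P)) u = 0 := by
    refine lineInt_deriv_eq_zero (f := fun v => cexp (-u * v) * (cexp (v ^ 2 / 2) * P.eval v))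
      (fun v _ => ?_) (lineIntegrable_gaussT P u) (lineIntegrable_gaussT _ u)
    have h1 : HasDerivAt (fun v : ℂ => cexp (-u * v)) (cexp (-u * v) * -u) v := by
      simpa using ((hasDerivAt_id v).const_mul (-u : ℂ)).cexp
    have h2 : HasDerivAt (fun v : ℂ => cexp (v ^ 2 / 2)) (cexp (v ^ 2 / 2) * v) v := by
      simpa using ((hasDerivAt_pow 2 v).div_const 2).cexp
    refine (h1.mul (h2.mul (P.hasDerivAt v))).congr_deriv ?_
    simp only [Pi.mul_apply, eval_add, eval_mul, eval_X, eval_C]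
    ring
  rw [gaussT_add, gaussT_add, gaussT_C_mul] at h0
  linear_combination h0

theorem gaussT_one (u : ℝ) :
    gaussT c 1 u = cexp (-(u : ℂ) ^ 2 / 2) / (√(2 * π) : ℝ) := by
  have h := lineInt_gaussian c (κ := 1 / 2) (by norm_num) (u : ℂ)
  have h1 : gaussT c 1 u = lineInt c fun z => cexp ((1 / 2 : ℝ) * z ^ 2 - u * z) := by
    unfold gaussT
    congr 1
    ext v
    rw [eval_one, mul_one, ← Complex.exp_add]
    congr 1
    push_cast
    ring
  have h2 : (π / (1 / 2 : ℝ) : ℂ) ^ (1 / 2 : ℂ) = (√(2 * π) : ℝ) := by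
    rw [Real.sqrt_eq_rpow, ofReal_cpow (by positivity)]
    congr 1 <;> push_cast <;> ring
  have h3 : ((√(2 * π) : ℝ) : ℂ) ^ 2 = 2 * π := by
    exact_mod_cast Real.sq_sqrt (show 0 ≤ 2 * π by positivity)
  have h5 : ((√(2 * π) : ℝ) : ℂ) ≠ 0 := by
    exact_mod_cast (Real.sqrt_pos.2 (by positivity)).ne'
  rw [h1, h, h2, ← h3]
  have h4 : -(u : ℂ) ^ 2 / (4 * (1 / 2 : ℝ)) = -(u : ℂ) ^ 2 / 2 := by
    push_cast
    norm_num
  rw [h4]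
  field_simp

theorem gaussT_C (a : ℂ) (u : ℝ) : gaussT c (C a) u = a * gaussT c 1 u := by
  rw [← gaussT_C_mul, mul_one]

theorem gaussT_X_pow_succ_succ (n : ℕ) (u : ℝ) :
    gaussT c (X ^ (n + 2)) u
      = u * gaussT c (X ^ (n + 1)) u - (n + 1) * gaussT c (X ^ n) u := by
  rw [pow_succ' X (n + 1), gaussT_X_mul, derivative_X_pow, gaussT_C_mul]
  simp

theorem gaussT_X (u : ℝ) : gaussT c (X ^ 1) u = u * gaussT c 1 u := by
  rw [pow_one, ← mul_one X, gaussT_X_mul, derivative_one]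
  simp [gaussT, lineInt]

/-- Formally this is differentiation under the integral. It is instead read off from the explicit P
= 1 and the recurrence for monomials, which needs no domination. -/
theorem hasDerivAt_gaussT (P : ℂ[X]) (u : ℝ) :
    HasDerivAt (gaussT c P) (-gaussT c (X * P) u) u := by
  have hid : HasDerivAt (fun u : ℝ => (u : ℂ)) 1 u := (hasDerivAt_id u).ofReal_comp
  have h0 : HasDerivAt (gaussT c 1) (-(u * gaussT c 1 u)) u := by
    have h1 : HasDerivAt (fun u : ℝ => -(u : ℂ) ^ 2 / (2 : ℂ)) (-(u : ℂ)) u := by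
      refine ((hid.pow 2).neg.div_const 2).congr_deriv ?_
      simp
      ring
    refine ((h1.cexp.div_const ((√(2 * π) : ℝ) : ℂ)).congr_of_eventuallyEq
      (Eventually.of_forall fun u => gaussT_one u)).congr_deriv ?_
    rw [gaussT_one]
    ring
  have hmon : ∀ n : ℕ, HasDerivAt (gaussT c (X ^ n)) (-gaussT c (X ^ (n + 1)) u) u := by
    intro n
    induction n using Nat.twoStepInduction with
    | zero => rwa [pow_zero, zero_add, gaussT_X]
    | one =>
      refine ((hid.mul h0).congr_of_eventuallyEq
        (Eventually.of_forall fun u => gaussT_X u)).congr_deriv ?_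
      rw [gaussT_X_pow_succ_succ, gaussT_X]
      simp
      ring
    | more n ih0 ih1 =>
      refine (((hid.mul ih1).sub (ih0.const_mul ((n : ℂ) + 1))).congr_of_eventuallyEq
        (Eventually.of_forall fun u => gaussT_X_pow_succ_succ n u)).congr_deriv ?_
      rw [gaussT_X_pow_succ_succ (n + 1)]
      push_cast
      ring
  induction P using Polynomial.induction_on' with
  | add P Q hP hQ =>
    rw [mul_add, gaussT_add, neg_add]
    exact (hP.add hQ).congr_of_eventuallyEq (Eventually.of_forall fun u => gaussT_add P Q u)
  | monomial n a =>
    rw [← C_mul_X_pow_eq_monomial, mul_left_comm, ← pow_succ', gaussT_C_mul, ← mul_neg]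
    exact ((hmon n).const_mul a).congr_of_eventuallyEq
      (Eventually.of_forall fun u => gaussT_C_mul a _ u)

/-- Provides the decay in u that makes the Laplace transform converge for every complex v. -/
theorem exists_gaussT_eq (P : ℂ[X]) :
    ∃ p : ℂ[X], ∀ u : ℝ, gaussT c P u = cexp (-(u : ℂ) ^ 2 / 2) * p.eval (u : ℂ) := by
  have h0 : ∃ p : ℂ[X], ∀ u : ℝ, gaussT c 1 u = cexp (-(u : ℂ) ^ 2 / 2) * p.eval (u : ℂ) :=
    ⟨C ((√(2 * π) : ℝ) : ℂ)⁻¹, fun u => by rw [gaussT_one, eval_C, div_eq_mul_inv]⟩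
  have hmon : ∀ n : ℕ, ∃ p : ℂ[X], ∀ u : ℝ,
      gaussT c (X ^ n) u = cexp (-(u : ℂ) ^ 2 / 2) * p.eval (u : ℂ) := by
    intro n
    induction n using Nat.twoStepInduction with
    | zero => simpa using h0
    | one =>
      obtain ⟨p, hp⟩ := h0
      refine ⟨X * p, fun u => ?_⟩
      rw [gaussT_X, hp, eval_mul, eval_X]
      ring
    | more n ih0 ih1 =>
      obtain ⟨p, hp⟩ := ih0
      obtain ⟨q, hq⟩ := ih1
      refine ⟨X * q - C ((n : ℂ) + 1) * p, fun u => ?_⟩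
      rw [gaussT_X_pow_succ_succ, hp, hq, eval_sub, eval_mul, eval_mul, eval_X, eval_C]
      ring
  induction P using Polynomial.induction_on' with
  | add P Q hP hQ =>
    obtain ⟨p, hp⟩ := hP
    obtain ⟨q, hq⟩ := hQ
    exact ⟨p + q, fun u => by rw [gaussT_add, hp, hq, eval_add, mul_add]⟩
  | monomial n a =>
    obtain ⟨p, hp⟩ := hmon n
    refine ⟨C a * p, fun u => ?_⟩
    rw [← C_mul_X_pow_eq_monomial, gaussT_C_mul, hp, eval_mul, eval_C]
    ring

theorem integrable_cexp_mul_gaussT (v : ℂ) (P : ℂ[X]) :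
    Integrable fun u : ℝ => cexp (u * v) * gaussT c P u := by
  obtain ⟨p, hp⟩ := exists_gaussT_eq (c := c) P
  -- The comparison function e^{-u²/4} p(u) is written on the imaginary axis z = iu, which explains
  -- the substitution of -iz. It suffices because u Re v - u²/2 ≤ (Re v)² - u²/4.
  have h : LineIntegrable 0 fun z => cexp ((1 / 4 : ℝ) * z ^ 2) * (p.comp (C (-I) * X)).eval z :=
    (PolyGrowthOn.polynomial _).lineIntegrable (by norm_num)
  refine (h.const_mul (cexp ((v.re ^ 2 : ℝ)))).mono ?_ (Eventually.of_forall fun u => ?_)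
  · have hc : Continuous (gaussT c P) :=
      continuous_iff_continuousAt.2 fun u => (hasDerivAt_gaussT P u).continuousAt
    exact (Continuous.mul (by fun_prop) hc).aestronglyMeasurable
  · have h1 : (p.comp (C (-I) * X)).eval (((0 : ℝ) : ℂ) + u * I) = p.eval (u : ℂ) := by
      rw [eval_comp]
      congr 1
      simp only [eval_mul, eval_C, eval_X, ofReal_zero, zero_add]
      linear_combination -(u : ℂ) * I_sq
    beta_reduce
    rw [h1, hp, ← mul_assoc, ← mul_assoc, ← Complex.exp_add, ← Complex.exp_add, norm_mul,
      norm_mul]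
    gcongr
    rw [Complex.norm_exp, Complex.norm_exp, Real.exp_le_exp]
    have e1 : (u * v + -(u : ℂ) ^ 2 / 2).re = u * v.re - u ^ 2 / 2 := by
      simp [pow_two]
      ring
    have e2 : (((v.re ^ 2 : ℝ) : ℂ) + (1 / 4 : ℝ) * (((0 : ℝ) : ℂ) + u * I) ^ 2).re
        = v.re ^ 2 - u ^ 2 / 4 := by
      rw [ofReal_zero, zero_add, mul_pow, I_sq]
      norm_cast
      simp
      ring
    rw [e1, e2]
    nlinarith [sq_nonneg (u / 2 - v.re)]

/-- The Laplace transform inverts `gaussT`. -/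
theorem integral_cexp_mul_gaussT (v : ℂ) (P : ℂ[X]) :
    ∫ u : ℝ, cexp (u * v) * gaussT c P u = cexp (v ^ 2 / 2) * P.eval v := by
  have h5 : ((√(2 * π) : ℝ) : ℂ) ≠ 0 := by
    exact_mod_cast (Real.sqrt_pos.2 (by positivity)).ne'
  have h0 : ∫ u : ℝ, cexp (u * v) * gaussT c 1 u = cexp (v ^ 2 / 2) := by
    have hpt : ∀ u : ℝ, cexp (u * v) * gaussT c 1 u
        = ((√(2 * π) : ℝ) : ℂ)⁻¹ * cexp (-(1 / 2 : ℂ) * u ^ 2 + v * u + 0) := by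
      intro u
      rw [gaussT_one, div_eq_inv_mul, mul_left_comm, ← Complex.exp_add]
      congr 2
      ring
    simp only [hpt]
    rw [integral_const_mul, integral_cexp_quadratic (by norm_num)]
    have h2 : (π / (- -(1 / 2 : ℂ))) ^ (1 / 2 : ℂ) = (√(2 * π) : ℝ) := by
      rw [Real.sqrt_eq_rpow, ofReal_cpow (by positivity)]
      congr 1 <;> push_cast <;> ring
    rw [h2, ← mul_assoc, inv_mul_cancel₀ h5, one_mul]
    congr 1
    ring
  -- Integration by parts in u: a factor X under the inverse transform becomes a factor v, so P = 1
  -- suffices.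
  have hX : ∀ P : ℂ[X], ∫ u : ℝ, cexp (u * v) * gaussT c (X * P) u
      = v * ∫ u : ℝ, cexp (u * v) * gaussT c P u := by
    intro P
    have hi := integrable_cexp_mul_gaussT (c := c) v
    have hd : ∀ u : ℝ, HasDerivAt (fun u : ℝ => cexp (u * v) * gaussT c P u)
        (v * (cexp (u * v) * gaussT c P u) - cexp (u * v) * gaussT c (X * P) u) u := by
      intro u
      have h1 : HasDerivAt (fun u : ℝ => cexp (u * v)) (cexp (u * v) * v) u := by
        simpa using (((hasDerivAt_id u).ofReal_comp).mul_const v).cexp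
      refine (h1.mul (hasDerivAt_gaussT P u)).congr_deriv ?_
      ring
    have := integral_eq_zero_of_hasDerivAt_of_integrable hd (((hi P).const_mul v).sub (hi (X * P)))
      (hi P)
    rw [integral_sub ((hi P).const_mul v) (hi (X * P)), integral_const_mul] at this
    linear_combination -this
  induction P using Polynomial.induction_on with
  | C a =>
    simp only [gaussT_C, mul_left_comm _ a, integral_const_mul, h0, eval_C]
    ring
  | add P Q hP hQ =>
    simp only [gaussT_add, mul_add, eval_add]
    rw [integral_add (integrable_cexp_mul_gaussT v P) (integrable_cexp_mul_gaussT v Q), hP, hQ]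
  | monomial n a ih =>
    rw [pow_succ', mul_left_comm, hX, ih]
    simp only [eval_mul, eval_X, eval_C]
    ring

theorem iteratedDeriv_gaussT (n : ℕ) (P : ℂ[X]) (u : ℝ) :
    iteratedDeriv n (gaussT c P) u = (-1) ^ n * gaussT c (X ^ n * P) u := by
  induction n generalizing P with
  | zero => simp
  | succ n ih =>
    have h1 : deriv (gaussT c P) = gaussT c (C (-1) * (X * P)) := by
      ext u
      rw [(hasDerivAt_gaussT P u).deriv, gaussT_C_mul]
      ring
    rw [iteratedDeriv_succ', h1, ih, mul_left_comm, gaussT_C_mul, ← mul_assoc (X ^ n), ← pow_succ]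
    ring

end gaussT

/-! ### The operators 𝒟, ℰ and ℱ on the Gaussian family -/

theorem integral_Ioi_eq_integral_Ioi_zero (ξ : ℝ) (f : ℝ → ℂ) :
    ∫ u in Set.Ioi ξ, f u = ∫ x in Set.Ioi (0 : ℝ), f (x + ξ) := by
  rw [← integral_indicator measurableSet_Ioi, ← integral_indicator measurableSet_Ioi,
    ← integral_add_right_eq_self _ ξ]
  congr 1
  ext x
  by_cases h : 0 < x
  · rw [Set.indicator_of_mem (by simpa using h), Set.indicator_of_mem (by simpa using h)]
  · rw [Set.indicator_of_notMem (by simpa using h), Set.indicator_of_notMem (by simpa using h)]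

theorem integrableOn_pow_mul_cexp_Ioi (n : ℕ) {v : ℂ} (hv : 0 < v.re) :
    IntegrableOn (fun x : ℝ => (x : ℂ) ^ n * cexp (-x * v)) (Set.Ioi 0) := by
  have h := Complex.integral_cpow_mul_exp_neg_mul_Ioi (a := (n + 1 : ℂ)) (r := v.re)
    (by simp; positivity) hv
  rw [Complex.Gamma_nat_eq_factorial] at h
  -- Integrability comes from the value of the Gamma integral: a nonintegrable function has Bochner
  -- integral 0 by convention, and this one is nonzero.
  have hI : Integrable (fun x : ℝ => (x : ℂ) ^ ((n : ℂ) + 1 - 1) * cexp (-(v.re * x)))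
      (volume.restrict (Set.Ioi 0)) := by
    refine Integrable.of_integral_ne_zero ?_
    rw [h]
    refine mul_ne_zero ?_ (by exact_mod_cast n.factorial_ne_zero)
    rw [cpow_def_of_ne_zero (by simpa using hv.ne')]
    exact Complex.exp_ne_zero _
  have hcont : Continuous fun x : ℝ => cexp (-(x * v.im : ℝ) * I) := by fun_prop
  refine (hI.bdd_mul (c := 1) hcont.aestronglyMeasurable
    (Eventually.of_forall fun x => ?_)).congr (Eventually.of_forall fun x => ?_)
  · rw [Complex.norm_exp]
    simp
  · beta_reduce
    rw [add_sub_cancel_right, cpow_natCast, mul_left_comm, ← Complex.exp_add]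
    congr 2
    conv_rhs => rw [← re_add_im v]
    push_cast
    ring

theorem integral_pow_mul_cexp_Ioi (n : ℕ) {v : ℂ} (hv : 0 < v.re) :
    ∫ x in Set.Ioi (0 : ℝ), (x : ℂ) ^ n * cexp (-x * v) = n ! * (v ^ (n + 1))⁻¹ := by
  have hv0 : v ≠ 0 := by
    rintro rfl
    simp at hv
  induction n with
  | zero =>
    have h := integral_exp_mul_complex_Ioi (a := -v) (by simpa using hv) 0
    have hpt : ∀ x : ℝ, (x : ℂ) ^ 0 * cexp (-x * v) = cexp (-v * x) := fun x => by
      rw [pow_zero, one_mul, neg_mul_comm, mul_comm]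
    simp only [hpt]
    rw [h]
    simp
  | succ n ih =>
    have hd : ∀ x : ℝ, HasDerivAt (fun x : ℝ => (x : ℂ) ^ (n + 1) * cexp (-x * v))
        ((n + 1) * ((x : ℂ) ^ n * cexp (-x * v)) - v * ((x : ℂ) ^ (n + 1) * cexp (-x * v))) x := by
      intro x
      have hid : HasDerivAt (fun u : ℝ => (u : ℂ)) 1 x := (hasDerivAt_id x).ofReal_comp
      refine ((hid.pow (n + 1)).mul (hid.neg.mul_const v).cexp).congr_deriv ?_
      simp
      ring
    have hi := integrableOn_pow_mul_cexp_Ioi (v := v)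
    have h0 := ((hi n hv).const_mul ((n : ℂ) + 1)).sub ((hi (n + 1) hv).const_mul v)
    have ht := tendsto_zero_of_hasDerivAt_of_integrableOn_Ioi (fun x _ => hd x) h0 (hi (n + 1) hv)
    have hr := integral_Ioi_of_hasDerivAt_of_tendsto' (fun x _ => hd x) h0 ht
    rw [integral_sub ((hi n hv).const_mul _) ((hi (n + 1) hv).const_mul v), integral_const_mul,
      integral_const_mul, ih] at hr
    rw [ofReal_zero, zero_pow n.succ_ne_zero, zero_mul, sub_zero] at hr
    rw [Nat.factorial_succ, pow_succ v (n + 1), mul_inv]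
    push_cast
    generalize ∫ x in Set.Ioi (0 : ℝ), (x : ℂ) ^ (n + 1) * cexp (-x * v) = J at hr ⊢
    rw [sub_eq_zero] at hr
    rw [← mul_right_inj' hv0, ← hr]
    field_simp

section operators

variable {δ c : ℝ}

/-- Fubini and ∫₀^∞ x^n e^{-xv} dx = n!/v^{n+1}, which converges because the line lies in Re v = c >
0. -/
theorem integral_pow_mul_gaussT (hc : 0 < c) (n : ℕ) (P : ℂ[X]) (ξ : ℝ) :
    ∫ x in Set.Ioi (0 : ℝ), (x : ℂ) ^ n * gaussT c P (x + ξ)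
      = n ! * lineInt c fun v => (v ^ (n + 1))⁻¹ * (cexp (-ξ * v) * (cexp (v ^ 2 / 2) * P.eval v)) := by
  set h : ℂ → ℂ := fun v => cexp (-ξ * v) * (cexp (v ^ 2 / 2) * P.eval v) with hh
  have hre : ∀ t : ℝ, 0 < (c + t * I : ℂ).re := by
    intro t
    simpa using hc
  have hint : Integrable (Function.uncurry fun x t : ℝ =>
      (x : ℂ) ^ n * (cexp (-x * (c + t * I)) * h (c + t * I)))
      ((volume.restrict (Set.Ioi 0)).prod volume) := by
    have h1 := Integrable.mul_prod (integrableOn_pow_mul_cexp_Ioi n (v := c) (by simpa using hc))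
      (lineIntegrable_gaussT (c := c) P ξ)
    have hcont : Continuous fun p : ℝ × ℝ => cexp (-(p.1 * p.2 : ℝ) * I) := by fun_prop
    refine (h1.bdd_mul (c := 1) hcont.aestronglyMeasurable
      (Eventually.of_forall fun p => ?_)).congr (Eventually.of_forall fun p => ?_)
    · rw [Complex.norm_exp]
      simp
    · simp only [Function.uncurry, hh]
      rw [show -(p.1 : ℂ) * (c + p.2 * I) = -(p.1 * p.2 : ℝ) * I + -p.1 * c by push_cast; ring,
        Complex.exp_add]
      ring
  have hL : ∀ x : ℝ, (x : ℂ) ^ n * gaussT c P (x + ξ)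
      = (2 * π * I)⁻¹ * I * ∫ t : ℝ, (x : ℂ) ^ n * (cexp (-x * (c + t * I)) * h (c + t * I)) := by
    intro x
    unfold gaussT lineInt
    rw [integral_const_mul, integral_mul_const]
    have : ∀ t : ℝ, cexp (-((x + ξ : ℝ) : ℂ) * (c + t * I)) * (cexp ((c + t * I : ℂ) ^ 2 / 2)
        * P.eval (c + t * I : ℂ)) = cexp (-x * (c + t * I)) * h (c + t * I) := by
      intro t
      rw [hh]
      simp only
      rw [← mul_assoc (cexp (-x * _)), ← Complex.exp_add]
      congr 2
      push_cast
      ring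
    simp only [this]
    ring
  simp only [hL]
  rw [integral_const_mul, integral_integral_swap hint]
  have hR : ∀ t : ℝ, ∫ x in Set.Ioi (0 : ℝ), (x : ℂ) ^ n * (cexp (-x * (c + t * I)) * h (c + t * I))
      = n ! * (((c + t * I : ℂ) ^ (n + 1))⁻¹ * h (c + t * I)) := by
    intro t
    simp only [← mul_assoc, integral_mul_const]
    rw [integral_pow_mul_cexp_Ioi n (hre t)]
  simp only [hR]
  unfold lineInt
  rw [integral_const_mul, integral_mul_const]
  ring

/-- The operator multiplies the integrand by (-v)^τ. For τ < 0 the half-line integral is the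
repeated antiderivative vanishing at +∞, hence division by -v. -/
theorem opD_gaussT (hc : 0 < c) (τ : ℤ) (ξ : ℝ) (P : ℂ[X]) :
    opD τ ξ (gaussT c P) = (-1) ^ τ * lineInt c fun v =>
      v ^ τ * (cexp (-ξ * v) * (cexp (v ^ 2 / 2) * P.eval v)) := by
  unfold opD
  split_ifs with h
  · lift τ to ℕ using h
    rw [Int.toNat_natCast, iteratedDeriv_gaussT, zpow_natCast, gaussT]
    congr 2
    ext v
    rw [eval_mul, eval_pow, eval_X, zpow_natCast]
    ring
  · obtain ⟨n, hn⟩ := Int.eq_ofNat_of_zero_le (show 0 ≤ -τ - 1 by omega)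
    obtain rfl : τ = -((n + 1 : ℕ) : ℤ) := by push_cast; omega
    rw [hn, Int.toNat_natCast, integral_Ioi_eq_integral_Ioi_zero]
    have hpt : ∀ x : ℝ, (((ξ - (x + ξ)) ^ n / n ! : ℝ) : ℂ) * gaussT c P (x + ξ)
        = ((-1) ^ n / n !) * ((x : ℂ) ^ n * gaussT c P (x + ξ)) := by
      intro x
      rw [show ξ - (x + ξ) = -1 * x by ring, mul_pow]
      push_cast
      ring
    simp only [hpt]
    rw [integral_const_mul, integral_pow_mul_gaussT hc]
    have hf : (n ! : ℂ) ≠ 0 := by exact_mod_cast n.factorial_ne_zero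
    simp only [zpow_neg, zpow_natCast]
    rw [← inv_pow, inv_neg, inv_one, pow_succ]
    field_simp

/-- The inner transform restores e^{v²/2} P(v), so the total weight is e^{v²}; the circle integral
then gives v^τ times the truncation. The outer minus sign comes from w - v in place of v - w. -/
theorem opE_gaussT (hδ : 0 < δ) (hc : δ < c) (τ : ℤ) (ξ : ℝ) (P : ℂ[X]) :
    (opE δ c τ ξ fun v => ∫ u : ℝ, (1 / (√(2 * π) : ℂ)) * cexp (u * v) * gaussT c P u)
      = -((-1) ^ τ * lineInt c fun v =>
        cexp (v ^ 2 / 2) * truncF ξ (-τ) v * v ^ τ * (cexp (v ^ 2 / 2) * P.eval v)) := by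
  have h5 : ((√(2 * π) : ℝ) : ℂ) ≠ 0 := by
    exact_mod_cast (Real.sqrt_pos.2 (by positivity)).ne'
  unfold opE
  simp only [mul_assoc, integral_const_mul, integral_cexp_mul_gaussT]
  have h1 : ∀ w : ℂ, cexp (-w ^ 2 / 2 - ξ * w) / (-w) ^ (-τ) * lineInt c (fun v =>
        cexp (v ^ 2 / 2) / (w - v) * (1 / ((√(2 * π) : ℝ) : ℂ) * (cexp (v ^ 2 / 2) * P.eval v)))
      = -((-1) ^ τ / ((√(2 * π) : ℝ) : ℂ)) * ((w ^ τ * hermGen ξ w) * lineInt c (fun v =>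
        cexp ((1 : ℝ) * v ^ 2) * (P.eval v * (v - w)⁻¹))) := by
    intro w
    have h2 : ∀ v : ℂ, cexp (v ^ 2 / 2) / (w - v)
          * (1 / ((√(2 * π) : ℝ) : ℂ) * (cexp (v ^ 2 / 2) * P.eval v))
        = -((√(2 * π) : ℝ) : ℂ)⁻¹ * (cexp ((1 : ℝ) * v ^ 2) * (P.eval v * (v - w)⁻¹)) := by
      intro v
      rw [show ((1 : ℝ) : ℂ) * v ^ 2 = v ^ 2 / 2 + v ^ 2 / 2 by push_cast; ring, Complex.exp_add,
        ← neg_sub v w, div_neg, div_eq_mul_inv, one_div]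
      ring
    simp only [h2]
    rw [lineInt_const_mul, hermGen, zpow_neg, div_inv_eq_mul, neg_eq_neg_one_mul w, mul_zpow]
    ring
  simp only [mul_assoc] at h1 ⊢
  simp only [h1]
  rw [circInt_const_mul]
  have hA : ContinuousOn (fun w => w ^ τ * hermGen ξ w) (Metric.sphere 0 δ) :=
    (continuousOn_zpow_sphere hδ τ).mul (differentiable_hermGen ξ).continuous.continuousOn
  have hs := circInt_lineInt_swap hδ hc one_pos hA (PolyGrowthOn.polynomial (S := vstrip c c) P)
  simp only [mul_assoc] at hs
  rw [hs]
  have hlt : ∀ w ∈ vstrip c c, δ < ‖w‖ := fun w hw =>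
    hc.trans_le ((hw.1.trans (le_abs_self _)).trans (abs_re_le_norm w))
  have hl : lineInt c (fun w => cexp ((1 : ℝ) * w ^ 2) * (P.eval w
        * circInt δ fun v => v ^ τ * (hermGen ξ v * (w - v)⁻¹)))
      = lineInt c fun v =>
        cexp (v ^ 2 / 2) * (truncF ξ (-τ) v * (v ^ τ * (cexp (v ^ 2 / 2) * P.eval v))) := by
    refine lineInt_congr fun v hv => ?_
    have := circInt_hermGen_cauchy hδ ξ τ (hlt v hv)
    simp only [mul_assoc] at this
    rw [this, show ((1 : ℝ) : ℂ) * v ^ 2 = v ^ 2 / 2 + v ^ 2 / 2 by push_cast; ring,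
      Complex.exp_add]
    ring
  rw [hl]
  field_simp

theorem opF_gaussT (hδ : 0 < δ) (hc : δ < c) (τ : ℤ) (ξ : ℝ) (P : ℂ[X]) :
    opF δ c τ ξ (gaussT c P) = (-1) ^ τ * lineF c τ ξ P := by
  have hc0 := hδ.trans hc
  unfold opF
  rw [opD_gaussT hc0, opE_gaussT hδ hc, ← sub_eq_add_neg, ← mul_sub, lineF, ← lineInt_sub]
  · congr 2
    ext v
    ring
  · have h : PolyGrowthOn (vstrip c c) fun v => v ^ τ * (cexp ((-ξ : ℝ) * v) * P.eval v) :=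
      (PolyGrowthOn.zpow hc0 τ).mul ((PolyGrowthOn.cexp_mul _).mul (.polynomial _))
    refine h.lineIntegrable_half.congr fun v _ => ?_
    push_cast
    ring
  · have h : PolyGrowthOn (vstrip c c) fun v => truncF ξ (-τ) v * v ^ τ * P.eval v :=
      ((PolyGrowthOn.truncF _ _).mul (PolyGrowthOn.zpow hc0 τ)).mul (.polynomial _)
    refine (h.lineIntegrable one_pos).congr fun v _ => ?_
    rw [show ((1 : ℝ) : ℂ) * v ^ 2 = v ^ 2 / 2 + v ^ 2 / 2 by push_cast; ring,
      Complex.exp_add]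
    ring

end operators

/-! ### The GUE kernel in the Gaussian family -/

section hermite

variable {c : ℝ}

/-- Under the transform X acts as u minus the derivative. The Appell term contributes -(j+1), which
changes the coefficient (j+1)/2 of the recurrence into -(j+1)/2: the parameter 1/2 becomes -1/2. -/
theorem gaussT_mpoly (j : ℕ) (u : ℝ) :
    gaussT c (mpoly (1 / 2) j) u = (mpoly (-1 / 2) j).eval (u : ℂ) * gaussT c 1 u := by
  induction j using Nat.twoStepInduction with
  | zero => simp [mpoly]
  | one => simpa [mpoly] using gaussT_X u
  | more j h0 h1 =>
    have hd : derivative (mpoly (1 / 2) (j + 1)) = C ((j : ℂ) + 1) * mpoly (1 / 2) j := by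
      rw [derivative_mpoly]
      simp
    rw [mpoly_succ_succ, gaussT_add, gaussT_X_mul, gaussT_C_mul, hd, gaussT_C_mul, h0, h1,
      eval_mpoly_succ_succ]
    ring

theorem hermiteH_eq (j : ℕ) (u : ℝ) :
    (hermiteH j u : ℂ) = 2 ^ j * (mpoly (-1 / 2) j).eval (u : ℂ) := by
  rw [hermiteH, ofReal_mul, hermiteP_eq, ofReal_mul, eval_mpoly_scale (b := -1 / 2),
    ofReal_pow, ← mul_assoc, ← mul_pow, ← pow_two, sqrt_two_sq]
  rw [sqrt_two_sq]
  norm_num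

theorem hermiteH_mul_cexp (j : ℕ) {ε : ℝ} (hε : ε ^ 2 = 1) (u : ℝ) :
    (hermiteH j (ε * u) : ℂ) * cexp (-((ε * u : ℝ) : ℂ) ^ 2 / 2)
      = (ε : ℂ) ^ j * 2 ^ j * (√(2 * π) : ℝ) * gaussT c (mpoly (1 / 2) j) u := by
  have h5 : ((√(2 * π) : ℝ) : ℂ) ≠ 0 := by
    exact_mod_cast (Real.sqrt_pos.2 (by positivity)).ne'
  have hε' : (ε : ℂ) ^ 2 = 1 := by exact_mod_cast hε
  rw [gaussT_mpoly, gaussT_one, hermiteH_eq, ofReal_mul,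
    eval_mpoly_scale (a := -1 / 2) (b := -1 / 2) (by rw [hε', one_mul]), mul_pow, hε', one_mul]
  field_simp

theorem gue_eq (r : ℕ) {ε₁ ε₂ : ℝ} (h₁ : ε₁ ^ 2 = 1) (h₂ : ε₂ ^ 2 = 1) (u₁ u₂ : ℝ) :
    (gue r (ε₁ * u₁) (ε₂ * u₂) : ℂ) = ∑ j ∈ Finset.range r,
      2 ^ j * (2 * (√π : ℝ)) / j ! * (ε₁ : ℂ) ^ j * (ε₂ : ℂ) ^ j
        * gaussT c (mpoly (1 / 2) j) u₁ * gaussT c (mpoly (1 / 2) j) u₂ := by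
  unfold gue
  push_cast
  refine Finset.sum_congr rfl fun j _ => ?_
  have e1 := hermiteH_mul_cexp (c := c) j h₁ u₁
  have e2 := hermiteH_mul_cexp (c := c) j h₂ u₂
  have hp : ((√π : ℝ) : ℂ) ≠ 0 := by exact_mod_cast (Real.sqrt_pos.2 Real.pi_pos).ne'
  have h3 : ((√(2 * π) : ℝ) : ℂ) * ((√(2 * π) : ℝ) : ℂ) = 2 * ((√π : ℝ) : ℂ) ^ 2 := by
    norm_cast
    rw [Real.mul_self_sqrt (by positivity), Real.sq_sqrt Real.pi_pos.le]
  have hs : cexp (-(((ε₁ * u₁) ^ 2 + (ε₂ * u₂) ^ 2 : ℝ) : ℂ) / 2)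
      = cexp (-((ε₁ * u₁ : ℝ) : ℂ) ^ 2 / 2) * cexp (-((ε₂ * u₂ : ℝ) : ℂ) ^ 2 / 2) := by
    rw [← Complex.exp_add]
    congr 1
    push_cast
    ring
  push_cast at hs e1 e2 ⊢
  rw [hs]
  calc _ = ((hermiteH j (ε₁ * u₁) : ℂ) * cexp (-(ε₁ * u₁ : ℂ) ^ 2 / 2))
        * ((hermiteH j (ε₂ * u₂) : ℂ) * cexp (-(ε₂ * u₂ : ℂ) ^ 2 / 2))
        / ((√π : ℝ) * 2 ^ j * j !) := by ring
    _ = _ := by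
      rw [e1, e2]
      have hf : (j ! : ℂ) ≠ 0 := by exact_mod_cast j.factorial_ne_zero
      field_simp
      linear_combination ((ε₁ : ℂ) ^ j * (ε₂ : ℂ) ^ j * gaussT c (mpoly (1 / 2) j) u₁
        * gaussT c (mpoly (1 / 2) j) u₂) * h3

end hermite

section lineF

variable {δ c : ℝ}

theorem lineIntegrable_lineF (hc : 0 < c) (τ : ℤ) (ξ : ℝ) (P : ℂ[X]) :
    LineIntegrable c fun v => v ^ τ * (cexp (-ξ * v) - cexp (v ^ 2 / 2) * truncF ξ (-τ) v)
      * (cexp (v ^ 2 / 2) * P.eval v) := by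
  have h1 : PolyGrowthOn (vstrip c c) fun v => v ^ τ * (cexp ((-ξ : ℝ) * v) * P.eval v) :=
    (PolyGrowthOn.zpow hc τ).mul ((PolyGrowthOn.cexp_mul _).mul (.polynomial _))
  have h2 : PolyGrowthOn (vstrip c c) fun v => truncF ξ (-τ) v * v ^ τ * P.eval v :=
    ((PolyGrowthOn.truncF _ _).mul (PolyGrowthOn.zpow hc τ)).mul (.polynomial _)
  refine (h1.lineIntegrable_half.sub (h2.lineIntegrable one_pos)).congr fun v _ => ?_
  rw [show ((1 : ℝ) : ℂ) * v ^ 2 = v ^ 2 / 2 + v ^ 2 / 2 by push_cast; ring, Complex.exp_add]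
  push_cast
  ring

theorem lineF_sum (hc : 0 < c) (τ : ℤ) (ξ : ℝ) {ι : Type*} (s : Finset ι) (a : ι → ℂ)
    (P : ι → ℂ[X]) :
    lineF c τ ξ (∑ i ∈ s, C (a i) * P i) = ∑ i ∈ s, a i * lineF c τ ξ (P i) := by
  unfold lineF
  simp only [← lineInt_const_mul]
  rw [← lineInt_sum s fun i _ => (lineIntegrable_lineF hc τ ξ (P i)).const_mul (a i)]
  refine lineInt_congr fun v _ => ?_
  simp only [eval_finsetSum, eval_mul, eval_C, Finset.mul_sum]
  refine Finset.sum_congr rfl fun i _ => ?_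
  ring

theorem opF_gaussT_sum (hδ : 0 < δ) (hc : δ < c) (τ : ℤ) (ξ : ℝ) {ι : Type*} (s : Finset ι)
    (a : ι → ℂ) (P : ι → ℂ[X]) :
    (opF δ c τ ξ fun u => ∑ i ∈ s, a i * gaussT c (P i) u)
      = (-1) ^ τ * ∑ i ∈ s, a i * lineF c τ ξ (P i) := by
  rw [← lineF_sum (hδ.trans hc), ← opF_gaussT hδ hc]
  congr 1
  ext u
  rw [gaussT_sum]

/-- The signs (-1)^{-τ₁} and (-1)^{τ₂} produced by the two operators cancel the prefactor, while the
minus sign in -ε₂u₂ turns 2^j into (-2)^j. -/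
theorem partL2_eq (hδ : 0 < δ) (hc : δ < c) {ε₁ ε₂ : ℝ} (h₁ : ε₁ ^ 2 = 1) (h₂ : ε₂ ^ 2 = 1)
    (r : ℕ) (τ₁ : ℤ) (ξ₁ : ℝ) (τ₂ : ℤ) (ξ₂ : ℝ) :
    partL2 δ c ε₁ ε₂ r τ₁ ξ₁ τ₂ ξ₂ = ∑ j ∈ Finset.range r,
      (-2) ^ j * (2 * (√π : ℝ)) / j !
        * ((ε₁ : ℂ) ^ τ₁ * (ε₁ : ℂ) ^ j * lineF c (-τ₁) (ε₁ * ξ₁) (mpoly (1 / 2) j))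
        * ((ε₂ : ℂ) ^ τ₂ * (ε₂ : ℂ) ^ j * lineF c τ₂ (ε₂ * -ξ₂) (mpoly (1 / 2) j)) := by
  have hinner : ∀ u₁ : ℝ, (opF δ c τ₂ (-ε₂ * ξ₂) fun u₂ => (gue r (ε₁ * u₁) (-ε₂ * u₂) : ℂ))
      = ∑ j ∈ Finset.range r, (-1) ^ τ₂ * (2 ^ j * (2 * (√π : ℝ)) / j ! * (ε₁ : ℂ) ^ j
        * ((-ε₂ : ℝ) : ℂ) ^ j * lineF c τ₂ (-ε₂ * ξ₂) (mpoly (1 / 2) j))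
        * gaussT c (mpoly (1 / 2) j) u₁ := by
    intro u₁
    have h₂' : (-ε₂) ^ 2 = 1 := by rw [neg_sq, h₂]
    simp only [gue_eq (c := c) r h₁ h₂']
    rw [opF_gaussT_sum hδ hc, Finset.mul_sum]
    refine Finset.sum_congr rfl fun j _ => ?_
    ring
  unfold partL2
  rw [funext hinner]
  rw [opF_gaussT_sum hδ hc, Finset.mul_sum, Finset.mul_sum]
  refine Finset.sum_congr rfl fun j _ => ?_
  have hm : (-1 : ℂ) ^ (τ₁ - τ₂) * (-1) ^ (-τ₁) * (-1) ^ τ₂ = 1 := by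
    have h0 : (-1 : ℂ) ≠ 0 := by norm_num
    rw [← zpow_add₀ h0, ← zpow_add₀ h0, show τ₁ - τ₂ + -τ₁ + τ₂ = 0 by ring, zpow_zero]
  rw [show -ε₂ * ξ₂ = ε₂ * -ξ₂ by ring, show (-2 : ℂ) = -1 * 2 by norm_num, mul_pow,
    show ((-ε₂ : ℝ) : ℂ) = -1 * ε₂ by push_cast; ring, mul_pow]
  linear_combination ((-1) ^ j * 2 ^ j * (2 * (√π : ℝ)) / j !
        * ((ε₁ : ℂ) ^ τ₁ * (ε₁ : ℂ) ^ j * lineF c (-τ₁) (ε₁ * ξ₁) (mpoly (1 / 2) j))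
        * ((ε₂ : ℂ) ^ τ₂ * (ε₂ : ℂ) ^ j * lineF c τ₂ (ε₂ * -ξ₂) (mpoly (1 / 2) j))) * hm

end lineF

/-! ### Moving the line across 0, and the independence of the signs -/

theorem circInt_zpow_of_ne {δ : ℝ} {n : ℤ} (hn : n ≠ -1) :
    circInt δ (fun w => w ^ n) = 0 := by
  have := circleIntegral.integral_sub_zpow_of_ne hn 0 0 δ
  simp only [sub_zero] at this
  rw [circInt, this, mul_zero]

theorem circInt_inv_mul {δ : ℝ} (hδ : 0 < δ) {f : ℂ → ℂ} (hf : Differentiable ℂ f) :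
    circInt δ (fun w => w⁻¹ * f w) = f 0 := by
  have := Complex.circleIntegral_sub_center_inv_smul_of_differentiable_on_off_countable (c := 0)
    hδ Set.countable_empty hf.continuous.continuousOn (fun z _ => hf z)
  simp only [sub_zero, smul_eq_mul] at this
  rw [circInt, this, inv_mul_cancel_left₀ two_pi_I_ne_zero]

theorem truncF_natCast (ξ : ℝ) (m : ℕ) (v : ℂ) :
    truncF ξ m v = ∑ j ∈ Finset.range m, ((hermiteP j (-ξ) / j ! : ℝ) : ℂ) * v ^ j := by
  rw [truncF, Int.toNat_natCast]

/-- The Taylor remainder is divisible by v^m. Inductively, the next coefficient is the value at 0 of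
the previous quotient, and the divided difference at 0 is again entire. -/
theorem exists_entire_quotient (ξ : ℝ) (m : ℕ) :
    ∃ N : ℂ → ℂ, Differentiable ℂ N ∧
      ∀ v ≠ 0, N v = v ^ (-(m : ℤ)) * (hermGen ξ v - truncF ξ m v) := by
  induction m with
  | zero => exact ⟨hermGen ξ, differentiable_hermGen ξ, fun v _ => by simp [truncF]⟩
  | succ m ih =>
    obtain ⟨N, hN, h⟩ := ih
    -- Cauchy's formula for N(0): the subtracted Taylor terms give powers w^n with n ≤ -2, whose
    -- integrals vanish.
    have hN0 : N 0 = ((hermiteP m (-ξ) / m ! : ℝ) : ℂ) := by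
      rw [← circInt_hermGen_coeff one_pos ξ m, ← circInt_inv_mul one_pos hN]
      have hs : ∀ w ∈ Metric.sphere (0 : ℂ) 1, w ^ (-(m : ℤ) - 1) * hermGen ξ w = w⁻¹ * N w
          + ∑ j ∈ Finset.range m, ((hermiteP j (-ξ) / j ! : ℝ) : ℂ) * w ^ ((j : ℤ) - m - 1) := by
        intro w hw
        have hw0 := ne_zero_of_mem_sphere one_pos hw
        have h2 : ∀ j : ℕ, ((hermiteP j (-ξ) / j ! : ℝ) : ℂ) * w ^ ((j : ℤ) - m - 1)
            = w ^ (-(m : ℤ) - 1) * (((hermiteP j (-ξ) / j ! : ℝ) : ℂ) * w ^ j) := by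
          intro j
          rw [show (j : ℤ) - m - 1 = (-(m : ℤ) - 1) + j by ring, zpow_add₀ hw0, zpow_natCast]
          ring
        simp only [h2]
        rw [← Finset.mul_sum, ← truncF_natCast, h w hw0, zpow_sub_one₀ hw0]
        ring
      have hc : ∀ n : ℤ, CircleIntegrable (fun w : ℂ => w ^ n) 0 1 := fun n =>
        (continuousOn_zpow_sphere one_pos n).circleIntegrable zero_le_one
      have hcs : ∀ j ∈ Finset.range m, CircleIntegrable
          (fun w : ℂ => ((hermiteP j (-ξ) / j ! : ℝ) : ℂ) * w ^ ((j : ℤ) - m - 1)) 0 1 :=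
        fun j _ => (hc _).const_fun_smul
      rw [circInt_congr one_pos hs, circInt_add, circInt_sum _ hcs, left_eq_add]
      · refine Finset.sum_eq_zero fun j hj => ?_
        rw [circInt_const_mul, circInt_zpow_of_ne, mul_zero]
        have := Finset.mem_range.1 hj
        omega
      · refine ContinuousOn.circleIntegrable zero_le_one (ContinuousOn.mul ?_
          hN.continuous.continuousOn)
        simpa using continuousOn_zpow_sphere one_pos (-1)
      · exact CircleIntegrable.fun_sum _ hcs
    refine ⟨dslope N 0, ?_, fun v hv => ?_⟩
    · rw [← differentiableOn_univ] at hN ⊢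
      exact (Complex.differentiableOn_dslope Filter.univ_mem).2 hN
    · rw [dslope_of_ne _ hv, slope_def_field, hN0, h v hv, truncF_natCast, truncF_natCast,
        Finset.sum_range_succ, sub_zero, Nat.cast_succ, neg_add, ← sub_eq_add_neg,
        zpow_sub_one₀ hv, zpow_neg, zpow_natCast]
      have := pow_ne_zero m hv
      field_simp
      ring

theorem exists_entire_zpow_mul (ξ : ℝ) (τ : ℤ) :
    ∃ N : ℂ → ℂ, Differentiable ℂ N ∧
      ∀ v ≠ 0, N v = v ^ τ * (hermGen ξ v - truncF ξ (-τ) v) := by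
  rcases le_total 0 τ with h | h
  · lift τ to ℕ using h
    refine ⟨fun v => v ^ τ * hermGen ξ v, (differentiable_id.pow τ).mul (differentiable_hermGen ξ),
      fun v _ => ?_⟩
    simp [truncF]
  · obtain ⟨m, rfl⟩ := Int.exists_eq_neg_ofNat h
    simpa using exists_entire_quotient ξ m

/-- Allows strips that contain 0, where a bound proved through v^τ with negative τ breaks down. -/
theorem PolyGrowthOn.of_diff_ball {S : Set ℂ} {f : ℂ → ℂ} (hf : Continuous f)
    (h : PolyGrowthOn (S \ Metric.ball 0 1) f) : PolyGrowthOn S f := by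
  obtain ⟨C, k, hC, hb⟩ := h.bound
  obtain ⟨D, hD⟩ := (isCompact_closedBall (0 : ℂ) 1).exists_bound_of_continuousOn hf.continuousOn
  refine ⟨hf.continuousOn, max C D, k, hC.trans (le_max_left _ _), fun z hz => ?_⟩
  have h1 : (1 : ℝ) ≤ (1 + ‖z‖) ^ k := one_le_pow₀ (by simp)
  by_cases hz1 : z ∈ Metric.ball (0 : ℂ) 1
  · calc ‖f z‖ ≤ max C D * 1 := by
          rw [mul_one]
          exact (hD z (Metric.ball_subset_closedBall hz1)).trans (le_max_right _ _)
      _ ≤ _ := mul_le_mul_of_nonneg_left h1 (hC.trans (le_max_left _ _))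
  · exact (hb z ⟨hz, hz1⟩).trans (by gcongr; exact le_max_left _ _)

theorem PolyGrowthOn.zpow_diff_ball {S : Set ℂ} (m : ℤ) :
    PolyGrowthOn (S \ Metric.ball 0 1) fun z => z ^ m := by
  rcases le_total 0 m with h | h
  · lift m to ℕ using h
    simpa using PolyGrowthOn.id.pow m
  · obtain ⟨n, rfl⟩ := Int.exists_eq_neg_ofNat h
    have hi : PolyGrowthOn (S \ Metric.ball 0 1) fun z : ℂ => z⁻¹ :=
      PolyGrowthOn.inv continuousOn_id one_pos fun z hz => by simpa using hz.2
    simpa using hi.pow n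

/-- Off 0 the integrand is e^{v²} P(v) times an entire function, so the line may pass over 0. The
lines themselves avoid 0, where the expression with v^τ need not agree with the entire extension. -/
theorem lineF_shift_of_le {a b : ℝ} (ha : a ≠ 0) (hb : b ≠ 0) (hab : a ≤ b) (τ : ℤ) (ξ : ℝ)
    (P : ℂ[X]) : lineF a τ ξ P = lineF b τ ξ P := by
  obtain ⟨N, hN, h⟩ := exists_entire_zpow_mul ξ τ
  have hpt : ∀ v ≠ 0, v ^ τ * (cexp (-ξ * v) - cexp (v ^ 2 / 2) * truncF ξ (-τ) v)
      = cexp (v ^ 2 / 2) * N v := by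
    intro v hv
    have he : cexp (-ξ * v) = cexp (v ^ 2 / 2) * hermGen ξ v := by
      rw [hermGen, ← Complex.exp_add]
      congr 1
      ring
    rw [h v hv, he]
    ring
  have hc : ∀ c : ℝ, c ≠ 0 → lineF c τ ξ P
      = lineInt c fun v => cexp ((1 / 2 : ℝ) * v ^ 2) * (cexp (v ^ 2 / 2) * N v * P.eval v) := by
    intro c hc
    refine lineInt_congr fun v hv => ?_
    have hv0 : v ≠ 0 := by
      rintro rfl
      exact hc (le_antisymm (by simpa using hv.1) (by simpa using hv.2))
    rw [hpt v hv0, ← cexp_half_sq]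
    ring
  rw [hc a ha, hc b hb]
  -- The factor e^{v²/2} must stay with N, since N alone can grow like e^{(Im v)²/2} up to powers.
  -- Off the unit disc the product is v^τ(e^{-ξv} - e^{v²/2} F), which has polynomial growth.
  have hd : Differentiable ℂ fun v => cexp (v ^ 2 / 2) * N v := by fun_prop
  refine lineInt_shift hab (by norm_num) (hd.mul P.differentiable).differentiableOn
    (PolyGrowthOn.mul (.of_diff_ball hd.continuous ?_) (.polynomial P))
  have h1 : PolyGrowthOn (vstrip a b \ Metric.ball 0 1) fun v : ℂ => cexp ((-ξ : ℝ) * v) :=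
    (PolyGrowthOn.cexp_mul _).mono Set.sdiff_subset
  have h2 : PolyGrowthOn (vstrip a b \ Metric.ball 0 1) fun v : ℂ => cexp ((1 / 2 : ℝ) * v ^ 2) :=
    (PolyGrowthOn.cexp_sq (by norm_num)).mono Set.sdiff_subset
  refine ((PolyGrowthOn.zpow_diff_ball τ).mul
    (h1.sub (h2.mul (PolyGrowthOn.truncF ξ (-τ))))).congr fun v hv => ?_
  have hv0 : v ≠ 0 := by
    rintro rfl
    exact hv.2 (by simp)
  rw [← hpt v hv0, ← cexp_half_sq, ofReal_neg]

theorem lineF_shift {a b : ℝ} (ha : a ≠ 0) (hb : b ≠ 0) (τ : ℤ) (ξ : ℝ) (P : ℂ[X]) :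
    lineF a τ ξ P = lineF b τ ξ P := by
  rcases le_total a b with h | h
  · exact lineF_shift_of_le ha hb h τ ξ P
  · exact (lineF_shift_of_le hb ha h τ ξ P).symm

theorem truncF_neg (ξ : ℝ) (τ : ℤ) (v : ℂ) : truncF ξ τ (-v) = truncF (-ξ) τ v := by
  refine Finset.sum_congr rfl fun j _ => ?_
  push_cast
  rw [hermiteP_eq, hermiteP_eq, neg_neg, ofReal_neg, ← neg_one_mul (ξ : ℂ), ← neg_one_mul v,
    eval_mpoly_scale (b := -1) (by norm_num), mul_pow]
  have : ((-1 : ℂ) ^ j) * (-1) ^ j = 1 := by rw [← mul_pow]; simp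
  linear_combination ((mpoly (-1) j).eval (ξ : ℂ) / j ! * v ^ j) * this

/-- The line is moved from c to -c and v replaced by -v; each of v^τ and the polynomial of degree j
then contributes its parity. -/
theorem lineF_neg {c : ℝ} (hc : c ≠ 0) (τ : ℤ) (ξ : ℝ) (a : ℂ) (j : ℕ) :
    lineF c τ (-ξ) (mpoly a j) = (-1) ^ τ * (-1) ^ j * lineF c τ ξ (mpoly a j) := by
  rw [lineF_shift hc (neg_ne_zero.2 hc) τ ξ]
  unfold lineF
  rw [← lineInt_comp_neg, ← lineInt_const_mul]
  congr 1
  ext v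
  have h1 : (-1 : ℂ) ^ τ * (-1) ^ τ = 1 := by
    rw [← mul_zpow]
    simp
  have h2 : (-1 : ℂ) ^ j * (-1) ^ j = 1 := by
    rw [← mul_pow]
    simp
  rw [truncF_neg, neg_sq, ← neg_one_mul v, eval_mpoly_scale (b := a) (by norm_num), mul_zpow,
    show -(ξ : ℂ) * (-1 * v) = -((-ξ : ℝ) : ℂ) * v by push_cast; ring]
  generalize (cexp (-((-ξ : ℝ) : ℂ) * v) - cexp (v ^ 2 / 2) * truncF (-ξ) (-τ) v) = A
  linear_combination -(v ^ τ * A * (cexp (v ^ 2 / 2) * (mpoly a j).eval v))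
    * ((-1) ^ j * (-1) ^ j * h1 + h2)

theorem lineF_sign {c ε : ℝ} (hc : c ≠ 0) (hε : ε = 1 ∨ ε = -1) (τ : ℤ) (ξ : ℝ) (a : ℂ) (j : ℕ) :
    (ε : ℂ) ^ τ * (ε : ℂ) ^ j * lineF c τ (ε * ξ) (mpoly a j) = lineF c τ ξ (mpoly a j) := by
  rcases hε with rfl | rfl
  · simp
  · rw [neg_one_mul, lineF_neg hc]
    have h1 : (-1 : ℂ) ^ τ * (-1) ^ τ = 1 := by
      rw [← mul_zpow]
      simp
    have h2 : (-1 : ℂ) ^ j * (-1) ^ j = 1 := by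
      rw [← mul_pow]
      simp
    push_cast
    linear_combination (lineF c τ ξ (mpoly a j)) * ((-1) ^ j * (-1) ^ j * h1 + h2)

theorem partL2_eq_sum {δ c ε₁ ε₂ : ℝ} (hδ : 0 < δ) (hc : δ < c) (h₁ : ε₁ = 1 ∨ ε₁ = -1)
    (h₂ : ε₂ = 1 ∨ ε₂ = -1) (r : ℕ) (τ₁ : ℤ) (ξ₁ : ℝ) (τ₂ : ℤ) (ξ₂ : ℝ) :
    partL2 δ c ε₁ ε₂ r τ₁ ξ₁ τ₂ ξ₂ = ∑ j ∈ Finset.range r, (-2) ^ j * (2 * (√π : ℝ)) / j !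
      * lineF c (-τ₁) ξ₁ (mpoly (1 / 2) j) * lineF c τ₂ (-ξ₂) (mpoly (1 / 2) j) := by
  have hc0 : c ≠ 0 := (hδ.trans hc).ne'
  rw [partL2_eq hδ hc (sq_eq_one_iff.2 h₁) (sq_eq_one_iff.2 h₂)]
  refine Finset.sum_congr rfl fun j _ => ?_
  have hi : (ε₁ : ℂ) ^ τ₁ = (ε₁ : ℂ) ^ (-τ₁) := by
    rcases h₁ with rfl | rfl <;> simp [← inv_zpow, inv_neg]
  rw [hi, lineF_sign hc0 h₁, lineF_sign hc0 h₂]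

/-! ### The single integrals: contour independence and splitting -/

variable {a b c : ℝ}

/-- Here a pole at 0 is allowed, so both lines stay in the right half-plane. -/
theorem lineInt_half_shift (ha : 0 < a) (hb : 0 < b) {F g : ℂ → ℂ}
    (hd : ∀ z ≠ 0, DifferentiableAt ℂ g z)
    (hg : ∀ a b : ℝ, 0 < a → PolyGrowthOn (vstrip a b) g)
    (hF : ∀ v ≠ 0, F v = cexp ((1 / 2 : ℝ) * v ^ 2) * g v) :
    lineInt a F = lineInt b F := by
  have hne : ∀ {a b : ℝ}, 0 < a → ∀ z ∈ vstrip a b, z ≠ 0 := by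
    rintro a b h z hz rfl
    exact absurd hz.1 (not_le.2 (by simpa using h))
  have key : ∀ {a b : ℝ}, 0 < a → 0 < b → a ≤ b → lineInt a F = lineInt b F := by
    intro a b ha hb hab
    rw [lineInt_congr fun v hv => hF v (hne ha v hv), lineInt_congr fun v hv => hF v (hne hb v hv)]
    exact lineInt_shift hab (by norm_num)
      (fun z hz => (hd z (hne ha z hz)).differentiableWithinAt) (hg a b ha)
  rcases le_total a b with h | h
  · exact key ha hb h
  · exact (key hb ha h).symm

theorem differentiable_truncF (ξ : ℝ) (τ : ℤ) : Differentiable ℂ (truncF ξ τ) := by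
  unfold truncF
  fun_prop

theorem PolyGrowthOn.zpow_mul_cexp_mul_truncF (ha : 0 < a) (m : ℤ) (x ξ : ℝ) (τ : ℤ) :
    PolyGrowthOn (vstrip a b) fun v => v ^ m * (cexp (x * v) * Tacnode.truncF ξ τ v) :=
  (PolyGrowthOn.zpow ha m).mul ((PolyGrowthOn.cexp_mul x).mul (.truncF ξ τ))

theorem PolyGrowthOn.zpow_mul_cexp_sq_mul_truncF (ha : 0 < a) (m : ℤ) (ξ₁ ξ₂ : ℝ) (τ₁ τ₂ : ℤ) :
    PolyGrowthOn (vstrip a b) fun v => v ^ m * (cexp ((1 / 2 : ℝ) * v ^ 2)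
      * Tacnode.truncF ξ₁ τ₁ v * Tacnode.truncF ξ₂ τ₂ v) :=
  (PolyGrowthOn.zpow ha m).mul
    (((PolyGrowthOn.cexp_sq (by norm_num)).mul (.truncF ξ₁ τ₁)).mul (.truncF ξ₂ τ₂))

theorem partL11_shift (ha : 0 < a) (hb : 0 < b) (τ₁ : ℤ) (ξ₁ : ℝ) (τ₂ : ℤ) (ξ₂ : ℝ) :
    partL11 a τ₁ ξ₁ τ₂ ξ₂ = partL11 b τ₁ ξ₁ τ₂ ξ₂ := by
  refine lineInt_half_shift ha hb (g := fun v => v ^ (-(τ₁ - τ₂)) * (cexp (ξ₂ * v)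
    * truncF ξ₁ τ₁ v)) (fun z hz => ?_) (fun a b ha => .zpow_mul_cexp_mul_truncF ha _ _ _ _)
    fun v _ => ?_
  · have := differentiable_truncF ξ₁ τ₁
    exact (differentiableAt_zpow.2 (Or.inl hz)).mul (by fun_prop)
  · rw [← cexp_half_sq, zpow_neg]
    ring

theorem partL12_shift (ha : 0 < a) (hb : 0 < b) (τ₁ : ℤ) (ξ₁ : ℝ) (τ₂ : ℤ) (ξ₂ : ℝ) :
    partL12 a τ₁ ξ₁ τ₂ ξ₂ = partL12 b τ₁ ξ₁ τ₂ ξ₂ := by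
  refine lineInt_half_shift ha hb (g := fun v => v ^ (-(τ₁ - τ₂)) * (cexp ((-ξ₁ : ℝ) * v)
    * truncF (-ξ₂) (-τ₂) v)) (fun z hz => ?_) (fun a b ha => .zpow_mul_cexp_mul_truncF ha _ _ _ _)
    fun v _ => ?_
  · have := differentiable_truncF (-ξ₂) (-τ₂)
    exact (differentiableAt_zpow.2 (Or.inl hz)).mul (by fun_prop)
  · rw [← cexp_half_sq, zpow_neg, ofReal_neg]
    ring

theorem partL13_shift (ha : 0 < a) (hb : 0 < b) (τ₁ : ℤ) (ξ₁ : ℝ) (τ₂ : ℤ) (ξ₂ : ℝ) :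
    partL13 a τ₁ ξ₁ τ₂ ξ₂ = partL13 b τ₁ ξ₁ τ₂ ξ₂ := by
  refine lineInt_half_shift ha hb (g := fun v => -(v ^ (-(τ₁ - τ₂)) * (cexp ((1 / 2 : ℝ) * v ^ 2)
    * truncF ξ₁ τ₁ v * truncF (-ξ₂) (-τ₂) v))) (fun z hz => ?_)
    (fun a b ha => (PolyGrowthOn.zpow_mul_cexp_sq_mul_truncF ha _ _ _ _ _).neg) fun v _ => ?_
  · have h1 := differentiable_truncF ξ₁ τ₁
    have h2 := differentiable_truncF (-ξ₂) (-τ₂)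
    exact ((differentiableAt_zpow.2 (Or.inl hz)).mul (by fun_prop)).neg
  · rw [← cexp_half_sq, zpow_neg]
    ring

theorem partL1_eq_add (hc : 0 < c) (τ₁ : ℤ) (ξ₁ : ℝ) (τ₂ : ℤ) (ξ₂ : ℝ) :
    partL1 c τ₁ ξ₁ τ₂ ξ₂
      = partL11 c τ₁ ξ₁ τ₂ ξ₂ + partL12 c τ₁ ξ₁ τ₂ ξ₂ + partL13 c τ₁ ξ₁ τ₂ ξ₂ := by
  have h1 := (PolyGrowthOn.zpow_mul_cexp_mul_truncF (b := c) hc (-(τ₁ - τ₂)) ξ₂ ξ₁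
    τ₁).lineIntegrable_half
  have h2 := (PolyGrowthOn.zpow_mul_cexp_mul_truncF (b := c) hc (-(τ₁ - τ₂)) (-ξ₁) (-ξ₂)
    (-τ₂)).lineIntegrable_half
  have h3 := (PolyGrowthOn.zpow_mul_cexp_sq_mul_truncF (b := c) hc (-(τ₁ - τ₂)) ξ₁ (-ξ₂) τ₁
    (-τ₂)).neg.lineIntegrable_half
  unfold partL1 partL11 partL12 partL13
  rw [← lineInt_add, ← lineInt_add]
  · congr 1
    ext v
    ring
  · refine (h1.add h2).congr fun v _ => ?_
    rw [zpow_neg, ofReal_neg]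
    ring
  · refine h3.congr fun v _ => ?_
    rw [zpow_neg, ← cexp_half_sq]
    ring
  · refine h1.congr fun v _ => ?_
    rw [zpow_neg]
    ring
  · refine h2.congr fun v _ => ?_
    rw [zpow_neg, ofReal_neg]
    ring

end Tacnode

theorem theorem2p1 (r : ℕ) (τ₁ τ₂ : ℤ) (ξ₁ ξ₂ : ℝ)
    (δ c : ℝ) (hδ : 0 < δ) (hc : δ < c) (δ' c' : ℝ) (hδ' : 0 < δ') (hc' : δ' < c') :
    Tacnode.Theta c r 0 0 0 0 ≠ 0 ∧
    (∀ ε₁ ε₂ : ℝ, (ε₁ = 1 ∨ ε₁ = -1) → (ε₂ = 1 ∨ ε₂ = -1) →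
      ((√2 : ℝ) : ℂ) ^ (τ₂ - τ₁)
          * Tacnode.dTac δ c r 0 0 τ₁ (ξ₁ * √2) τ₂ (ξ₂ * √2) * ((√2 : ℝ) : ℂ)
        = Tacnode.partL0 τ₁ ξ₁ τ₂ ξ₂
          + Tacnode.partL1 c' τ₁ ξ₁ τ₂ ξ₂
          + Tacnode.partL2 δ' c' ε₁ ε₂ r τ₁ ξ₁ τ₂ ξ₂) ∧
    Tacnode.partL1 c' τ₁ ξ₁ τ₂ ξ₂
      = Tacnode.partL11 c' τ₁ ξ₁ τ₂ ξ₂ + Tacnode.partL12 c' τ₁ ξ₁ τ₂ ξ₂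
        + Tacnode.partL13 c' τ₁ ξ₁ τ₂ ξ₂ ∧
    (∀ ε₁ ε₂ ε₁' ε₂' : ℝ, (ε₁ = 1 ∨ ε₁ = -1) → (ε₂ = 1 ∨ ε₂ = -1) →
      (ε₁' = 1 ∨ ε₁' = -1) → (ε₂' = 1 ∨ ε₂' = -1) →
      Tacnode.partL2 δ' c' ε₁ ε₂ r τ₁ ξ₁ τ₂ ξ₂
        = Tacnode.partL2 δ' c' ε₁' ε₂' r τ₁ ξ₁ τ₂ ξ₂) := by
  have hc0 : 0 < c := hδ.trans hc
  have hc0' : 0 < c' := hδ'.trans hc'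
  have hs : 0 < √2 * c := mul_pos Tacnode.sqrt_two_pos hc0
  refine ⟨Tacnode.Theta_zero_zero_ne_zero hc0 r, fun ε₁ ε₂ h₁ h₂ => ?_,
    Tacnode.partL1_eq_add hc0' τ₁ ξ₁ τ₂ ξ₂, fun ε₁ ε₂ ε₁' ε₂' h₁ h₂ h₁' h₂' => ?_⟩
  -- The rescaled left side lives on Re v = √2 c; every line integral is moved to Re v = c', and δ'
  -- no longer occurs once the operators have been evaluated.
  · rw [Tacnode.dTac_scaled hδ hc, Tacnode.partL1_eq_add hc0', Tacnode.partL2_eq_sum hδ' hc' h₁ h₂,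
      Tacnode.partL11_shift hs hc0', Tacnode.partL12_shift hs hc0', Tacnode.partL13_shift hs hc0']
    simp only [Tacnode.lineF_shift hs.ne' hc0'.ne']
  · rw [Tacnode.partL2_eq_sum hδ' hc' h₁ h₂, Tacnode.partL2_eq_sum hδ' hc' h₁' h₂']
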